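/- Fix a dimension $d\ge 1$, $\beta>0$ and $a>b>0$. **Model.** Let $q_k=(4\pi\beta)^{-d/2}k^{-1-d/2}$, $k\in\mathbb N=\{1,2,\dots\}$. For $\alpha<0$ and a centred box $\Lambda\subset\mathbb R^d$ of volume $|\Lambda|$, let under the reference law $\mathsf Q_\Lambda$ the numbers $N_k=|\Lambda|\lambda_k$, $k\in\mathbb N$, be independent Poisson variables with parameters $|\Lambda|q_k e^{\beta\alpha k}$, i.e. $\mathsf Q_\Lambda(N_k=n_k\ \forall k)=e^{-|\Lambda|\sum_k q_ke^{\beta\alpha k}}\prod_k \frac{(|\Lambda|q_ke^{\beta\alpha k})^{n_k}}{n_k!}$ for finitely supported $(n_k)\in\mathbb N_0^{\mathbb N}$. For $\mu\in\mathbb R$ and a cut-off $m_\Lambda\in\mathbb N_0$ let $$H_\Lambda=|\Lambda|\Big(-(\mu-\alpha)\sum_{k}k\lambda_k+\frac a2\Big(\sum_k k\lambda_k\Big)^2-\frac b2\sum_{k\ge m_\Lambda}k^2\lambda_k^2\Big),\qquad \frac{d\mathsf P_\Lambda}{d\mathsf Q_\Lambda}=\frac{e^{-\beta H_\Lambda}}{\mathsf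 E_{\mathsf Q_\Lambda}[e^{-\beta H_\Lambda}]},\qquad \mathbf M_\Lambda=\Big(\sum_{k<m_\Lambda}k\lambda_k,\ \sum_{k\ge m_\Lambda}k\lambda_k\Big).$$ For $\kappa\in[0,\infty]$, $\Lambda\uparrow\mathbb R^d$ denotes the limit along a sequence of centred boxes with $|\Lambda|\to\infty$, $m_\Lambda\to\infty$ and $m_\Lambda/|\Lambda|\to\kappa$. **Rate function.** Let $p_0(\beta,s)=\frac1\beta\sum_{k\ge1}q_ke^{\beta sk}\in[0,\infty]$, $f_0(\beta,x)=\sup_{s\in\mathbb R}\{sx-p_0(\beta,s)\}$ and $K(\kappa)=[0,\infty)\times(\{0\}\cup[\kappa,\infty))$, with $K(\infty)=[0,\infty)\times\{0\}$. Put $$I^{(\kappa)}(x,y)=f_0(\beta,x)-\mu(x+y)+\frac a2(x+y)^2-\frac b2y^2+\sup_{(u,v)\in K(\kappa)}\Big\{\mu(u+v)-\frac a2(u+v)^2+\frac b2v^2-f_0(\beta,u)\Big\}$$ for $(x,y)\in K(\kappa)$, and $I^{(\kappa)}=+\infty$ otherwise. Let $\mathscr M^{(\kappa)}(\mu)$ be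 the set of zeroes of $I^{(\kappa)}$. **Critical parameters.** Let $\varrho_c=(4\pi\beta)^{-d/2}\zeta(d/2)$ for $d\ge3$ and $\varrho_c=\infty$ for $d=1,2$; $\mu_c=a\varrho_c$. For $x>0$ let $s_\beta(x)=0$ if $x\ge\varrho_c$, and otherwise let $s_\beta(x)$ be the unique $s<0$ with $\partial_sp_0(\beta,s)=x$. Let $\mu_t=\inf_{s<0}\{a\,\partial_sp_0(\beta,s)-\frac{a-b}{b}s\}$. Let $\tilde x_1(\mu)$ be the unique $x>0$ with $s_\beta(x)=\mu-ax$; for $\mu\ge\mu_t$ let $\tilde x_2(\mu)$ be the minimal $x>0$ with $s_\beta(x)=-\frac b{a-b}(\mu-ax)$. For $\kappa\in(0,\infty)$ let $\tilde x_3(\mu)=\tilde x_1(\mu-a\kappa)$ and $\mu_r=\inf\{s\ge\mu_t:\tilde x_2(s)\le\frac1a(s-\kappa(a-b))\}$. **Corollary (Thermodynamic limit of the pair particle density).** Let $\kappa\in[0,\infty]$, $\mu\in\mathbb R$ and $\alpha<0$. If $I^{(\kappa)}$ has a unique zero $(x,y)$, then, for every such sequence $(\Lambda,m_\Lambda)$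 and every $\delta>0$, $$\lim_{\Lambda\uparrow\mathbb R^d}\mathsf P_\Lambda\big(\mathbf M_\Lambda\in B_\delta(x,y)\big)=1,$$ where $B_\delta(x,y)$ is the open Euclidean ball. The zero is unique in the following cases. * $\kappa=\infty$: for all $\mu\in\mathbb R$, $\mathscr M^{(\infty)}(\mu)=\{(\tilde x_1(\mu),0)\}$. * $\kappa=0$: there is $\mu^*\in\mathbb R$ with $\mu_t\le\mu^*\le\mu_c$ such that $\mathscr M^{(0)}(\mu)=\{(\tilde x_1(\mu),0)\}$ for $\mu<\mu^*$ and $\mathscr M^{(0)}(\mu)=\{(\tilde x_2(\mu),\frac{\mu-a\tilde x_2(\mu)}{a-b})\}$ for $\mu>\mu^*$. * $\kappa\in(0,\infty)$: there is $\mu^*_\kappa\in\mathbb R$, equal to $\mu^*$ if $\mu_r\le\mu^*$ and lying in $(\mu^*,\mu_r)$ if $\mu_r>\mu^*$, such that $\mathscr M^{(\kappa)}(\mu)$ is $\{(\tilde x_1(\mu),0)\}$ for $\mu<\mu^*_\kappa$, $\{(\tilde x_3(\mu),\kappa)\}$ for $\mu^*_\kappa<\mu\le\mu_r$, and $\{(\tilde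 x_2(\mu),\frac{\mu-a\tilde x_2(\mu)}{a-b})\}$ for $\mu>\mu^*_\kappa$ with $\mu\ge\mu_r$. -/

import Mathlib

open MeasureTheory Filter Topology
open scoped ENNReal

namespace HYL

noncomputable section

/-- The weight `q_k = 1 / ((4πβ)^{d/2} k^{1+d/2})` of a cycle of length `k` in dimension `d`. -/
def cycleWeight (d : ℕ) (β : ℝ) (k : ℕ+) : ℝ :=
  1 / ((4 * Real.pi * β) ^ ((d : ℝ) / 2) * ((k : ℕ) : ℝ) ^ (1 + (d : ℝ) / 2))

/-- A cycle configuration: `n k` is the number of cycles of length `k ≥ 1`; only finitely many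
cycles are present. In volume `V` the bosonic cycle count is `λ_k = n k / V`. -/
abbrev CycleCounts : Type := ℕ+ →₀ ℕ

instance : MeasurableSpace CycleCounts := ⊤

/-- The bosonic cycle count (number density) `λ_k` in volume `V`. -/
def cycleDensity (V : ℝ) (n : CycleCounts) (k : ℕ+) : ℝ := (n k : ℝ) / V

/-- `q̄^{(α)} = ∑_k q_k e^{βαk}`. -/
def totalWeight (d : ℕ) (β α : ℝ) : ℝ :=
  ∑' k : ℕ+, cycleWeight d β k * Real.exp (β * α * (k : ℕ))

/-- The probability, under the ideal Bose gas reference process in volume `V`, of the cycle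
configuration `n`: the numbers of cycles of the different lengths `k` are independent Poisson
variables with parameters `V q_k e^{βαk}`. -/
def referenceWeight (d : ℕ) (β α V : ℝ) (n : CycleCounts) : ℝ :=
  Real.exp (-(V * totalWeight d β α)) *
    ∏ k ∈ n.support,
      (V * cycleWeight d β k * Real.exp (β * α * (k : ℕ))) ^ (n k) / (Nat.factorial (n k) : ℝ)

/-- The law of the cycle configuration under the reference process. -/
def referenceMeasure (d : ℕ) (β α V : ℝ) : Measure CycleCounts :=
  Measure.sum fun n => ENNReal.ofReal (referenceWeight d β α V n) • Measure.dirac n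

/-- The density `∑_{k < m} k λ_k` of particles in cycles shorter than `m`. -/
def shortDensity (V : ℝ) (m : ℕ) (n : CycleCounts) : ℝ :=
  ∑ k ∈ n.support with PNat.val k < m, (k : ℕ) * cycleDensity V n k

/-- The density `∑_{k ≥ m} k λ_k` of particles in cycles of length at least `m`. -/
def longDensity (V : ℝ) (m : ℕ) (n : CycleCounts) : ℝ :=
  ∑ k ∈ n.support with m ≤ PNat.val k, (k : ℕ) * cycleDensity V n k

/-- The pair empirical particle density. -/
def pairDensity (V : ℝ) (m : ℕ) (n : CycleCounts) : EuclideanSpace ℝ (Fin 2) :=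
  !₂[shortDensity V m n, longDensity V m n]

/-- The Hamiltonian of the spatial cycle HYL model in volume `V` with cut-off `m`. -/
def hamiltonian (a b α μ V : ℝ) (m : ℕ) (n : CycleCounts) : ℝ :=
  V * (-(μ - α) * ∑ k ∈ n.support, (k : ℕ) * cycleDensity V n k
    + a / 2 * (∑ k ∈ n.support, (k : ℕ) * cycleDensity V n k) ^ 2
    - b / 2 * ∑ k ∈ n.support with m ≤ PNat.val k, ((k : ℕ) : ℝ) ^ 2 * cycleDensity V n k ^ 2)

/-- The Gibbs distribution of the spatial cycle HYL model: it has density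
`e^{-βH} / E[e^{-βH}]` with respect to the reference process. -/
def gibbsMeasure (d : ℕ) (β a b α μ V : ℝ) (m : ℕ) : Measure CycleCounts :=
  (referenceMeasure d β α V).tilted fun n => -β * hamiltonian a b α μ V m n

/-- The centred box in `ℝ^d` with side lengths `ℓ`. -/
def centredBox {d : ℕ} (ℓ : Fin d → ℝ) : Set (Fin d → ℝ) :=
  Set.univ.pi fun i => Set.Icc (-(ℓ i) / 2) (ℓ i / 2)

/-- The volume of the centred box with side lengths `ℓ`. -/
def boxVolume {d : ℕ} (ℓ : Fin d → ℝ) : ℝ := (volume : Measure (Fin d → ℝ)).real (centredBox ℓ)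

/-- A sequence of centred boxes with volumes tending to infinity, together with cut-offs `m`
such that `m → ∞` and `m / |Λ| → κ ∈ [0, ∞]`. -/
structure IsThermodynamicSequence {d : ℕ} (κ : ℝ≥0∞) (ℓ : ℕ → Fin d → ℝ) (m : ℕ → ℕ) : Prop where
  side_pos : ∀ j i, 0 < ℓ j i
  tendsto_volume : Tendsto (fun j => boxVolume (ℓ j)) atTop atTop
  tendsto_cutoff : Tendsto m atTop atTop
  tendsto_ratio : Tendsto (fun j => ENNReal.ofReal ((m j : ℝ) / boxVolume (ℓ j))) atTop (𝓝 κ)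

/-- The pair empirical particle density converges to `(x, y)` in probability under the Gibbs
distributions, along every thermodynamic sequence of parameter `κ`. -/
def PairDensityConcentratesAt (d : ℕ) (β a b α μ : ℝ) (κ : ℝ≥0∞) (x y : ℝ) : Prop :=
  ∀ (ℓ : ℕ → Fin d → ℝ) (m : ℕ → ℕ), IsThermodynamicSequence κ ℓ m → ∀ δ : ℝ, 0 < δ →
    Tendsto (fun j => gibbsMeasure d β a b α μ (boxVolume (ℓ j)) (m j)
      {n | pairDensity (boxVolume (ℓ j)) (m j) n ∈ Metric.ball !₂[x, y] δ}) atTop (𝓝 1)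

/-- The ideal Bose gas pressure `p₀(β, s) = β⁻¹ ∑_k q_k e^{βsk} ∈ [0, ∞]`
(it equals `∞` for `s > 0`). -/
def idealPressure (d : ℕ) (β s : ℝ) : ℝ≥0∞ :=
  ENNReal.ofReal (1 / β) *
    ∑' k : ℕ+, ENNReal.ofReal (cycleWeight d β k * Real.exp (β * s * (k : ℕ)))

/-- The ideal Bose gas free energy `f₀(β, x) = sup_s {s x - p₀(β, s)}`. -/
def idealFreeEnergy (d : ℕ) (β x : ℝ) : EReal :=
  ⨆ s : ℝ, ((s * x : ℝ) : EReal) - (idealPressure d β s : EReal)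

/-- The set `ℝ₊ × ({0} ∪ [κ, ∞))`; for `κ = ∞` it is `ℝ₊ × {0}`. -/
def admissible (κ : ℝ≥0∞) : Set (ℝ × ℝ) :=
  {z | 0 ≤ z.1 ∧ (z.2 = 0 ∨ (0 ≤ z.2 ∧ κ ≤ ENNReal.ofReal z.2))}

/-- The variational pressure
`sup {μ(x+y) - a/2 (x+y)² + b/2 y² - f₀(β,x)}` over the admissible `(x, y)`. -/
def pressure (d : ℕ) (β a b μ : ℝ) (κ : ℝ≥0∞) : EReal :=
  ⨆ z ∈ admissible κ,
    ((μ * (z.1 + z.2) - a / 2 * (z.1 + z.2) ^ 2 + b / 2 * z.2 ^ 2 : ℝ) : EReal)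
      - idealFreeEnergy d β z.1

open Classical in
/-- The rate function `I^{(κ)}`. -/
def rateFunction (d : ℕ) (β a b μ : ℝ) (κ : ℝ≥0∞) (z : ℝ × ℝ) : EReal :=
  if z ∈ admissible κ then
    idealFreeEnergy d β z.1
      + ((-μ * (z.1 + z.2) + a / 2 * (z.1 + z.2) ^ 2 - b / 2 * z.2 ^ 2 : ℝ) : EReal)
      + pressure d β a b μ κ
  else ⊤

/-- The zeroes of the rate function. -/
def zeroes (d : ℕ) (β a b μ : ℝ) (κ : ℝ≥0∞) : Set (ℝ × ℝ) :=
  {z | rateFunction d β a b μ κ z = 0}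

/-- The derivative `p₀'(β, s)` of the ideal pressure in `s` (used for `s < 0`). -/
def idealPressureDeriv (d : ℕ) (β s : ℝ) : ℝ :=
  deriv (fun t => (idealPressure d β t).toReal) s

open Classical in
/-- The critical density of the ideal Bose gas: `ζ(d/2) / (4πβ)^{d/2}` for `d ≥ 3`,
and `∞` for `d = 1, 2`. -/
def criticalDensity (d : ℕ) (β : ℝ) : ℝ≥0∞ :=
  if 3 ≤ d then
    ENNReal.ofReal (1 / (4 * Real.pi * β) ^ ((d : ℝ) / 2) *
      ∑' k : ℕ+, 1 / ((k : ℕ) : ℝ) ^ ((d : ℝ) / 2))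
  else ⊤

open Classical in
/-- `s_β(x)`: it is `0` above the critical density, and below it the unique solution `s < 0` of
`p₀'(β, s) = x`. -/
def sBeta (d : ℕ) (β x : ℝ) : ℝ :=
  if criticalDensity d β ≤ ENNReal.ofReal x then 0
  else Classical.epsilon fun s : ℝ => s < 0 ∧ idealPressureDeriv d β s = x

/-- `μ_t(β) = inf_{s<0} {a p₀'(β, s) - (a-b)/b s}`. -/
def muT (d : ℕ) (β a b : ℝ) : ℝ :=
  sInf ((fun s => a * idealPressureDeriv d β s - (a - b) / b * s) '' Set.Iio 0)

/-- `μ_c = a ϱ_c`, possibly infinite. -/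
def muC (d : ℕ) (β a : ℝ) : ℝ≥0∞ := ENNReal.ofReal a * criticalDensity d β

/-- `x̃₁(μ)`: the unique `x > 0` with `s_β(x) = μ - a x`. -/
def xOne (d : ℕ) (β a μ : ℝ) : ℝ :=
  Classical.epsilon fun x : ℝ => 0 < x ∧ sBeta d β x = μ - a * x

/-- `x̃₂(μ)`, for `μ ≥ μ_t`: the minimal `x > 0` with `s_β(x) = -b/(a-b) (μ - a x)`. -/
def xTwo (d : ℕ) (β a b μ : ℝ) : ℝ :=
  Classical.epsilon fun x : ℝ =>
    IsLeast {x : ℝ | 0 < x ∧ sBeta d β x = -(b / (a - b)) * (μ - a * x)} x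

/-- `x̃₃(μ) = x̃₁(μ - aκ)`. -/
def xThree (d : ℕ) (β a κ μ : ℝ) : ℝ := xOne d β a (μ - a * κ)

/-- `μ_r(β, κ) = inf {s ≥ μ_t : x̃₂(s) ≤ (s - κ(a-b))/a}`. -/
def muR (d : ℕ) (β a b κ : ℝ) : ℝ :=
  sInf {s : ℝ | muT d β a b ≤ s ∧ xTwo d β a b s ≤ 1 / a * (s - κ * (a - b))}

end

end HYL

/-!
Write `energy` for the rate function without its normalisation, so that the zeroes of the rate
function are the minimisers of `energy` over the admissible set.

*Concentration.* The Gibbs weight of the configurations with pair density near `z` is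
`exp (-β V (energy z + o(1)))`. From above, the quadratic reward of the long cycles is at most
`b / 2 * (∑ k λₖ)²` and the logarithm of their total weight is `o(V)` because `m → ∞`, while the
short cycles are controlled by an exponential tilt. From below, finitely many short cycle lengths
carry the density `x` at the price `gasFreeEnergy x`, and one cycle of length about `y V` carries
the density `y` at no exponential price.

*Minimisers.* At a minimiser `(x, y)` one has `sBeta x = μ - a (x + y)`. If `y = 0`, then `x` is
`xOne μ`; if `y = κ` is on the boundary, then `x` is `xThree μ`; otherwise also
`(a - b) y = μ - a x`, and the first order condition becomes `criticalPotential x = μ`.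
Parametrised by the slope `s < 0`, `criticalPotential` is strictly convex, so among its solutions
only the smallest one, `xTwo μ`, can be a minimiser.

*Transitions.* The maximal value of `-energy` over pairs with long cycles has derivative `x + y` in
`μ`, which grows with rate `1 / (a - b)`, whereas without long cycles the rate is at most
`1 / a`. Hence condensation, once it occurs, persists for all larger `μ`. For `0 < κ < ∞` the same
comparison is made with `y = κ` fixed, until `muR`, where the unconstrained optimal long density
reaches `κ`.
-/

namespace HYL

section ExponentialSeries

/-- The exponential series `∑_k w_k e^{tk}`. The pressure of the ideal Bose gas is the case
`w_k = q_k` and its density the case `w_k = k q_k`, both at `t = βs`. -/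
noncomputable def expSeries (w : ℕ+ → ℝ) (t : ℝ) : ℝ :=
  ∑' k : ℕ+, w k * Real.exp (t * (k : ℕ))

variable {w : ℕ+ → ℝ} {s t C : ℝ}

theorem cast_pnat_pos (k : ℕ+) : (0 : ℝ) < (k : ℕ) := by exact_mod_cast k.pos

theorem one_le_cast_pnat (k : ℕ+) : (1 : ℝ) ≤ (k : ℕ) := by exact_mod_cast k.pos

theorem exp_mul_pnat_le_one (ht : t ≤ 0) (k : ℕ+) : Real.exp (t * (k : ℕ)) ≤ 1 :=
  Real.exp_le_one_iff.2 (mul_nonpos_of_nonpos_of_nonneg ht (Nat.cast_nonneg _))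

theorem summable_mul_exp_of_summable (hw : ∀ k, 0 ≤ w k) (hs : Summable w) (ht : t ≤ 0) :
    Summable fun k => w k * Real.exp (t * (k : ℕ)) :=
  hs.of_nonneg_of_le (fun k => mul_nonneg (hw k) (Real.exp_pos _).le)
    fun k => mul_le_of_le_one_right (hw k) (exp_mul_pnat_le_one ht k)

theorem summable_mul_exp_of_le_linear (hw : ∀ k, 0 ≤ w k) (hC : ∀ k, w k ≤ C * (k : ℕ))
    (ht : t < 0) : Summable fun k => w k * Real.exp (t * (k : ℕ)) := by
  have hlin : Summable fun k : ℕ+ => ((k : ℕ) : ℝ) ^ 1 * Real.exp (-(-t) * (k : ℕ)) :=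
    (Real.summable_pow_mul_exp_neg_nat_mul 1 (neg_pos.2 ht)).comp_injective PNat.coe_injective
  refine (hlin.mul_left C).of_nonneg_of_le
    (fun k => mul_nonneg (hw k) (Real.exp_pos _).le) fun k => ?_
  rw [pow_one, neg_neg, ← mul_assoc]
  exact mul_le_mul_of_nonneg_right (hC k) (Real.exp_pos _).le

theorem expSeries_nonneg (hw : ∀ k, 0 ≤ w k) : 0 ≤ expSeries w t :=
  tsum_nonneg fun k => mul_nonneg (hw k) (Real.exp_pos _).le

theorem expSeries_pos (hw : ∀ k, 0 < w k) (ht : Summable fun k => w k * Real.exp (t * (k : ℕ))) :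
    0 < expSeries w t :=
  ht.tsum_pos (fun k => mul_nonneg (hw k).le (Real.exp_pos _).le) 1
    (mul_pos (hw 1) (Real.exp_pos _))

theorem expSeries_zero (w : ℕ+ → ℝ) : expSeries w 0 = ∑' k, w k := by simp [expSeries]

theorem strictMonoOn_expSeries (hw : ∀ k, 0 < w k)
    (hs : ∀ t < 0, Summable fun k => w k * Real.exp (t * (k : ℕ))) :
    StrictMonoOn (expSeries w) (Set.Iio 0) := by
  intro s hs0 t ht0 hst
  have hterm (k : ℕ+) : w k * Real.exp (s * (k : ℕ)) < w k * Real.exp (t * (k : ℕ)) := by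
    have := hw k
    have := cast_pnat_pos k
    gcongr
  exact (hs s hs0).tsum_lt_tsum (i := 1) (fun k => (hterm k).le) (hterm 1) (hs t ht0)

theorem strictConvexOn_expSeries (hw : ∀ k, 0 < w k)
    (hs : ∀ t < 0, Summable fun k => w k * Real.exp (t * (k : ℕ))) :
    StrictConvexOn ℝ (Set.Iio 0) (expSeries w) := by
  refine ⟨convex_Iio _, fun s hs0 t ht0 hst u v hu hv huv => ?_⟩
  have hst0 : u • s + v • t < 0 := convex_Iio (0 : ℝ) hs0 ht0 hu.le hv.le huv
  have hterm (k : ℕ+) : w k * Real.exp ((u • s + v • t) * (k : ℕ)) <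
      u * (w k * Real.exp (s * (k : ℕ))) + v * (w k * Real.exp (t * (k : ℕ))) := by
    have hconv := strictConvexOn_exp.2 (Set.mem_univ (s * (k : ℕ))) (Set.mem_univ (t * (k : ℕ)))
      (fun h => hst (mul_right_cancel₀ (cast_pnat_pos k).ne' h)) hu hv huv
    calc w k * Real.exp ((u • s + v • t) * (k : ℕ))
        = w k * Real.exp (u • (s * (k : ℕ)) + v • (t * (k : ℕ))) := by
          simp only [smul_eq_mul]; ring_nf
      _ < w k * (u • Real.exp (s * (k : ℕ)) + v • Real.exp (t * (k : ℕ))) :=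
          mul_lt_mul_of_pos_left hconv (hw k)
      _ = _ := by simp only [smul_eq_mul]; ring
  have hs' := (hs s hs0).mul_left u
  have ht' := (hs t ht0).mul_left v
  simp only [expSeries, smul_eq_mul (a := u) (b := ∑' _, _), smul_eq_mul (a := v) (b := ∑' _, _)]
  rw [← tsum_mul_left, ← tsum_mul_left, ← hs'.tsum_add ht']
  exact (hs _ hst0).tsum_lt_tsum (i := 1) (fun k => (hterm k).le) (hterm 1) (hs'.add ht')

theorem tendsto_expSeries_atBot (hw : ∀ k, 0 ≤ w k)
    (hs : ∀ t < 0, Summable fun k => w k * Real.exp (t * (k : ℕ))) :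
    Tendsto (expSeries w) atBot (𝓝 0) := by
  have hle : ∀ t ≤ -1, expSeries w t ≤ Real.exp (t + 1) * expSeries w (-1) := fun t ht => by
    rw [expSeries, expSeries, ← tsum_mul_left]
    refine (hs t (by linarith)).tsum_le_tsum (fun k => ?_) ((hs (-1) (by norm_num)).mul_left _)
    rw [mul_left_comm, ← Real.exp_add]
    refine mul_le_mul_of_nonneg_left (Real.exp_le_exp.2 ?_) (hw k)
    nlinarith [one_le_cast_pnat k]
  have hexp : Tendsto (fun t => Real.exp (t + 1) * expSeries w (-1)) atBot (𝓝 0) := by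
    simpa only [zero_mul, id_eq, Function.comp_def] using (Real.tendsto_exp_atBot.comp
      (tendsto_atBot_add_const_right _ 1 tendsto_id)).mul_const (expSeries w (-1))
  exact tendsto_of_tendsto_of_tendsto_of_le_of_le' tendsto_const_nhds hexp
    (.of_forall fun t => expSeries_nonneg hw) ((eventually_le_atBot (-1)).mono hle)

theorem expSeries_add_mul_sub_le (hw : ∀ k, 0 ≤ w k)
    (hs : Summable fun k => w k * Real.exp (s * (k : ℕ)))
    (hs' : Summable fun k : ℕ+ => (k : ℕ) * w k * Real.exp (s * (k : ℕ)))
    (ht : Summable fun k => w k * Real.exp (t * (k : ℕ))) :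
    expSeries w s + expSeries (fun k => (k : ℕ) * w k) s * (t - s) ≤ expSeries w t := by
  rw [expSeries, expSeries, expSeries, ← tsum_mul_right, ← hs.tsum_add (hs'.mul_right _)]
  refine (hs.add (hs'.mul_right _)).tsum_le_tsum (fun k => ?_) ht
  calc w k * Real.exp (s * (k : ℕ)) + (k : ℕ) * w k * Real.exp (s * (k : ℕ)) * (t - s)
      = w k * Real.exp (s * (k : ℕ)) * ((t - s) * (k : ℕ) + 1) := by ring
    _ ≤ w k * Real.exp (s * (k : ℕ)) * Real.exp ((t - s) * (k : ℕ)) :=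
        mul_le_mul_of_nonneg_left (Real.add_one_le_exp _) (mul_nonneg (hw k) (Real.exp_pos _).le)
    _ = w k * Real.exp (t * (k : ℕ)) := by rw [mul_assoc, ← Real.exp_add]; ring_nf

theorem ofReal_expSeries (hw : ∀ k, 0 ≤ w k)
    (ht : Summable fun k => w k * Real.exp (t * (k : ℕ))) :
    ENNReal.ofReal (expSeries w t) = ∑' k, ENNReal.ofReal (w k * Real.exp (t * (k : ℕ))) :=
  ENNReal.ofReal_tsum_of_nonneg (fun k => mul_nonneg (hw k) (Real.exp_pos _).le) ht

theorem ofReal_expSeries_le_tsum (hw : ∀ k, 0 ≤ w k) (ht : t ≤ 0)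
    (hs : Summable fun k => w k * Real.exp (t * (k : ℕ))) :
    ENNReal.ofReal (expSeries w t) ≤ ∑' k, ENNReal.ofReal (w k) := by
  rw [ofReal_expSeries hw hs]
  exact ENNReal.tsum_le_tsum fun k =>
    ENNReal.ofReal_le_ofReal (mul_le_of_le_one_right (hw k) (exp_mul_pnat_le_one ht k))

theorem exists_lt_expSeries (hw : ∀ k, 0 ≤ w k)
    (hs : ∀ t < 0, Summable fun k => w k * Real.exp (t * (k : ℕ))) {x : ℝ}
    (hx : ENNReal.ofReal x < ∑' k, ENNReal.ofReal (w k)) : ∃ t < 0, x < expSeries w t := by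
  rw [ENNReal.tsum_eq_iSup_sum, lt_iSup_iff] at hx
  obtain ⟨A, hA⟩ := hx
  rw [← ENNReal.ofReal_sum_of_nonneg fun k _ => hw k] at hA
  have hcont : Continuous fun t : ℝ => ∑ k ∈ A, w k * Real.exp (t * (k : ℕ)) := by fun_prop
  have hnear : ∀ᶠ t in 𝓝[<] (0 : ℝ), x < ∑ k ∈ A, w k * Real.exp (t * (k : ℕ)) := by
    refine nhdsWithin_le_nhds (hcont.continuousAt.eventually_const_lt ?_)
    simpa using (ENNReal.ofReal_lt_ofReal_iff'.1 hA).1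
  obtain ⟨t, hxt, ht⟩ := (hnear.and self_mem_nhdsWithin).exists
  exact ⟨t, ht, hxt.trans_le
    ((hs t ht).sum_le_tsum A fun k _ => mul_nonneg (hw k) (Real.exp_pos _).le)⟩

end ExponentialSeries

section IdealGas

variable {d : ℕ} {β : ℝ}

theorem cycleWeight_pos (hβ : 0 < β) (k : ℕ+) : 0 < cycleWeight d β k := by
  have := cast_pnat_pos k
  have := Real.pi_pos
  unfold cycleWeight
  positivity

theorem cast_mul_cycleWeight_pos (hβ : 0 < β) (k : ℕ+) : 0 < (k : ℕ) * cycleWeight d β k :=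
  mul_pos (cast_pnat_pos k) (cycleWeight_pos hβ k)

theorem cycleWeight_eq_mul (d : ℕ) (β : ℝ) (k : ℕ+) : cycleWeight d β k =
    1 / (4 * Real.pi * β) ^ ((d : ℝ) / 2) * (1 / ((k : ℕ) : ℝ) ^ (1 + (d : ℝ) / 2)) := by
  rw [cycleWeight, div_mul_div_comm, one_mul]

theorem cast_mul_cycleWeight (d : ℕ) (β : ℝ) (k : ℕ+) : (k : ℕ) * cycleWeight d β k =
    1 / (4 * Real.pi * β) ^ ((d : ℝ) / 2) * (1 / ((k : ℕ) : ℝ) ^ ((d : ℝ) / 2)) := by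
  have hk := cast_pnat_pos k
  rw [cycleWeight_eq_mul, Real.rpow_add hk, Real.rpow_one]
  field_simp

theorem summable_one_div_pnat_rpow {p : ℝ} :
    Summable (fun k : ℕ+ => 1 / ((k : ℕ) : ℝ) ^ p) ↔ 1 < p := by
  rw [← Real.summable_one_div_nat_rpow]
  exact summable_pnat_iff_summable_nat (f := fun n : ℕ => 1 / (n : ℝ) ^ p)

theorem summable_cycleWeight (hd : 1 ≤ d) : Summable (cycleWeight d β) := by
  have hp : (1 : ℝ) < 1 + (d : ℝ) / 2 := by
    have : (1 : ℝ) ≤ d := by exact_mod_cast hd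
    linarith
  exact ((summable_one_div_pnat_rpow.2 hp).mul_left _).congr fun k =>
    (cycleWeight_eq_mul d β k).symm

theorem summable_cast_mul_cycleWeight_iff (hβ : 0 < β) :
    (Summable fun k : ℕ+ => (k : ℕ) * cycleWeight d β k) ↔ 3 ≤ d := by
  have hc : 1 / (4 * Real.pi * β) ^ ((d : ℝ) / 2) ≠ 0 := by
    have := Real.pi_pos
    positivity
  simp_rw [cast_mul_cycleWeight, summable_mul_left_iff hc, summable_one_div_pnat_rpow]
  rw [lt_div_iff₀ two_pos, one_mul]
  exact_mod_cast Nat.lt_iff_add_one_le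

theorem criticalDensity_eq_tsum (hβ : 0 < β) :
    criticalDensity d β = ∑' k : ℕ+, ENNReal.ofReal ((k : ℕ) * cycleWeight d β k) := by
  have hnn (k : ℕ+) : 0 ≤ (k : ℕ) * cycleWeight d β k := (cast_mul_cycleWeight_pos hβ k).le
  unfold criticalDensity
  split_ifs with h
  · rw [← ENNReal.ofReal_tsum_of_nonneg hnn ((summable_cast_mul_cycleWeight_iff hβ).2 h)]
    simp_rw [cast_mul_cycleWeight, tsum_mul_left]
  · by_contra hne
    refine h ((summable_cast_mul_cycleWeight_iff hβ).1 ?_)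
    simpa only [ENNReal.toReal_ofReal (hnn _)] using ENNReal.summable_toReal (Ne.symm hne)

theorem cast_mul_cycleWeight_le (hβ : 0 < β) (k : ℕ+) :
    (k : ℕ) * cycleWeight d β k ≤ 1 / (4 * Real.pi * β) ^ ((d : ℝ) / 2) * (k : ℕ) := by
  have hk := one_le_cast_pnat k
  have := Real.pi_pos
  have hpow : 1 ≤ ((k : ℕ) : ℝ) ^ ((d : ℝ) / 2) := Real.one_le_rpow hk (by positivity)
  rw [cast_mul_cycleWeight]
  refine mul_le_mul_of_nonneg_left (le_trans ?_ hk) (by positivity)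
  exact div_le_one_of_le₀ hpow (by positivity)

theorem summable_cast_mul_cycleWeight_mul_exp (hβ : 0 < β) {t : ℝ} (ht : t < 0) :
    Summable fun k : ℕ+ => (k : ℕ) * cycleWeight d β k * Real.exp (t * (k : ℕ)) :=
  summable_mul_exp_of_le_linear (fun k => (cast_mul_cycleWeight_pos hβ k).le)
    (cast_mul_cycleWeight_le hβ) ht

theorem summable_cycleWeight_mul_exp_of_neg (hβ : 0 < β) {t : ℝ} (ht : t < 0) :
    Summable fun k : ℕ+ => cycleWeight d β k * Real.exp (t * (k : ℕ)) :=
  summable_mul_exp_of_le_linear (fun k => (cycleWeight_pos hβ k).le)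
    (fun k => (le_mul_of_one_le_left (cycleWeight_pos hβ k).le (one_le_cast_pnat k)).trans
      (cast_mul_cycleWeight_le hβ k)) ht

theorem summable_cycleWeight_mul_exp (hd : 1 ≤ d) (hβ : 0 < β) {t : ℝ} (ht : t ≤ 0) :
    Summable fun k : ℕ+ => cycleWeight d β k * Real.exp (t * (k : ℕ)) :=
  summable_mul_exp_of_summable (fun k => (cycleWeight_pos hβ k).le) (summable_cycleWeight hd) ht

/-- The ideal gas pressure `p₀(β, s)` as a real number, for `s ≤ 0`. -/
noncomputable def gasPressure (d : ℕ) (β s : ℝ) : ℝ :=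
  1 / β * expSeries (cycleWeight d β) (β * s)

/-- The particle density `∑_k k q_k e^{βsk}` of the ideal gas at chemical potential `s < 0`,
which is the derivative of the pressure. -/
noncomputable def gasDensity (d : ℕ) (β s : ℝ) : ℝ :=
  expSeries (fun k => (k : ℕ) * cycleWeight d β k) (β * s)

theorem gasPressure_nonneg (hβ : 0 < β) (s : ℝ) : 0 ≤ gasPressure d β s :=
  mul_nonneg (by positivity) (expSeries_nonneg fun k => (cycleWeight_pos hβ k).le)

theorem gasDensity_pos (hβ : 0 < β) {s : ℝ} (hs : s < 0) : 0 < gasDensity d β s :=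
  expSeries_pos (cast_mul_cycleWeight_pos hβ)
    (summable_cast_mul_cycleWeight_mul_exp hβ (mul_neg_of_pos_of_neg hβ hs))

theorem gasPressure_add_mul_sub_le (hβ : 0 < β) {s t : ℝ}
    (hs : Summable fun k => cycleWeight d β k * Real.exp (β * s * (k : ℕ)))
    (hs' : Summable fun k : ℕ+ => (k : ℕ) * cycleWeight d β k * Real.exp (β * s * (k : ℕ)))
    (ht : Summable fun k => cycleWeight d β k * Real.exp (β * t * (k : ℕ))) :
    gasPressure d β s + gasDensity d β s * (t - s) ≤ gasPressure d β t := by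
  have h := mul_le_mul_of_nonneg_left
    (expSeries_add_mul_sub_le (fun k => (cycleWeight_pos hβ k).le) hs hs' ht)
    (one_div_pos.2 hβ).le
  refine le_of_eq_of_le ?_ h
  unfold gasPressure gasDensity
  field_simp

theorem gasDensity_strictMonoOn (hβ : 0 < β) : StrictMonoOn (gasDensity d β) (Set.Iio 0) :=
  fun _ hs _ ht hst => strictMonoOn_expSeries (cast_mul_cycleWeight_pos hβ)
    (fun _ => summable_cast_mul_cycleWeight_mul_exp hβ) (mul_neg_of_pos_of_neg hβ hs)
    (mul_neg_of_pos_of_neg hβ ht) (mul_lt_mul_of_pos_left hst hβ)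

theorem strictConvexOn_gasDensity (hβ : 0 < β) :
    StrictConvexOn ℝ (Set.Iio 0) (gasDensity d β) := by
  refine ⟨convex_Iio _, fun s hs t ht hst u v hu hv huv => ?_⟩
  have h := (strictConvexOn_expSeries (cast_mul_cycleWeight_pos (d := d) hβ)
    fun _ => summable_cast_mul_cycleWeight_mul_exp hβ).2 (mul_neg_of_pos_of_neg hβ hs)
    (mul_neg_of_pos_of_neg hβ ht) (fun h => hst (mul_left_cancel₀ hβ.ne' h)) hu hv huv
  rwa [← mul_smul_comm, ← mul_smul_comm, ← mul_add] at h

theorem continuousOn_gasDensity (hβ : 0 < β) : ContinuousOn (gasDensity d β) (Set.Iio 0) :=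
  (strictConvexOn_gasDensity hβ).convexOn.continuousOn isOpen_Iio

theorem tendsto_gasDensity_atBot (hβ : 0 < β) : Tendsto (gasDensity d β) atBot (𝓝 0) :=
  (tendsto_expSeries_atBot (fun k => (cast_mul_cycleWeight_pos hβ k).le)
    fun _ => summable_cast_mul_cycleWeight_mul_exp hβ).comp (tendsto_id.const_mul_atBot hβ)

theorem tendsto_gasPressure_atBot (hβ : 0 < β) : Tendsto (gasPressure d β) atBot (𝓝 0) := by
  have h := tendsto_expSeries_atBot (fun k => (cycleWeight_pos (d := d) hβ k).le)
    fun _ => summable_cycleWeight_mul_exp_of_neg hβ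
  rw [← mul_zero (1 / β)]
  exact (h.comp (tendsto_id.const_mul_atBot hβ)).const_mul (1 / β)

theorem gasDensity_lt_of_criticalDensity_le (hβ : 0 < β) {x s : ℝ} (hs : s < 0) (hx0 : 0 ≤ x)
    (hx : criticalDensity d β ≤ ENNReal.ofReal x) : gasDensity d β s < x := by
  obtain ⟨t, hst, ht⟩ := exists_between hs
  refine (gasDensity_strictMonoOn hβ hs ht hst).trans_le ((ENNReal.ofReal_le_ofReal_iff hx0).1 ?_)
  have hβt : β * t < 0 := mul_neg_of_pos_of_neg hβ ht
  refine (ofReal_expSeries_le_tsum (fun k => (cast_mul_cycleWeight_pos hβ k).le) hβt.le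
    (summable_cast_mul_cycleWeight_mul_exp hβ hβt)).trans ?_
  rwa [← criticalDensity_eq_tsum hβ]

theorem exists_lt_gasDensity (hβ : 0 < β) {x : ℝ} (hx : ENNReal.ofReal x < criticalDensity d β) :
    ∃ s < 0, x < gasDensity d β s := by
  rw [criticalDensity_eq_tsum hβ] at hx
  obtain ⟨t, ht, hxt⟩ := exists_lt_expSeries (fun k => (cast_mul_cycleWeight_pos hβ k).le)
    (fun _ => summable_cast_mul_cycleWeight_mul_exp hβ) hx
  exact ⟨t / β, div_neg_of_neg_of_pos ht hβ, by rwa [gasDensity, mul_div_cancel₀ _ hβ.ne']⟩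

theorem exists_gasDensity_eq (hβ : 0 < β) {x : ℝ} (hx0 : 0 < x)
    (hx : ENNReal.ofReal x < criticalDensity d β) : ∃ s < 0, gasDensity d β s = x := by
  obtain ⟨t, ht, hxt⟩ := exists_lt_gasDensity hβ hx
  have hsmall := (tendsto_gasDensity_atBot (d := d) hβ).eventually_lt_const hx0
  obtain ⟨r, hr, hrt⟩ := (hsmall.and (eventually_lt_atBot t)).exists
  have hsub : Set.Icc r t ⊆ Set.Iio 0 := fun z hz => hz.2.trans_lt ht
  obtain ⟨s, hs, hsx⟩ := intermediate_value_Icc hrt.le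
    ((continuousOn_gasDensity hβ).mono hsub) ⟨hr.le, hxt.le⟩
  exact ⟨s, hsub hs, hsx⟩

theorem gasPressure_zero_add_mul_le (hd : 1 ≤ d) (hβ : 0 < β) {t x : ℝ} (ht : t ≤ 0)
    (hx0 : 0 ≤ x) (hx : criticalDensity d β ≤ ENNReal.ofReal x) :
    gasPressure d β 0 + x * t ≤ gasPressure d β t := by
  have hnn (k : ℕ+) : 0 ≤ (k : ℕ) * cycleWeight d β k := (cast_mul_cycleWeight_pos hβ k).le
  rw [criticalDensity_eq_tsum hβ] at hx
  have hsum : Summable fun k : ℕ+ => (k : ℕ) * cycleWeight d β k := by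
    simpa only [ENNReal.toReal_ofReal (hnn _)] using
      ENNReal.summable_toReal (ne_top_of_le_ne_top ENNReal.ofReal_ne_top hx)
  have hle : gasDensity d β 0 ≤ x := by
    rw [gasDensity, mul_zero, expSeries_zero]
    rwa [← ENNReal.ofReal_tsum_of_nonneg hnn hsum, ENNReal.ofReal_le_ofReal_iff hx0] at hx
  have htangent := gasPressure_add_mul_sub_le hβ (s := 0) (t := t)
    (summable_cycleWeight_mul_exp hd hβ (mul_zero β).le)
    (summable_mul_exp_of_summable hnn hsum (mul_zero β).le)
    (summable_cycleWeight_mul_exp hd hβ (mul_nonpos_of_nonneg_of_nonpos hβ.le ht))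
  nlinarith

end IdealGas

theorem hasDerivAt_of_subgradient {f g : ℝ → ℝ} {s : Set ℝ} {x : ℝ} (hs : s ∈ 𝓝 x)
    (h : ∀ u ∈ s, ∀ v ∈ s, f u + g u * (v - u) ≤ f v) (hg : ContinuousAt g x) :
    HasDerivAt f (g x) x := by
  rw [hasDerivAt_iff_isLittleO, Asymptotics.isLittleO_iff]
  intro c hc
  filter_upwards [hs, Metric.continuousAt_iff'.1 hg c hc] with v hv hgv
  have hx : x ∈ s := mem_of_mem_nhds hs
  have hlower : f x + g x * (v - x) ≤ f v := h x hx v hv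
  have hupper : f v + g v * (x - v) ≤ f x := h v hv x hx
  have hslope : (g v - g x) * (v - x) ≤ c * |v - x| := by
    refine (le_abs_self _).trans ?_
    rw [abs_mul]
    exact mul_le_mul_of_nonneg_right hgv.le (abs_nonneg _)
  simp only [smul_eq_mul, Real.norm_eq_abs]
  rw [abs_of_nonneg (by linarith)]
  linarith

section IdealGasPressure

variable {d : ℕ} {β s : ℝ}

theorem hasDerivAt_gasPressure (hβ : 0 < β) (hs : s < 0) :
    HasDerivAt (gasPressure d β) (gasDensity d β s) s := by
  refine hasDerivAt_of_subgradient (Iio_mem_nhds hs) (fun u hu v hv => ?_)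
    ((continuousOn_gasDensity hβ).continuousAt (Iio_mem_nhds hs))
  have hβu : β * u < 0 := mul_neg_of_pos_of_neg hβ hu
  exact gasPressure_add_mul_sub_le hβ (summable_cycleWeight_mul_exp_of_neg hβ hβu)
    (summable_cast_mul_cycleWeight_mul_exp hβ hβu)
    (summable_cycleWeight_mul_exp_of_neg hβ (mul_neg_of_pos_of_neg hβ hv))

theorem idealPressure_eq_ofReal (hβ : 0 < β)
    (hs : Summable fun k => cycleWeight d β k * Real.exp (β * s * (k : ℕ))) :
    idealPressure d β s = ENNReal.ofReal (gasPressure d β s) := by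
  rw [idealPressure, gasPressure, ENNReal.ofReal_mul (by positivity),
    ofReal_expSeries (fun k => (cycleWeight_pos hβ k).le) hs]

theorem not_summable_cycleWeight_mul_exp (hβ : 0 < β) {t : ℝ} (ht : 0 < t) :
    ¬Summable fun k => cycleWeight d β k * Real.exp (t * (k : ℕ)) := by
  intro hsum
  let C : ℝ := 1 / (4 * Real.pi * β) ^ ((d : ℝ) / 2)
  let f : ℝ → ℝ := fun x => C * (Real.exp (t * x) / x ^ (1 + (d : ℝ) / 2))
  have hC : 0 < C := by
    have := Real.pi_pos
    positivity
  have hsum_nat : Summable fun n : ℕ => f n := by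
    refine (summable_pnat_iff_summable_nat (f := fun n : ℕ => f n)).1 (hsum.congr fun k => ?_)
    rw [cycleWeight_eq_mul]
    ring
  have htop : Tendsto (fun n : ℕ => f n) atTop atTop :=
    ((tendsto_exp_mul_div_rpow_atTop _ _ ht).comp tendsto_natCast_atTop_atTop).const_mul_atTop hC
  exact not_tendsto_nhds_of_tendsto_atTop htop 0 hsum_nat.tendsto_atTop_zero

theorem idealPressure_of_pos (hβ : 0 < β) (hs : 0 < s) : idealPressure d β s = ⊤ := by
  have hnn (k : ℕ+) : 0 ≤ cycleWeight d β k * Real.exp (β * s * (k : ℕ)) :=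
    mul_nonneg (cycleWeight_pos hβ k).le (Real.exp_pos _).le
  refine ENNReal.mul_eq_top.2 (Or.inl ⟨by simpa using hβ, ?_⟩)
  by_contra hne
  refine not_summable_cycleWeight_mul_exp (d := d) hβ (mul_pos hβ hs) ?_
  simpa only [ENNReal.toReal_ofReal (hnn _)] using ENNReal.summable_toReal hne

theorem idealPressureDeriv_eq_gasDensity (hβ : 0 < β) (hs : s < 0) :
    idealPressureDeriv d β s = gasDensity d β s := by
  refine ((hasDerivAt_gasPressure hβ hs).congr_of_eventuallyEq ?_).deriv
  filter_upwards [Iio_mem_nhds hs] with t ht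
  rw [idealPressure_eq_ofReal hβ
    (summable_cycleWeight_mul_exp_of_neg hβ (mul_neg_of_pos_of_neg hβ ht)),
    ENNReal.toReal_ofReal (gasPressure_nonneg hβ t)]

end IdealGasPressure

section InverseDensity

variable {d : ℕ} {β x y t : ℝ}

theorem sBeta_of_criticalDensity_le (hx : criticalDensity d β ≤ ENNReal.ofReal x) :
    sBeta d β x = 0 := if_pos hx

theorem sBeta_spec (hβ : 0 < β) (hx0 : 0 < x) (hx : ENNReal.ofReal x < criticalDensity d β) :
    sBeta d β x < 0 ∧ gasDensity d β (sBeta d β x) = x := by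
  have hex : ∃ s : ℝ, s < 0 ∧ idealPressureDeriv d β s = x := by
    obtain ⟨s, hs, hsx⟩ := exists_gasDensity_eq hβ hx0 hx
    exact ⟨s, hs, (idealPressureDeriv_eq_gasDensity hβ hs).trans hsx⟩
  obtain ⟨hneg, heq⟩ := Classical.epsilon_spec hex
  rw [sBeta, if_neg hx.not_ge]
  exact ⟨hneg, (idealPressureDeriv_eq_gasDensity hβ hneg).symm.trans heq⟩

theorem sBeta_nonpos (hβ : 0 < β) (hx0 : 0 < x) : sBeta d β x ≤ 0 := by
  rcases lt_or_ge (ENNReal.ofReal x) (criticalDensity d β) with h | h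
  · exact (sBeta_spec hβ hx0 h).1.le
  · exact (sBeta_of_criticalDensity_le h).le

theorem gasDensity_sBeta (hβ : 0 < β) (hx0 : 0 < x) (hs : sBeta d β x < 0) :
    gasDensity d β (sBeta d β x) = x := by
  rcases lt_or_ge (ENNReal.ofReal x) (criticalDensity d β) with h | h
  · exact (sBeta_spec hβ hx0 h).2
  · exact absurd (sBeta_of_criticalDensity_le h) hs.ne

theorem lt_sBeta_iff (hβ : 0 < β) (hx0 : 0 < x) (ht : t < 0) :
    t < sBeta d β x ↔ gasDensity d β t < x := by
  rcases lt_or_ge (ENNReal.ofReal x) (criticalDensity d β) with h | h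
  · obtain ⟨hneg, heq⟩ := sBeta_spec hβ hx0 h
    rw [← (gasDensity_strictMonoOn hβ).lt_iff_lt ht hneg, heq]
  · rw [sBeta_of_criticalDensity_le h]
    exact iff_of_true ht (gasDensity_lt_of_criticalDensity_le hβ ht hx0.le h)

theorem sBeta_lt_iff (hβ : 0 < β) (hx0 : 0 < x) (ht : t < 0) :
    sBeta d β x < t ↔ x < gasDensity d β t := by
  rcases lt_or_ge (ENNReal.ofReal x) (criticalDensity d β) with h | h
  · obtain ⟨hneg, heq⟩ := sBeta_spec hβ hx0 h
    rw [← (gasDensity_strictMonoOn hβ).lt_iff_lt hneg ht, heq]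
  · rw [sBeta_of_criticalDensity_le h]
    exact iff_of_false ht.not_gt (gasDensity_lt_of_criticalDensity_le hβ ht hx0.le h).not_gt

theorem sBeta_gasDensity (hβ : 0 < β) (ht : t < 0) : sBeta d β (gasDensity d β t) = t := by
  have hpos := gasDensity_pos (d := d) hβ ht
  refine le_antisymm (not_lt.1 fun h => ?_) (not_lt.1 fun h => ?_)
  · exact lt_irrefl _ ((lt_sBeta_iff hβ hpos ht).1 h)
  · exact lt_irrefl _ ((sBeta_lt_iff hβ hpos ht).1 h)

theorem monotoneOn_sBeta (hβ : 0 < β) : MonotoneOn (sBeta d β) (Set.Ioi 0) := by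
  refine fun x hx y hy hxy => le_of_forall_lt fun t ht => ?_
  have ht0 := ht.trans_le (sBeta_nonpos hβ hx)
  exact (lt_sBeta_iff hβ hy ht0).2 (((lt_sBeta_iff hβ hx ht0).1 ht).trans_le hxy)

theorem sBeta_lt_sBeta (hβ : 0 < β) (hx0 : 0 < x) (hxy : x < y) (hs : sBeta d β x < 0) :
    sBeta d β x < sBeta d β y :=
  (lt_sBeta_iff hβ (hx0.trans hxy) hs).2 ((gasDensity_sBeta hβ hx0 hs).trans_lt hxy)

theorem continuousAt_sBeta (hβ : 0 < β) (hx0 : 0 < x) : ContinuousAt (sBeta d β) x := by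
  refine tendsto_order.2 ⟨fun t ht => ?_, fun t ht => ?_⟩
  · have ht0 := ht.trans_le (sBeta_nonpos hβ hx0)
    filter_upwards [Ioi_mem_nhds ((lt_sBeta_iff hβ hx0 ht0).1 ht), Ioi_mem_nhds hx0] with y hy hy0
    exact (lt_sBeta_iff hβ hy0 ht0).2 hy
  · rcases (sBeta_nonpos (d := d) hβ hx0).eq_or_lt with hzero | hneg
    · filter_upwards [Ioi_mem_nhds hx0] with y hy0
      exact (sBeta_nonpos hβ hy0).trans_lt (hzero ▸ ht)
    · obtain ⟨r, hxr, hr⟩ := exists_between (lt_min ht hneg)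
      obtain ⟨hrt, hr0⟩ := lt_min_iff.1 hr
      filter_upwards [Iio_mem_nhds ((sBeta_lt_iff hβ hx0 hr0).1 hxr), Ioi_mem_nhds hx0]
        with y hy hy0
      exact ((sBeta_lt_iff hβ hy0 hr0).2 hy).trans hrt

theorem tendsto_sBeta_nhdsGT_zero (hβ : 0 < β) : Tendsto (sBeta d β) (𝓝[>] 0) atBot := by
  refine tendsto_atBot.2 fun t => ?_
  have hneg : min t (-1) < 0 := (min_le_right _ _).trans_lt neg_one_lt_zero
  filter_upwards [Ioo_mem_nhdsGT (gasDensity_pos (d := d) hβ hneg)] with x hx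
  exact (((sBeta_lt_iff hβ hx.1 hneg).2 hx.2).trans_le (min_le_left _ _)).le

end InverseDensity

section IdealGasFreeEnergy

variable {d : ℕ} {β x : ℝ}

/-- The ideal gas free energy `f₀(β, x)` as a real number, for `x ≥ 0`: the Legendre transform of
the pressure, in which only `s ≤ 0` matters because the pressure is infinite for `s > 0`. -/
noncomputable def gasFreeEnergy (d : ℕ) (β x : ℝ) : ℝ :=
  sSup ((fun s => s * x - gasPressure d β s) '' Set.Iic 0)

theorem mul_sub_gasPressure_nonpos (hβ : 0 < β) {s : ℝ} (hx : 0 ≤ x) (hs : s ≤ 0) :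
    s * x - gasPressure d β s ≤ 0 :=
  sub_nonpos.2 ((mul_nonpos_of_nonpos_of_nonneg hs hx).trans (gasPressure_nonneg hβ s))

theorem isLUB_gasFreeEnergy (hβ : 0 < β) (hx : 0 ≤ x) :
    IsLUB ((fun s => s * x - gasPressure d β s) '' Set.Iic 0) (gasFreeEnergy d β x) :=
  isLUB_csSup (Set.nonempty_Iic.image _)
    ⟨0, Set.forall_mem_image.2 fun _ hs => mul_sub_gasPressure_nonpos hβ hx hs⟩

theorem mul_sub_gasPressure_le (hβ : 0 < β) {s : ℝ} (hx : 0 ≤ x) (hs : s ≤ 0) :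
    s * x - gasPressure d β s ≤ gasFreeEnergy d β x :=
  (isLUB_gasFreeEnergy hβ hx).1 ⟨s, hs, rfl⟩

theorem gasFreeEnergy_nonpos (hβ : 0 < β) (hx : 0 ≤ x) : gasFreeEnergy d β x ≤ 0 :=
  (isLUB_gasFreeEnergy hβ hx).2
    (Set.forall_mem_image.2 fun _ hs => mul_sub_gasPressure_nonpos hβ hx hs)

theorem neg_gasPressure_zero_le_gasFreeEnergy (hβ : 0 < β) (hx : 0 ≤ x) :
    -gasPressure d β 0 ≤ gasFreeEnergy d β x := by
  simpa only [zero_mul, zero_sub] using mul_sub_gasPressure_le hβ hx le_rfl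

theorem gasFreeEnergy_zero (hβ : 0 < β) : gasFreeEnergy d β 0 = 0 := by
  refine le_antisymm (gasFreeEnergy_nonpos hβ le_rfl) (le_of_forall_lt fun c hc => ?_)
  have hsmall := (tendsto_gasPressure_atBot (d := d) hβ).eventually_lt_const (neg_pos.2 hc)
  obtain ⟨s, hs, hs0⟩ := (hsmall.and (eventually_le_atBot 0)).exists
  have := mul_sub_gasPressure_le (d := d) hβ le_rfl hs0
  linarith

theorem idealFreeEnergy_eq_coe (hd : 1 ≤ d) (hβ : 0 < β) (hx : 0 ≤ x) :
    idealFreeEnergy d β x = (gasFreeEnergy d β x : EReal) := by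
  have hterm {s : ℝ} (hs : s ≤ 0) : ((s * x : ℝ) : EReal) - (idealPressure d β s : EReal) =
      ((s * x - gasPressure d β s : ℝ) : EReal) := by
    rw [idealPressure_eq_ofReal hβ (summable_cycleWeight_mul_exp hd hβ
      (mul_nonpos_of_nonneg_of_nonpos hβ.le hs)), EReal.coe_ennreal_ofReal,
      max_eq_left (gasPressure_nonneg hβ s), ← EReal.coe_sub]
  refine le_antisymm (iSup_le fun s => ?_) (le_of_forall_lt fun c hc => ?_)
  · rcases le_or_gt s 0 with hs | hs
    · exact (hterm hs).trans_le (EReal.coe_le_coe_iff.2 (mul_sub_gasPressure_le hβ hx hs))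
    · rw [idealPressure_of_pos hβ hs, EReal.coe_ennreal_top, EReal.sub_top]
      exact bot_le
  · obtain ⟨r, hcr, hr⟩ := EReal.lt_iff_exists_real_btwn.1 hc
    obtain ⟨_, ⟨s, hs, rfl⟩, hrs⟩ :=
      (lt_isLUB_iff (isLUB_gasFreeEnergy hβ hx)).1 (EReal.coe_lt_coe_iff.1 hr)
    refine (hcr.trans ((EReal.coe_lt_coe_iff.2 hrs).trans_eq (hterm hs).symm)).trans_le ?_
    exact le_iSup (fun s : ℝ => ((s * x : ℝ) : EReal) - (idealPressure d β s : EReal)) s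

theorem gasFreeEnergy_eq_sBeta (hd : 1 ≤ d) (hβ : 0 < β) (hx : 0 < x) :
    gasFreeEnergy d β x = sBeta d β x * x - gasPressure d β (sBeta d β x) := by
  refine (isLUB_gasFreeEnergy hβ hx.le).unique
    (IsGreatest.isLUB ⟨⟨_, sBeta_nonpos hβ hx, rfl⟩, Set.forall_mem_image.2 fun s hs => ?_⟩)
  rcases lt_or_ge (ENNReal.ofReal x) (criticalDensity d β) with h | h
  · obtain ⟨hneg, heq⟩ := sBeta_spec hβ hx h
    have hβneg : β * sBeta d β x < 0 := mul_neg_of_pos_of_neg hβ hneg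
    have htangent := gasPressure_add_mul_sub_le hβ (summable_cycleWeight_mul_exp_of_neg hβ hβneg)
      (summable_cast_mul_cycleWeight_mul_exp hβ hβneg)
      (summable_cycleWeight_mul_exp hd hβ (mul_nonpos_of_nonneg_of_nonpos hβ.le hs))
    rw [heq] at htangent
    linarith
  · have htangent := gasPressure_zero_add_mul_le hd hβ hs hx.le h
    rw [sBeta_of_criticalDensity_le h]
    linarith

theorem gasFreeEnergy_add_sBeta_mul_le (hd : 1 ≤ d) (hβ : 0 < β) {y : ℝ} (hx : 0 < x)
    (hy : 0 ≤ y) :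
    gasFreeEnergy d β x + sBeta d β x * (y - x) ≤ gasFreeEnergy d β y := by
  have := mul_sub_gasPressure_le (d := d) hβ hy (sBeta_nonpos (d := d) hβ hx)
  rw [gasFreeEnergy_eq_sBeta hd hβ hx]
  linarith

theorem hasDerivAt_gasFreeEnergy (hd : 1 ≤ d) (hβ : 0 < β) (hx : 0 < x) :
    HasDerivAt (gasFreeEnergy d β) (sBeta d β x) x :=
  hasDerivAt_of_subgradient (Ioi_mem_nhds hx)
    (fun _ hu _ hv => gasFreeEnergy_add_sBeta_mul_le hd hβ hu (le_of_lt hv))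
    (continuousAt_sBeta hβ hx)

theorem continuousOn_gasFreeEnergy (hd : 1 ≤ d) (hβ : 0 < β) :
    ContinuousOn (gasFreeEnergy d β) (Set.Ici 0) := by
  intro x hx
  rcases (show (0 : ℝ) ≤ x from hx).eq_or_lt with rfl | hx0
  · refine tendsto_order.2 ⟨fun c hc => ?_, fun c hc => ?_⟩
    · obtain ⟨_, ⟨s, hs, rfl⟩, hcs⟩ := (lt_isLUB_iff (isLUB_gasFreeEnergy hβ le_rfl)).1 hc
      have hcont : ContinuousAt (fun y : ℝ => s * y - gasPressure d β s) 0 := by fun_prop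
      filter_upwards [self_mem_nhdsWithin, nhdsWithin_le_nhds (hcont.eventually_const_lt hcs)]
        with y hy0 hy
      exact hy.trans_le (mul_sub_gasPressure_le hβ hy0 hs)
    · filter_upwards [self_mem_nhdsWithin] with y hy
      exact (gasFreeEnergy_nonpos hβ hy).trans_lt ((gasFreeEnergy_zero hβ).symm.trans_lt hc)
  · exact (hasDerivAt_gasFreeEnergy hd hβ hx0).continuousAt.continuousWithinAt

end IdealGasFreeEnergy

section Minimisers

variable {d : ℕ} {β a b μ : ℝ} {κ : ℝ≥0∞}

theorem coe_add_biSup_neg_eq_zero_iff {ι : Type*} {f : ι → ℝ} {S : Set ι} {z : ι} (hz : z ∈ S) :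
    ((f z : ℝ) : EReal) + ⨆ w ∈ S, ((-f w : ℝ) : EReal) = 0 ↔ IsMinOn f S z := by
  rw [isMinOn_iff]
  constructor
  · intro h w hw
    have hle : ((f z : ℝ) : EReal) + ((-f w : ℝ) : EReal) ≤ 0 := by
      rw [← h]
      gcongr
      exact le_iSup₂ (f := fun w (_ : w ∈ S) => ((-f w : ℝ) : EReal)) w hw
    rw [← EReal.coe_add, ← EReal.coe_zero, EReal.coe_le_coe_iff] at hle
    linarith
  · intro h
    have hsup : ⨆ w ∈ S, ((-f w : ℝ) : EReal) = ((-f z : ℝ) : EReal) :=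
      le_antisymm (iSup₂_le fun w hw => EReal.coe_le_coe_iff.2 (neg_le_neg (h w hw)))
        (le_iSup₂ (f := fun w (_ : w ∈ S) => ((-f w : ℝ) : EReal)) z hz)
    rw [hsup, ← EReal.coe_add, add_neg_cancel, EReal.coe_zero]

/-- The rate function without its normalisation, as a real function on `[0, ∞)²`. -/
noncomputable def energy (d : ℕ) (β a b μ : ℝ) (z : ℝ × ℝ) : ℝ :=
  gasFreeEnergy d β z.1 - μ * (z.1 + z.2) + a / 2 * (z.1 + z.2) ^ 2 - b / 2 * z.2 ^ 2

/-- The minimisers of the energy over the admissible set. -/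
def minimisers (d : ℕ) (β a b μ : ℝ) (κ : ℝ≥0∞) : Set (ℝ × ℝ) :=
  {z | z ∈ admissible κ ∧ IsMinOn (energy d β a b μ) (admissible κ) z}

theorem pressure_eq_iSup_neg_energy (hd : 1 ≤ d) (hβ : 0 < β) :
    pressure d β a b μ κ = ⨆ z ∈ admissible κ, ((-energy d β a b μ z : ℝ) : EReal) := by
  refine iSup_congr fun z => iSup_congr fun hz => ?_
  rw [idealFreeEnergy_eq_coe hd hβ hz.1, ← EReal.coe_sub]
  congr 1
  unfold energy
  ring

theorem rateFunction_eq_energy_add_pressure (hd : 1 ≤ d) (hβ : 0 < β) {z : ℝ × ℝ}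
    (hz : z ∈ admissible κ) :
    rateFunction d β a b μ κ z = ((energy d β a b μ z : ℝ) : EReal) + pressure d β a b μ κ := by
  rw [rateFunction, if_pos hz, idealFreeEnergy_eq_coe hd hβ hz.1, ← EReal.coe_add]
  congr 2
  unfold energy
  ring

theorem zeroes_eq_minimisers (hd : 1 ≤ d) (hβ : 0 < β) :
    zeroes d β a b μ κ = minimisers d β a b μ κ := by
  ext z
  by_cases hz : z ∈ admissible κ
  · simp only [zeroes, minimisers, Set.mem_ofPred_eq, hz, true_and,
      rateFunction_eq_energy_add_pressure hd hβ hz, pressure_eq_iSup_neg_energy hd hβ]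
    exact coe_add_biSup_neg_eq_zero_iff hz
  · simp [zeroes, minimisers, rateFunction, hz]

theorem admissible_nonneg {z : ℝ × ℝ} (hz : z ∈ admissible κ) : 0 ≤ z.2 :=
  hz.2.elim (fun h => h.ge) And.left

theorem mem_admissible_zero {z : ℝ × ℝ} (hx : 0 ≤ z.1) (hy : 0 ≤ z.2) : z ∈ admissible 0 :=
  ⟨hx, Or.inr ⟨hy, zero_le⟩⟩

theorem admissible_subset_zero : admissible κ ⊆ admissible 0 := fun _ hz =>
  mem_admissible_zero hz.1 (admissible_nonneg hz)

theorem isClosed_admissible : IsClosed (admissible κ) := by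
  have hunion : admissible κ = {z : ℝ × ℝ | 0 ≤ z.1} ∩ ({z | z.2 = 0} ∪
      ({z | 0 ≤ z.2} ∩ {z | κ ≤ ENNReal.ofReal z.2})) := by
    ext z; simp [admissible]
  rw [hunion]
  exact (isClosed_le continuous_const continuous_fst).inter
    ((isClosed_eq continuous_snd continuous_const).union
      ((isClosed_le continuous_const continuous_snd).inter
        (isClosed_le continuous_const (ENNReal.continuous_ofReal.comp continuous_snd))))

theorem continuousOn_energy (hd : 1 ≤ d) (hβ : 0 < β) :
    ContinuousOn (energy d β a b μ) {z | 0 ≤ z.1} := by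
  have hfree : ContinuousOn (fun z : ℝ × ℝ => gasFreeEnergy d β z.1) {z | 0 ≤ z.1} :=
    (continuousOn_gasFreeEnergy hd hβ).comp continuousOn_fst fun _ hz => hz
  unfold energy
  fun_prop

theorem quadratic_le_energy (hβ : 0 < β) (hb : 0 < b) {z : ℝ × ℝ} (hx : 0 ≤ z.1)
    (hy : 0 ≤ z.2) :
    -gasPressure d β 0 - μ * (z.1 + z.2) + (a - b) / 2 * (z.1 + z.2) ^ 2 ≤
      energy d β a b μ z := by
  have hfree := neg_gasPressure_zero_le_gasFreeEnergy (d := d) hβ hx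
  have hcross : 0 ≤ b * (z.1 ^ 2 + 2 * (z.1 * z.2)) := by positivity
  unfold energy
  nlinarith

theorem exists_add_le_energy (hβ : 0 < β) (hb : 0 < b) (hab : b < a) (μ c : ℝ) :
    ∃ R > 0, ∀ z : ℝ × ℝ, 0 ≤ z.1 → 0 ≤ z.2 → R ≤ z.1 + z.2 →
      c + (z.1 + z.2) ≤ energy d β a b μ z := by
  have hquad : Tendsto (fun t : ℝ => t * ((a - b) / 2 * t + (-μ - 1))) atTop atTop :=
    tendsto_id.atTop_mul_atTop₀ (tendsto_atTop_add_const_right _ _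
      (tendsto_id.const_mul_atTop (by linarith)))
  obtain ⟨R, hR⟩ := eventually_atTop.1 (hquad.eventually_ge_atTop (c + gasPressure d β 0))
  refine ⟨max R 1, by positivity, fun z hx hy hz => ?_⟩
  have hlarge := hR (z.1 + z.2) ((le_max_left _ _).trans hz)
  have hlower := quadratic_le_energy (d := d) (a := a) (μ := μ) hβ hb hx hy
  nlinarith

theorem minimisers_nonempty (hd : 1 ≤ d) (hβ : 0 < β) (hb : 0 < b) (hab : b < a) :
    (minimisers d β a b μ κ).Nonempty := by
  have hcont : ContinuousOn (energy d β a b μ) (admissible κ) :=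
    (continuousOn_energy hd hβ).mono fun z hz => hz.1
  obtain ⟨R, -, hR⟩ := exists_add_le_energy hβ hb hab μ (energy d β a b μ (0, 0))
  have hcoercive : ∀ᶠ z in cocompact (ℝ × ℝ) ⊓ 𝓟 (admissible κ),
      energy d β a b μ (0, 0) ≤ energy d β a b μ z := by
    rw [eventually_inf_principal]
    filter_upwards [(isCompact_Icc (a := ((0 : ℝ), (0 : ℝ))) (b := (R, R))).compl_mem_cocompact]
      with z hz hzA
    have hx := hzA.1
    have hy := admissible_nonneg hzA
    have hsum : R ≤ z.1 + z.2 := by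
      contrapose! hz
      exact not_not.2 ⟨⟨hx, hy⟩, ⟨by simp only; linarith, by simp only; linarith⟩⟩
    linarith [hR z hx hy hsum]
  obtain ⟨z, hz, hmin⟩ :=
    hcont.exists_isMinOn' isClosed_admissible ⟨le_rfl, Or.inl rfl⟩ hcoercive
  exact ⟨z, hz, hmin⟩

theorem minimisers_eq_singleton (hd : 1 ≤ d) (hβ : 0 < β) (hb : 0 < b) (hab : b < a) {z : ℝ × ℝ}
    (h : ∀ w ∈ minimisers d β a b μ κ, w = z) : minimisers d β a b μ κ = {z} :=
  Set.eq_singleton_iff_nonempty_unique_mem.2 ⟨minimisers_nonempty hd hβ hb hab, h⟩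

theorem minimisers_eq_of_mem_admissible {z : ℝ × ℝ} (hzero : minimisers d β a b μ 0 = {z})
    (hz : z ∈ admissible κ) : minimisers d β a b μ κ = {z} := by
  have hmin : z ∈ minimisers d β a b μ 0 := by rw [hzero]; rfl
  ext w
  constructor
  · intro hw
    rw [← hzero]
    refine ⟨admissible_subset_zero hw.1, isMinOn_iff.2 fun v hv => ?_⟩
    exact (hw.2 hz : _ ≤ _).trans (hmin.2 hv)
  · rintro rfl
    exact ⟨hz, hmin.2.on_subset admissible_subset_zero⟩

end Minimisers

section FirstOrder

variable {d : ℕ} {β a b μ x y : ℝ} {κ : ℝ≥0∞}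

-- The slope `s_β(u)` of the free energy tends to `-∞` as `u → 0`.
theorem fst_pos_of_mem_minimisers (hd : 1 ≤ d) (hβ : 0 < β)
    (h : (x, y) ∈ minimisers d β a b μ κ) : 0 < x := by
  refine lt_of_le_of_ne h.1.1 fun hx => ?_
  subst hx
  have hslope : Tendsto (fun u => sBeta d β u + (a / 2 * u + (a * y - μ))) (𝓝[>] 0) atBot := by
    refine (tendsto_sBeta_nhdsGT_zero hβ).atBot_add (C := a / 2 * 0 + (a * y - μ)) ?_
    exact (Continuous.tendsto (by fun_prop) 0).mono_left nhdsWithin_le_nhds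
  obtain ⟨u, hu, hu0⟩ := ((hslope.eventually_lt_atBot 0).and self_mem_nhdsWithin).exists
  have hu0 : 0 < u := hu0
  have hmin : energy d β a b μ (0, y) ≤ energy d β a b μ (u, y) := h.2 ⟨hu0.le, h.1.2⟩
  have htangent := gasFreeEnergy_add_sBeta_mul_le hd hβ hu0 le_rfl
  rw [gasFreeEnergy_zero hβ] at htangent
  simp only [energy, gasFreeEnergy_zero hβ] at hmin
  nlinarith [mul_neg_of_pos_of_neg hu0 hu]

theorem sBeta_eq_of_mem_minimisers (hd : 1 ≤ d) (hβ : 0 < β)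
    (h : (x, y) ∈ minimisers d β a b μ κ) : sBeta d β x = μ - a * (x + y) := by
  have hx := fst_pos_of_mem_minimisers hd hβ h
  have hmin : IsLocalMin (fun u => energy d β a b μ (u, y)) x := by
    filter_upwards [Ioi_mem_nhds hx] with u hu
    exact h.2 ⟨le_of_lt hu, h.1.2⟩
  have hderiv : HasDerivAt (fun u => energy d β a b μ (u, y))
      (sBeta d β x - μ * 1 + a / 2 * (2 * (x + y)) - 0) x := by
    have htotal := (hasDerivAt_id x).add_const y
    refine (((hasDerivAt_gasFreeEnergy hd hβ hx).sub (htotal.const_mul μ)).add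
      ((htotal.pow 2).const_mul (a / 2))).sub (hasDerivAt_const x (b / 2 * y ^ 2))
      |>.congr_deriv ?_
    simp
  linarith [hmin.hasDerivAt_eq_zero hderiv]

theorem eventually_mem_admissible (hx : 0 ≤ x) (hy : κ < ENNReal.ofReal y) :
    ∀ᶠ v in 𝓝 y, (x, v) ∈ admissible κ := by
  have hy0 : 0 < y := ENNReal.ofReal_pos.1 (zero_le.trans_lt hy)
  filter_upwards [Ioi_mem_nhds hy0,
    ENNReal.continuous_ofReal.continuousAt.eventually_const_lt hy] with v hv hκv
  exact ⟨hx, Or.inr ⟨le_of_lt hv, hκv.le⟩⟩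

/-- The long cycle density `y` at which the energy is stationary in `y`, given the short cycle
density `x`. -/
noncomputable def optimalLongDensity (a b μ x : ℝ) : ℝ := (μ - a * x) / (a - b)

theorem eq_optimalLongDensity_of_mem_minimisers (hab : b < a)
    (h : (x, y) ∈ minimisers d β a b μ κ) (hy : κ < ENNReal.ofReal y) :
    y = optimalLongDensity a b μ x := by
  have hmin : IsLocalMin (fun v => energy d β a b μ (x, v)) y := by
    filter_upwards [eventually_mem_admissible h.1.1 hy] with v hv
    exact h.2 hv
  have hderiv : HasDerivAt (fun v => energy d β a b μ (x, v))
      (-μ + a * (x + y) - b * y) y := by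
    have htotal := (hasDerivAt_id y).const_add x
    refine ((((htotal.const_mul μ).const_sub (gasFreeEnergy d β x)).add
      ((htotal.pow 2).const_mul (a / 2)))).sub (((hasDerivAt_id y).pow 2).const_mul (b / 2))
      |>.congr_deriv ?_
    simp
    ring
  rw [optimalLongDensity, eq_div_iff (sub_pos.2 hab).ne']
  linarith [hmin.hasDerivAt_eq_zero hderiv]

theorem sBeta_eq_neg_mul_of_mem_minimisers (hd : 1 ≤ d) (hβ : 0 < β) (hab : b < a)
    (h : (x, y) ∈ minimisers d β a b μ κ) (hy : κ < ENNReal.ofReal y) :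
    sBeta d β x = -b * y := by
  have hopt := eq_optimalLongDensity_of_mem_minimisers hab h hy
  rw [optimalLongDensity, eq_div_iff (sub_pos.2 hab).ne'] at hopt
  linarith [sBeta_eq_of_mem_minimisers hd hβ h]

end FirstOrder

section HalfLine

variable {f : ℝ → ℝ} {c : ℝ}

theorem exists_isLeast_sublevel_Ioi (hf : ContinuousOn f (Set.Ioi 0))
    (hzero : Tendsto f (𝓝[>] 0) atTop) (hc : ∃ x, 0 < x ∧ f x ≤ c) :
    ∃ m, IsLeast {x | 0 < x ∧ f x ≤ c} m ∧ f m = c := by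
  obtain ⟨ε, hε, hlarge⟩ := mem_nhdsGT_iff_exists_Ioo_subset.1 (hzero.eventually_gt_atTop c)
  have hε : 0 < ε := hε
  have hsub : ∀ x, 0 < x → f x ≤ c → ε ≤ x := fun x hx hfx => by
    by_contra! hxε
    exact (hlarge ⟨hx, hxε⟩).not_ge hfx
  have hset : {x | 0 < x ∧ f x ≤ c} = Set.Ici ε ∩ f ⁻¹' Set.Iic c :=
    Set.ext fun x => ⟨fun h => ⟨hsub x h.1 h.2, h.2⟩, fun h => ⟨hε.trans_le h.1, h.2⟩⟩
  have hclosed : IsClosed {x | 0 < x ∧ f x ≤ c} := by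
    rw [hset]
    exact (hf.mono fun x hx => hε.trans_le hx).preimage_isClosed_of_isClosed isClosed_Ici
      isClosed_Iic
  obtain ⟨m, hleast⟩ : ∃ m, IsLeast {x | 0 < x ∧ f x ≤ c} m :=
    ⟨_, hclosed.isLeast_csInf hc ⟨ε, fun x hx => hsub x hx.1 hx.2⟩⟩
  refine ⟨m, hleast, le_antisymm hleast.1.2 ?_⟩
  by_contra! hlt
  have hpos := hleast.1.1
  have hnear : ∀ᶠ u in 𝓝[<] m, 0 < u ∧ f u < c :=
    ((eventually_gt_nhds hpos).and ((hf.continuousAt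
      (Ioi_mem_nhds hpos)).eventually_lt_const hlt)).filter_mono nhdsWithin_le_nhds
  obtain ⟨u, ⟨hu0, hfu⟩, hu⟩ := (hnear.and self_mem_nhdsWithin).exists
  exact (hleast.2 ⟨hu0, hfu.le⟩).not_gt hu

theorem exists_isMinOn_Ioc (hf : ContinuousOn f (Set.Ioi 0)) (hzero : Tendsto f (𝓝[>] 0) atTop)
    {X : ℝ} (hX : 0 < X) : ∃ x ∈ Set.Ioc 0 X, IsMinOn f (Set.Ioc 0 X) x := by
  obtain ⟨ε, hε, hlarge⟩ := mem_nhdsGT_iff_exists_Ioo_subset.1 (hzero.eventually_ge_atTop (f X))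
  have hε : 0 < ε := hε
  have hminX : min ε X ≤ X := min_le_right _ _
  have hpos : 0 < min ε X := lt_min hε hX
  obtain ⟨x, hx, hmin⟩ := isCompact_Icc.exists_isMinOn ⟨X, hminX, le_rfl⟩
    (hf.mono fun u (hu : u ∈ Set.Icc (min ε X) X) => hpos.trans_le hu.1)
  refine ⟨x, ⟨hpos.trans_le hx.1, hx.2⟩, fun u hu => ?_⟩
  rcases le_or_gt (min ε X) u with h | h
  · exact hmin ⟨h, hu.2⟩
  · have hXu : f X ≤ f u := hlarge ⟨hu.1, h.trans_le (min_le_left _ _)⟩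
    exact le_trans (hmin (Set.right_mem_Icc.2 hminX)) hXu

theorem exists_isMinOn_Ioi (hf : ContinuousOn f (Set.Ioi 0)) (hzero : Tendsto f (𝓝[>] 0) atTop)
    (htop : Tendsto f atTop atTop) : ∃ x ∈ Set.Ioi 0, IsMinOn f (Set.Ioi 0) x := by
  obtain ⟨X, hX⟩ := eventually_atTop.1 (htop.eventually_ge_atTop (f 1))
  obtain ⟨x, hx, hmin⟩ := exists_isMinOn_Ioc hf hzero (X := max X 1) (by positivity)
  refine ⟨x, hx.1, fun u hu => ?_⟩
  rcases le_or_gt u (max X 1) with h | h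
  · exact hmin ⟨hu, h⟩
  · exact le_trans (hmin ⟨one_pos, le_max_right _ _⟩) (hX u ((le_max_left _ _).trans h.le))

end HalfLine

section ShortCycles

variable {d : ℕ} {β a b μ ν x : ℝ} {κ : ℝ≥0∞}

theorem strictMonoOn_sBeta_add_mul (hβ : 0 < β) (ha : 0 < a) :
    StrictMonoOn (fun x => sBeta d β x + a * x) (Set.Ioi 0) :=
  (monotoneOn_sBeta hβ).add_strictMono ((strictMono_mul_left_of_pos ha).strictMonoOn _)

theorem exists_sBeta_eq (hβ : 0 < β) (ha : 0 < a) (μ : ℝ) :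
    ∃ x, 0 < x ∧ sBeta d β x = μ - a * x := by
  have hcont : ContinuousOn (fun x => -(sBeta d β x + a * x)) (Set.Ioi 0) := fun x hx =>
    ((continuousAt_sBeta hβ hx).add (by fun_prop)).neg.continuousWithinAt
  have hzero : Tendsto (fun x => -(sBeta d β x + a * x)) (𝓝[>] 0) atTop :=
    tendsto_neg_atBot_atTop.comp ((tendsto_sBeta_nhdsGT_zero hβ).atBot_add
      ((Continuous.tendsto (by fun_prop) 0).mono_left nhdsWithin_le_nhds))
  obtain ⟨u, hu1, huμ⟩ : ∃ u, 1 ≤ u ∧ μ - sBeta d β 1 ≤ a * u :=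
    ⟨max 1 ((μ - sBeta d β 1) / a), le_max_left _ _,
      (div_le_iff₀' ha).1 (le_max_right _ _)⟩
  have hmono := monotoneOn_sBeta (d := d) hβ (Set.mem_Ioi.2 one_pos) (one_pos.trans_le hu1) hu1
  obtain ⟨m, hm, hmμ⟩ := exists_isLeast_sublevel_Ioi hcont hzero (c := -μ)
    ⟨u, one_pos.trans_le hu1, by linarith⟩
  exact ⟨m, hm.1.1, by linarith⟩

theorem xOne_spec (hβ : 0 < β) (ha : 0 < a) (μ : ℝ) :
    0 < xOne d β a μ ∧ sBeta d β (xOne d β a μ) = μ - a * xOne d β a μ :=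
  Classical.epsilon_spec (exists_sBeta_eq hβ ha μ)

theorem xOne_pos (hβ : 0 < β) (ha : 0 < a) (μ : ℝ) : 0 < xOne d β a μ :=
  (xOne_spec hβ ha μ).1

theorem sBeta_xOne (hβ : 0 < β) (ha : 0 < a) (μ : ℝ) :
    sBeta d β (xOne d β a μ) = μ - a * xOne d β a μ :=
  (xOne_spec hβ ha μ).2

theorem eq_xOne (hβ : 0 < β) (ha : 0 < a) (hx : 0 < x) (h : sBeta d β x = μ - a * x) :
    x = xOne d β a μ :=
  (strictMonoOn_sBeta_add_mul hβ ha).injOn hx (xOne_pos hβ ha μ)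
    (show _ + _ = _ + _ by rw [h, sBeta_xOne hβ ha]; ring)

theorem eq_xOne_of_mem_minimisers (hd : 1 ≤ d) (hβ : 0 < β) (ha : 0 < a)
    (h : (x, 0) ∈ minimisers d β a b μ κ) : x = xOne d β a μ :=
  eq_xOne hβ ha (fst_pos_of_mem_minimisers hd hβ h)
    (by rw [sBeta_eq_of_mem_minimisers hd hβ h, add_zero])

theorem xOne_mem_admissible (hβ : 0 < β) (ha : 0 < a) (μ : ℝ) :
    (xOne d β a μ, 0) ∈ admissible κ :=
  ⟨(xOne_pos hβ ha μ).le, Or.inl rfl⟩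

theorem strictMono_xOne (hβ : 0 < β) (ha : 0 < a) : StrictMono (xOne d β a) := fun μ ν h => by
  rw [← (strictMonoOn_sBeta_add_mul (d := d) hβ ha).lt_iff_lt (xOne_pos hβ ha μ)
    (xOne_pos hβ ha ν)]
  simp only [sBeta_xOne hβ ha]
  linarith

theorem xOne_sub_le (hβ : 0 < β) (ha : 0 < a) (h : μ ≤ ν) :
    xOne d β a ν - xOne d β a μ ≤ (ν - μ) / a := by
  have hmono := monotoneOn_sBeta (d := d) hβ (xOne_pos hβ ha μ) (xOne_pos hβ ha ν)
    ((strictMono_xOne (d := d) hβ ha).monotone h)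
  rw [sBeta_xOne hβ ha, sBeta_xOne hβ ha] at hmono
  rw [le_div_iff₀ ha]
  linarith

theorem continuous_xOne (hβ : 0 < β) (ha : 0 < a) : Continuous (xOne d β a) := by
  refine (LipschitzWith.of_le_add_mul (Real.toNNReal a⁻¹) fun ν μ => ?_).continuous
  rw [Real.coe_toNNReal _ (by positivity), Real.dist_eq, inv_mul_eq_div]
  rcases le_total μ ν with h | h
  · have hle := xOne_sub_le (d := d) hβ ha h
    rw [abs_of_nonneg (sub_nonneg.2 h)]
    linarith
  · have hle := (strictMono_xOne (d := d) hβ ha).monotone h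
    have hdist : 0 ≤ |ν - μ| / a := by positivity
    linarith

end ShortCycles

section CriticalPotential

variable {d : ℕ} {β a b μ x y : ℝ} {κ : ℝ≥0∞}

/-- The chemical potential `μ` for which `x` is a stationary point of the energy
`u ↦ energy d β a b μ (u, optimalLongDensity a b μ u)` with optimised long cycle density. -/
noncomputable def criticalPotential (d : ℕ) (β a b x : ℝ) : ℝ :=
  a * x - (a - b) / b * sBeta d β x

theorem criticalPotential_eq_iff (hb : 0 < b) (hab : b < a) :
    criticalPotential d β a b x = μ ↔ sBeta d β x = -b * optimalLongDensity a b μ x := by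
  have : 0 < a - b := sub_pos.2 hab
  unfold criticalPotential optimalLongDensity
  field_simp
  constructor <;> intro h <;> linarith

theorem continuousOn_criticalPotential (hβ : 0 < β) :
    ContinuousOn (criticalPotential d β a b) (Set.Ioi 0) := fun x hx => by
  have := continuousAt_sBeta (d := d) hβ hx
  unfold criticalPotential
  exact ContinuousAt.continuousWithinAt (by fun_prop)

theorem tendsto_criticalPotential_nhdsGT_zero (hβ : 0 < β) (hb : 0 < b) (hab : b < a) :
    Tendsto (criticalPotential d β a b) (𝓝[>] 0) atTop := by
  have hslope : Tendsto (fun x => (a - b) / b * sBeta d β x) (𝓝[>] 0) atBot :=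
    (tendsto_sBeta_nhdsGT_zero hβ).const_mul_atBot (div_pos (sub_pos.2 hab) hb)
  have hlin : Tendsto (fun x : ℝ => a * x) (𝓝[>] 0) (𝓝 (a * 0)) :=
    (Continuous.tendsto (by fun_prop) 0).mono_left nhdsWithin_le_nhds
  exact (hlin.add_atTop (tendsto_neg_atBot_atTop.comp hslope)).congr fun x =>
    (sub_eq_add_neg _ _).symm

theorem mul_le_criticalPotential (hβ : 0 < β) (hb : 0 < b) (hab : b < a) (hx : 0 < x) :
    a * x ≤ criticalPotential d β a b x := by
  have hslope : (a - b) / b * sBeta d β x ≤ 0 :=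
    mul_nonpos_of_nonneg_of_nonpos (div_nonneg (sub_pos.2 hab).le hb.le) (sBeta_nonpos hβ hx)
  unfold criticalPotential
  linarith

theorem tendsto_criticalPotential_atTop (hβ : 0 < β) (hb : 0 < b) (hab : b < a) :
    Tendsto (criticalPotential d β a b) atTop atTop :=
  tendsto_atTop_mono' _ ((eventually_gt_atTop 0).mono fun _ hx =>
    mul_le_criticalPotential hβ hb hab hx) (tendsto_id.const_mul_atTop (hb.trans hab))

theorem criticalPotential_gasDensity (hβ : 0 < β) {s : ℝ} (hs : s < 0) :
    criticalPotential d β a b (gasDensity d β s) =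
      a * gasDensity d β s - (a - b) / b * s := by
  rw [criticalPotential, sBeta_gasDensity hβ hs]

-- Parametrised by the slope `s`, it is the strictly convex function `a p₀'(s) - (a - b) s / b`.
theorem criticalPotential_lt_of_lt_of_lt (hβ : 0 < β) (ha : 0 < a) {u v c : ℝ}
    (hx : 0 < x) (hxu : x < u) (huv : u < v) (hv : sBeta d β v < 0)
    (hxc : criticalPotential d β a b x ≤ c) (hvc : criticalPotential d β a b v ≤ c) :
    criticalPotential d β a b u < c := by
  have hu0 := hx.trans hxu
  have hu : sBeta d β u < 0 := (monotoneOn_sBeta hβ hu0 (hu0.trans huv) huv.le).trans_lt hv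
  have hxs : sBeta d β x < 0 := (monotoneOn_sBeta hβ hx hu0 hxu.le).trans_lt hu
  have hxu_slope := sBeta_lt_sBeta hβ hx hxu hxs
  have huv_slope := sBeta_lt_sBeta hβ hu0 huv hu
  have hconvex : StrictConvexOn ℝ (Set.Iio 0)
      (fun s => a * gasDensity d β s - (a - b) / b * s) := by
    refine ⟨convex_Iio _, fun p hp q hq hpq m n hm hn hmn => ?_⟩
    have hdensity := (strictConvexOn_gasDensity (d := d) hβ).2 hp hq hpq hm hn hmn
    simp only [smul_eq_mul] at hdensity ⊢
    nlinarith
  have hslope : ∀ w, 0 < w → sBeta d β w < 0 → criticalPotential d β a b w =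
      a * gasDensity d β (sBeta d β w) - (a - b) / b * sBeta d β w := fun w hw hws => by
    rw [gasDensity_sBeta hβ hw hws, criticalPotential]
  rw [hslope x hx hxs] at hxc
  rw [hslope v (hu0.trans huv) hv] at hvc
  rw [hslope u hu0 hu]
  exact (hconvex.lt_on_openSegment hxs hv (hxu_slope.trans huv_slope).ne
    (by rw [openSegment_eq_Ioo (hxu_slope.trans huv_slope)]
        exact ⟨hxu_slope, huv_slope⟩)).trans_le (max_le hxc hvc)

theorem muT_eq_sInf (hβ : 0 < β) :
    muT d β a b = sInf ((fun s => criticalPotential d β a b (gasDensity d β s)) '' Set.Iio 0) := by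
  refine congrArg sInf (Set.image_congr fun s hs => ?_)
  rw [criticalPotential_gasDensity hβ hs, idealPressureDeriv_eq_gasDensity hβ hs]

theorem bddBelow_criticalPotential_gasDensity (hβ : 0 < β) (hb : 0 < b) (hab : b < a) :
    BddBelow ((fun s => criticalPotential d β a b (gasDensity d β s)) '' Set.Iio 0) := by
  refine ⟨0, ?_⟩
  rintro _ ⟨s, hs, rfl⟩
  have hpos := gasDensity_pos (d := d) hβ hs
  exact (mul_pos (hb.trans hab) hpos).le.trans (mul_le_criticalPotential hβ hb hab hpos)

-- At or above the critical density `s_β(x) = 0` is not in the range of the infimum, whence the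
-- limit `s ↑ s_β(x)`.
theorem muT_le_criticalPotential (hβ : 0 < β) (hb : 0 < b) (hab : b < a) (hx : 0 < x) :
    muT d β a b ≤ criticalPotential d β a b x := by
  have hlim : Tendsto (fun s => a * x - (a - b) / b * s) (𝓝[<] sBeta d β x)
      (𝓝 (criticalPotential d β a b x)) :=
    (Continuous.tendsto (by fun_prop) _).mono_left nhdsWithin_le_nhds
  refine ge_of_tendsto hlim ?_
  filter_upwards [self_mem_nhdsWithin] with s hs
  have hs0 : s < 0 := lt_of_lt_of_le hs (sBeta_nonpos hβ hx)
  have hdensity : a * gasDensity d β s ≤ a * x :=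
    mul_le_mul_of_nonneg_left ((lt_sBeta_iff hβ hx hs0).1 hs).le (hb.trans hab).le
  have hinf := csInf_le (bddBelow_criticalPotential_gasDensity (d := d) hβ hb hab)
    (Set.mem_image_of_mem _ (Set.mem_Iio.2 hs0))
  rw [← muT_eq_sInf hβ, criticalPotential_gasDensity hβ hs0] at hinf
  linarith

theorem exists_criticalPotential_le (hβ : 0 < β) (hb : 0 < b) (hab : b < a)
    (hμ : muT d β a b ≤ μ) : ∃ x, 0 < x ∧ criticalPotential d β a b x ≤ μ := by
  obtain ⟨x, hx, hmin⟩ := exists_isMinOn_Ioi (continuousOn_criticalPotential (d := d) hβ)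
    (tendsto_criticalPotential_nhdsGT_zero hβ hb hab) (tendsto_criticalPotential_atTop hβ hb hab)
  refine ⟨x, hx, le_trans ?_ hμ⟩
  rw [muT_eq_sInf hβ]
  refine le_csInf (Set.nonempty_Iio.image _) ?_
  rintro _ ⟨s, hs, rfl⟩
  exact hmin (gasDensity_pos hβ hs)

theorem isLeast_xTwo (hβ : 0 < β) (hb : 0 < b) (hab : b < a) (hμ : muT d β a b ≤ μ) :
    IsLeast {x | 0 < x ∧ criticalPotential d β a b x ≤ μ} (xTwo d β a b μ) ∧
      criticalPotential d β a b (xTwo d β a b μ) = μ := by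
  obtain ⟨m, hm, hmμ⟩ := exists_isLeast_sublevel_Ioi (continuousOn_criticalPotential hβ)
    (tendsto_criticalPotential_nhdsGT_zero hβ hb hab) (exists_criticalPotential_le hβ hb hab hμ)
  have hset : {x : ℝ | 0 < x ∧ sBeta d β x = -(b / (a - b)) * (μ - a * x)} =
      {x | 0 < x ∧ criticalPotential d β a b x = μ} := by
    ext x
    rw [Set.mem_ofPred_eq, Set.mem_ofPred_eq, criticalPotential_eq_iff hb hab,
      show -(b / (a - b)) * (μ - a * x) = -b * optimalLongDensity a b μ x by
        rw [optimalLongDensity]; ring]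
  have hleast : IsLeast {x | 0 < x ∧ criticalPotential d β a b x = μ} m :=
    ⟨⟨hm.1.1, hmμ⟩, fun x hx => hm.2 ⟨hx.1, hx.2.le⟩⟩
  rw [← hset] at hleast
  have hxTwo : xTwo d β a b μ = m :=
    (Classical.epsilon_spec (p := fun x => IsLeast _ x) ⟨m, hleast⟩).unique hleast
  rw [hxTwo]
  exact ⟨hm, hmμ⟩

theorem xTwo_pos (hβ : 0 < β) (hb : 0 < b) (hab : b < a) (hμ : muT d β a b ≤ μ) :
    0 < xTwo d β a b μ :=
  (isLeast_xTwo hβ hb hab hμ).1.1.1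

theorem hasDerivAt_energy_optimalLongDensity (hd : 1 ≤ d) (hβ : 0 < β) (hb : 0 < b) (hab : b < a)
    (hx : 0 < x) :
    HasDerivAt (fun u => energy d β a b μ (u, optimalLongDensity a b μ u))
      (b / (a - b) * (μ - criticalPotential d β a b x)) x := by
  have hlong : HasDerivAt (optimalLongDensity a b μ) (-a / (a - b)) x := by
    unfold optimalLongDensity
    refine ((((hasDerivAt_id x).const_mul a).const_sub μ).div_const (a - b)).congr_deriv ?_
    simp
  have htotal := (hasDerivAt_id x).add hlong
  refine ((((hasDerivAt_gasFreeEnergy hd hβ hx).sub (htotal.const_mul μ)).add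
    ((htotal.pow 2).const_mul (a / 2)))).sub ((hlong.pow 2).const_mul (b / 2)) |>.congr_deriv ?_
  have hab' : a - b ≠ 0 := (sub_pos.2 hab).ne'
  simp [criticalPotential, optimalLongDensity]
  field_simp
  ring

theorem strictMonoOn_energy_optimalLongDensity (hd : 1 ≤ d) (hβ : 0 < β) (hb : 0 < b)
    (hab : b < a) {v : ℝ} (hx : 0 < x) (hv : sBeta d β v < 0)
    (hxμ : criticalPotential d β a b x ≤ μ) (hvμ : criticalPotential d β a b v ≤ μ) :
    StrictMonoOn (fun u => energy d β a b μ (u, optimalLongDensity a b μ u)) (Set.Icc x v) := by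
  refine strictMonoOn_of_deriv_pos (convex_Icc _ _) (fun u hu =>
    (hasDerivAt_energy_optimalLongDensity hd hβ hb hab
      (hx.trans_le hu.1)).continuousAt.continuousWithinAt) fun u hu => ?_
  rw [interior_Icc] at hu
  rw [(hasDerivAt_energy_optimalLongDensity hd hβ hb hab (hx.trans hu.1)).deriv]
  exact mul_pos (div_pos hb (sub_pos.2 hab)) (sub_pos.2
    (criticalPotential_lt_of_lt_of_lt hβ (hb.trans hab) hx hu.1 hu.2 hv hxμ hvμ))

theorem criticalPotential_eq_of_mem_minimisers (hd : 1 ≤ d) (hβ : 0 < β) (hb : 0 < b)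
    (hab : b < a) (h : (x, y) ∈ minimisers d β a b μ κ) (hy : κ < ENNReal.ofReal y) :
    criticalPotential d β a b x = μ := by
  rw [criticalPotential_eq_iff hb hab, ← eq_optimalLongDensity_of_mem_minimisers hab h hy]
  exact sBeta_eq_neg_mul_of_mem_minimisers hd hβ hab h hy

theorem muT_le_of_mem_minimisers (hd : 1 ≤ d) (hβ : 0 < β) (hb : 0 < b) (hab : b < a)
    (h : (x, y) ∈ minimisers d β a b μ κ) (hy : κ < ENNReal.ofReal y) : muT d β a b ≤ μ :=
  (muT_le_criticalPotential hβ hb hab (fst_pos_of_mem_minimisers hd hβ h)).trans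
    (criticalPotential_eq_of_mem_minimisers hd hβ hb hab h hy).le

-- The optimised energy increases strictly from `xTwo` to any larger stationary point.
theorem eq_xTwo_of_mem_minimisers (hd : 1 ≤ d) (hβ : 0 < β) (hb : 0 < b) (hab : b < a)
    (h : (x, y) ∈ minimisers d β a b μ κ) (hy : κ < ENNReal.ofReal y) :
    (x, y) = (xTwo d β a b μ, optimalLongDensity a b μ (xTwo d β a b μ)) := by
  have hμ := muT_le_of_mem_minimisers hd hβ hb hab h hy
  have hyx := eq_optimalLongDensity_of_mem_minimisers hab h hy
  have hcrit := criticalPotential_eq_of_mem_minimisers hd hβ hb hab h hy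
  obtain ⟨hleast, hxTwoμ⟩ := isLeast_xTwo hβ hb hab hμ
  have hy0 : 0 < y := ENNReal.ofReal_pos.1 (zero_le.trans_lt hy)
  rcases (hleast.2 ⟨fst_pos_of_mem_minimisers hd hβ h, hcrit.le⟩).lt_or_eq with hlt | heq
  swap
  · rw [heq, hyx]
  exfalso
  have hslope : sBeta d β x < 0 := by
    rw [sBeta_eq_neg_mul_of_mem_minimisers hd hβ hab h hy]
    nlinarith
  have henergy := strictMonoOn_energy_optimalLongDensity hd hβ hb hab hleast.1.1 hslope hxTwoμ.le
    hcrit.le ⟨le_rfl, hlt.le⟩ ⟨hlt.le, le_rfl⟩ hlt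
  have hlong : y ≤ optimalLongDensity a b μ (xTwo d β a b μ) := by
    rw [hyx]
    have : 0 < a - b := sub_pos.2 hab
    have : 0 < a := hb.trans hab
    unfold optimalLongDensity
    gcongr
  have hadm : (xTwo d β a b μ, optimalLongDensity a b μ (xTwo d β a b μ)) ∈ admissible κ :=
    ⟨hleast.1.1.le, Or.inr ⟨hy0.le.trans hlong,
      hy.le.trans (ENNReal.ofReal_le_ofReal hlong)⟩⟩
  have hmin : energy d β a b μ (x, y) ≤ _ := h.2 hadm
  simp only [← hyx] at henergy
  exact absurd henergy hmin.not_gt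

end CriticalPotential

section CondensateTransition

variable {d : ℕ} {β a b μ ν x y : ℝ}

/-- The pressure of the mean-field gas without long cycles: `-meanFieldPressure d β a μ` is the
minimum of the energy over the pairs `(x, 0)`. -/
noncomputable def meanFieldPressure (d : ℕ) (β a μ : ℝ) : ℝ :=
  μ * xOne d β a μ - a / 2 * xOne d β a μ ^ 2 - gasFreeEnergy d β (xOne d β a μ)

theorem energy_xOne : energy d β a b μ (xOne d β a μ, 0) = -meanFieldPressure d β a μ := by
  unfold energy meanFieldPressure
  ring

theorem meanFieldPressure_add_le (hd : 1 ≤ d) (hβ : 0 < β) (ha : 0 < a) (hx : 0 ≤ x) :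
    μ * x - a / 2 * x ^ 2 - gasFreeEnergy d β x + a / 2 * (x - xOne d β a μ) ^ 2 ≤
      meanFieldPressure d β a μ := by
  have htangent := gasFreeEnergy_add_sBeta_mul_le hd hβ (xOne_pos (d := d) hβ ha μ) hx
  rw [sBeta_xOne hβ ha] at htangent
  unfold meanFieldPressure
  nlinarith

theorem neg_meanFieldPressure_le_energy (hd : 1 ≤ d) (hβ : 0 < β) (ha : 0 < a) (hx : 0 ≤ x) :
    -meanFieldPressure d β a μ ≤ energy d β a b μ (x, 0) := by
  have hmax := meanFieldPressure_add_le (μ := μ) hd hβ ha hx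
  unfold energy
  nlinarith [sq_nonneg (x - xOne d β a μ)]

theorem meanFieldPressure_add_mul_le (hd : 1 ≤ d) (hβ : 0 < β) (ha : 0 < a) :
    meanFieldPressure d β a μ + xOne d β a μ * (ν - μ) ≤ meanFieldPressure d β a ν := by
  have hmax := meanFieldPressure_add_le (μ := ν) hd hβ ha (xOne_pos (d := d) hβ ha μ).le
  have hsq : 0 ≤ a / 2 * (xOne d β a μ - xOne d β a ν) ^ 2 := by positivity
  rw [meanFieldPressure]
  linarith

theorem meanFieldPressure_le_add_mul_add_sq (hd : 1 ≤ d) (hβ : 0 < β) (ha : 0 < a) :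
    meanFieldPressure d β a ν ≤
      meanFieldPressure d β a μ + xOne d β a μ * (ν - μ) + (ν - μ) ^ 2 / (2 * a) := by
  have hmax := meanFieldPressure_add_le (μ := μ) hd hβ ha (xOne_pos (d := d) hβ ha ν).le
  have hsq : (ν - μ) * (xOne d β a ν - xOne d β a μ) ≤
      a / 2 * (xOne d β a ν - xOne d β a μ) ^ 2 + (ν - μ) ^ 2 / (2 * a) := by
    rw [← sub_nonneg]
    calc (0 : ℝ) ≤ (a * (xOne d β a ν - xOne d β a μ) - (ν - μ)) ^ 2 / (2 * a) := by positivity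
      _ = _ := by field_simp; ring
  rw [meanFieldPressure]
  linarith

theorem hasDerivAt_meanFieldPressure (hd : 1 ≤ d) (hβ : 0 < β) (ha : 0 < a) (μ : ℝ) :
    HasDerivAt (meanFieldPressure d β a) (xOne d β a μ) μ :=
  hasDerivAt_of_subgradient univ_mem
    (fun _ _ _ _ => meanFieldPressure_add_mul_le hd hβ ha) (continuous_xOne hβ ha).continuousAt

theorem meanFieldPressure_le (hβ : 0 < β) (ha : 0 < a) (μ : ℝ) :
    meanFieldPressure d β a μ ≤ μ ^ 2 / (2 * a) + gasPressure d β 0 := by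
  have hfree := neg_gasPressure_zero_le_gasFreeEnergy (d := d) hβ (xOne_pos (d := d) hβ ha μ).le
  have hsq : μ * xOne d β a μ - a / 2 * xOne d β a μ ^ 2 ≤ μ ^ 2 / (2 * a) := by
    rw [← sub_nonneg]
    calc (0 : ℝ) ≤ (a * xOne d β a μ - μ) ^ 2 / (2 * a) := by positivity
      _ = _ := by field_simp; ring
  rw [meanFieldPressure]
  linarith

theorem minimisers_top (hd : 1 ≤ d) (hβ : 0 < β) (hb : 0 < b) (hab : b < a) (μ : ℝ) :
    minimisers d β a b μ ⊤ = {(xOne d β a μ, 0)} := by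
  refine minimisers_eq_singleton hd hβ hb hab ?_
  rintro ⟨x, y⟩ hw
  obtain rfl : y = 0 := hw.1.2.resolve_right fun h => ENNReal.ofReal_ne_top (top_le_iff.1 h.2)
  rw [← eq_xOne_of_mem_minimisers hd hβ (hb.trans hab) hw]

theorem energy_optimalLongDensity (hb : 0 < b) (hab : b < a) (μ x : ℝ) :
    energy d β a b μ (x, optimalLongDensity a b μ x) =
      gasFreeEnergy d β x - μ ^ 2 / (2 * a) - b / (2 * a * (a - b)) * (μ - a * x) ^ 2 := by
  have : a - b ≠ 0 := (sub_pos.2 hab).ne'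
  have : a ≠ 0 := (hb.trans hab).ne'
  unfold energy optimalLongDensity
  field_simp
  ring

theorem energy_optimalLongDensity_sub (hab : b < a) (μ ν x : ℝ) :
    energy d β a b ν (x, optimalLongDensity a b ν x) =
      energy d β a b μ (x, optimalLongDensity a b μ x) -
        (x + optimalLongDensity a b μ x) * (ν - μ) - (ν - μ) ^ 2 / (2 * (a - b)) := by
  have : a - b ≠ 0 := (sub_pos.2 hab).ne'
  unfold energy optimalLongDensity
  field_simp
  ring

/-- The chemical potentials at which, for `κ = 0`, the energy has a minimiser with a positive
density of long cycles. -/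
def condensedSet (d : ℕ) (β a b : ℝ) : Set ℝ :=
  {μ | ∃ z ∈ minimisers d β a b μ 0, 0 < z.2}

theorem xOne_le_add_of_mem_minimisers (hd : 1 ≤ d) (hβ : 0 < β) (ha : 0 < a) {κ : ℝ≥0∞}
    (h : (x, y) ∈ minimisers d β a b μ κ) : xOne d β a μ ≤ x + y := by
  by_contra! hlt
  have hy := admissible_nonneg h.1
  have hxlt : x < xOne d β a μ := by simp only at hy; linarith
  have hmono := monotoneOn_sBeta (d := d) hβ (fst_pos_of_mem_minimisers hd hβ h)
    (xOne_pos hβ ha μ) hxlt.le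
  rw [sBeta_xOne hβ ha, sBeta_eq_of_mem_minimisers hd hβ h] at hmono
  nlinarith

-- The pressure with long cycles starts at least as high, with at least the same slope `x + y`, and
-- its second derivative `1 / (a - b)` exceeds the bound `1 / a` for the mean-field pressure.
theorem snd_pos_of_mem_condensedSet_of_lt (hd : 1 ≤ d) (hβ : 0 < β) (hb : 0 < b) (hab : b < a)
    (hμ : μ ∈ condensedSet d β a b) (hμν : μ < ν) {w : ℝ × ℝ}
    (hw : w ∈ minimisers d β a b ν 0) : 0 < w.2 := by
  obtain ⟨⟨x, y⟩, hmin, hy⟩ := hμ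
  obtain ⟨v, z⟩ := w
  refine (admissible_nonneg hw.1).lt_of_ne fun hz => ?_
  simp only at hz hy
  subst hz
  have ha := hb.trans hab
  have hyopt := eq_optimalLongDensity_of_mem_minimisers hab hmin (ENNReal.ofReal_pos.2 hy)
  have hoptν : 0 ≤ optimalLongDensity a b ν x := by
    refine hy.le.trans (hyopt.trans_le ?_)
    have : 0 < a - b := sub_pos.2 hab
    unfold optimalLongDensity
    gcongr
  have hminμ : energy d β a b μ (x, y) ≤ energy d β a b μ (xOne d β a μ, 0) :=
    hmin.2 (xOne_mem_admissible hβ ha μ)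
  have hminν : energy d β a b ν (v, 0) ≤ energy d β a b ν (x, optimalLongDensity a b ν x) :=
    hw.2 (mem_admissible_zero hmin.1.1 hoptν)
  rw [energy_optimalLongDensity_sub hab μ, ← hyopt,
    eq_xOne_of_mem_minimisers hd hβ ha hw, energy_xOne] at hminν
  rw [energy_xOne] at hminμ
  have hquad := meanFieldPressure_le_add_mul_add_sq (d := d) (μ := μ) (ν := ν) hd hβ ha
  have hslope : xOne d β a μ * (ν - μ) ≤ (x + y) * (ν - μ) :=
    mul_le_mul_of_nonneg_right (xOne_le_add_of_mem_minimisers hd hβ ha hmin)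
      (sub_nonneg.2 hμν.le)
  have hcurv : (ν - μ) ^ 2 / (2 * a) < (ν - μ) ^ 2 / (2 * (a - b)) :=
    div_lt_div_of_pos_left (pow_pos (sub_pos.2 hμν) 2) (by linarith) (by linarith)
  linarith

theorem mem_condensedSet_of_lt (hd : 1 ≤ d) (hβ : 0 < β) (hb : 0 < b) (hab : b < a)
    (hx : 0 ≤ x) (hxμ : a * x ≤ μ)
    (h : gasFreeEnergy d β x + gasPressure d β 0 <
      b / (2 * a * (a - b)) * (μ - a * x) ^ 2) : μ ∈ condensedSet d β a b := by
  obtain ⟨⟨u, y⟩, hmin⟩ := minimisers_nonempty (d := d) (μ := μ) (κ := 0) hd hβ hb hab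
  refine ⟨(u, y), hmin, (admissible_nonneg hmin.1).lt_of_ne fun hy => ?_⟩
  simp only at hy
  subst hy
  have hle : energy d β a b μ (u, 0) ≤ energy d β a b μ (x, optimalLongDensity a b μ x) :=
    hmin.2 (mem_admissible_zero hx (div_nonneg (sub_nonneg.2 hxμ) (sub_pos.2 hab).le))
  rw [eq_xOne_of_mem_minimisers hd hβ (hb.trans hab) hmin, energy_xOne,
    energy_optimalLongDensity hb hab] at hle
  linarith [meanFieldPressure_le (d := d) hβ (hb.trans hab) μ]

theorem condensedSet_nonempty (hd : 1 ≤ d) (hβ : 0 < β) (hb : 0 < b) (hab : b < a) :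
    (condensedSet d β a b).Nonempty := by
  have hcoeff : 0 < b / (2 * a * (a - b)) :=
    div_pos hb (mul_pos (mul_pos two_pos (hb.trans hab)) (sub_pos.2 hab))
  have hquad : Tendsto (fun μ : ℝ => b / (2 * a * (a - b)) * μ ^ 2) atTop atTop :=
    (tendsto_pow_atTop two_ne_zero).const_mul_atTop hcoeff
  obtain ⟨μ, hμ, hμ0⟩ :=
    ((hquad.eventually_gt_atTop (gasPressure d β 0)).and (eventually_ge_atTop 0)).exists
  refine ⟨μ, mem_condensedSet_of_lt hd hβ hb hab le_rfl (by simpa using hμ0) ?_⟩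
  simpa [gasFreeEnergy_zero hβ] using hμ

theorem muT_le_of_mem_condensedSet (hd : 1 ≤ d) (hβ : 0 < β) (hb : 0 < b) (hab : b < a)
    (hμ : μ ∈ condensedSet d β a b) : muT d β a b ≤ μ := by
  obtain ⟨⟨x, y⟩, hmin, hy⟩ := hμ
  exact muT_le_of_mem_minimisers hd hβ hb hab hmin (ENNReal.ofReal_pos.2 hy)

theorem bddBelow_condensedSet (hd : 1 ≤ d) (hβ : 0 < β) (hb : 0 < b) (hab : b < a) :
    BddBelow (condensedSet d β a b) :=
  ⟨muT d β a b, fun _ => muT_le_of_mem_condensedSet hd hβ hb hab⟩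

-- A density `x ∈ [ϱ_c, μ / a)` has free energy `-p₀(0)`.
theorem mem_condensedSet_of_muC_lt (hd : 1 ≤ d) (hβ : 0 < β) (hb : 0 < b) (hab : b < a)
    (hμ : muC d β a < ENNReal.ofReal μ) : μ ∈ condensedSet d β a b := by
  have ha := hb.trans hab
  have hμ0 : 0 < μ := ENNReal.ofReal_pos.1 (zero_le.trans_lt hμ)
  have hμa : 0 < μ / a := div_pos hμ0 ha
  rw [muC] at hμ
  obtain ⟨x, hcx, hxμ⟩ : ∃ x, criticalDensity d β < ENNReal.ofReal x ∧ a * x < μ := by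
    have hcμ : criticalDensity d β < ENNReal.ofReal (μ / a) := by
      rw [ENNReal.ofReal_div_of_pos ha]
      exact ENNReal.lt_div_iff_mul_lt (by simp [ha]) (by simp) |>.2 (by rwa [mul_comm])
    obtain ⟨x, -, hcx, hxμ⟩ := ENNReal.lt_iff_exists_real_btwn.1 hcμ
    rw [ENNReal.ofReal_lt_ofReal_iff hμa, lt_div_iff₀' ha] at hxμ
    exact ⟨x, hcx, hxμ⟩
  have hx0 : 0 < x := ENNReal.ofReal_pos.1 (zero_le.trans_lt hcx)
  refine mem_condensedSet_of_lt hd hβ hb hab hx0.le hxμ.le ?_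
  rw [gasFreeEnergy_eq_sBeta hd hβ hx0, sBeta_of_criticalDensity_le hcx.le, zero_mul, zero_sub,
    neg_add_cancel]
  exact mul_pos (div_pos hb (mul_pos (mul_pos two_pos ha) (sub_pos.2 hab)))
    (pow_pos (sub_pos.2 hxμ) 2)

/-- The critical chemical potential `μ*` of the model with `κ = 0`. -/
noncomputable def transitionPoint (d : ℕ) (β a b : ℝ) : ℝ := sInf (condensedSet d β a b)

theorem muT_le_transitionPoint (hd : 1 ≤ d) (hβ : 0 < β) (hb : 0 < b) (hab : b < a) :
    muT d β a b ≤ transitionPoint d β a b :=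
  le_csInf (condensedSet_nonempty hd hβ hb hab) fun _ => muT_le_of_mem_condensedSet hd hβ hb hab

theorem transitionPoint_le_muC (hd : 1 ≤ d) (hβ : 0 < β) (hb : 0 < b) (hab : b < a) :
    (transitionPoint d β a b : EReal) ≤ (muC d β a : EReal) := by
  refine EReal.le_of_forall_lt_iff_le.1 fun μ hμ => EReal.coe_le_coe_iff.2 ?_
  refine csInf_le (bddBelow_condensedSet hd hβ hb hab) (mem_condensedSet_of_muC_lt hd hβ hb hab ?_)
  rwa [← EReal.coe_ennreal_lt_coe_ennreal_iff, EReal.coe_ennreal_ofReal, max_eq_left]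
  exact EReal.coe_nonneg.1 ((EReal.coe_ennreal_nonneg _).trans hμ.le)

theorem minimisers_zero_of_lt (hd : 1 ≤ d) (hβ : 0 < β) (hb : 0 < b) (hab : b < a)
    (hμ : μ < transitionPoint d β a b) : minimisers d β a b μ 0 = {(xOne d β a μ, 0)} := by
  refine minimisers_eq_singleton hd hβ hb hab ?_
  rintro ⟨x, y⟩ hw
  obtain rfl : 0 = y := (admissible_nonneg hw.1).eq_of_not_lt fun hy =>
    hμ.not_ge (csInf_le (bddBelow_condensedSet hd hβ hb hab) ⟨(x, y), hw, hy⟩)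
  rw [← eq_xOne_of_mem_minimisers hd hβ (hb.trans hab) hw]

theorem minimisers_zero_of_gt (hd : 1 ≤ d) (hβ : 0 < β) (hb : 0 < b) (hab : b < a)
    (hμ : transitionPoint d β a b < μ) : minimisers d β a b μ 0 =
      {(xTwo d β a b μ, optimalLongDensity a b μ (xTwo d β a b μ))} := by
  obtain ⟨ν, hν, hνμ⟩ := exists_lt_of_csInf_lt (condensedSet_nonempty hd hβ hb hab) hμ
  exact minimisers_eq_singleton hd hβ hb hab fun w hw =>
    eq_xTwo_of_mem_minimisers hd hβ hb hab hw
      (ENNReal.ofReal_pos.2 (snd_pos_of_mem_condensedSet_of_lt hd hβ hb hab hν hνμ hw))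

theorem xOne_mem_minimisers_transitionPoint (hd : 1 ≤ d) (hβ : 0 < β) (hb : 0 < b)
    (hab : b < a) : (xOne d β a (transitionPoint d β a b), 0) ∈
      minimisers d β a b (transitionPoint d β a b) 0 := by
  have ha := hb.trans hab
  refine ⟨xOne_mem_admissible hβ ha _, fun z hz => ?_⟩
  have hpressure : Tendsto (fun μ => -meanFieldPressure d β a μ)
      (𝓝[<] transitionPoint d β a b) (𝓝 (-meanFieldPressure d β a (transitionPoint d β a b))) :=
    (hasDerivAt_meanFieldPressure hd hβ ha _).continuousAt.neg.tendsto.mono_left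
      nhdsWithin_le_nhds
  have henergy : Tendsto (fun μ => energy d β a b μ z) (𝓝[<] transitionPoint d β a b)
      (𝓝 (energy d β a b (transitionPoint d β a b) z)) := by
    unfold energy
    exact (Continuous.tendsto (by fun_prop) _).mono_left nhdsWithin_le_nhds
  rw [Set.mem_ofPred_eq, energy_xOne]
  refine le_of_tendsto_of_tendsto hpressure henergy ?_
  filter_upwards [self_mem_nhdsWithin] with μ hμ
  have hmem : (xOne d β a μ, 0) ∈ minimisers d β a b μ 0 := by
    rw [minimisers_zero_of_lt hd hβ hb hab hμ]
    rfl
  rw [← energy_xOne (b := b)]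
  exact hmem.2 hz

end CondensateTransition

section ReturnPotential

variable {d : ℕ} {β a b κ μ x : ℝ}

theorem le_optimalLongDensity_xTwo_iff (hβ : 0 < β) (hb : 0 < b) (hab : b < a) (hκ : 0 < κ)
    (hμ : muT d β a b ≤ μ) : κ ≤ optimalLongDensity a b μ (xTwo d β a b μ) ↔
      xTwo d β a b μ ≤ gasDensity d β (-(b * κ)) := by
  have hslope := (criticalPotential_eq_iff hb hab).1 (isLeast_xTwo (d := d) hβ hb hab hμ).2
  have hlt := lt_sBeta_iff (d := d) hβ (xTwo_pos hβ hb hab hμ)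
    (neg_neg_of_pos (mul_pos hb hκ))
  rw [hslope, neg_mul, neg_lt_neg_iff, mul_lt_mul_iff_right₀ hb] at hlt
  rw [← not_lt, hlt, not_lt]

theorem setOf_xTwo_le_eq_Ici (hβ : 0 < β) (hb : 0 < b) (hab : b < a) {X : ℝ}
    (hx : x ∈ Set.Ioc 0 X) (hmin : IsMinOn (criticalPotential d β a b) (Set.Ioc 0 X) x) :
    {s | muT d β a b ≤ s ∧ xTwo d β a b s ≤ X} = Set.Ici (criticalPotential d β a b x) := by
  ext s
  constructor
  · rintro ⟨hs, hsX⟩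
    obtain ⟨hleast, heq⟩ := isLeast_xTwo (d := d) hβ hb hab hs
    rw [Set.mem_Ici, ← heq]
    exact hmin ⟨hleast.1.1, hsX⟩
  · intro hs
    have hsT := (muT_le_criticalPotential (d := d) hβ hb hab hx.1).trans hs
    exact ⟨hsT, ((isLeast_xTwo hβ hb hab hsT).1.2 ⟨hx.1, hs⟩).trans hx.2⟩

theorem exists_isMinOn_criticalPotential_eq_muR (hβ : 0 < β) (hb : 0 < b) (hab : b < a)
    (hκ : 0 < κ) : ∃ x ∈ Set.Ioc 0 (gasDensity d β (-(b * κ))),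
      IsMinOn (criticalPotential d β a b) (Set.Ioc 0 (gasDensity d β (-(b * κ)))) x ∧
      criticalPotential d β a b x = muR d β a b κ := by
  obtain ⟨x, hx, hmin⟩ := exists_isMinOn_Ioc (continuousOn_criticalPotential (d := d) hβ)
    (tendsto_criticalPotential_nhdsGT_zero hβ hb hab)
    (gasDensity_pos hβ (neg_neg_of_pos (mul_pos hb hκ)))
  refine ⟨x, hx, hmin, ?_⟩
  have hset : {s | muT d β a b ≤ s ∧ xTwo d β a b s ≤ 1 / a * (s - κ * (a - b))} =
      {s | muT d β a b ≤ s ∧ xTwo d β a b s ≤ gasDensity d β (-(b * κ))} := by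
    refine Set.ext fun s => and_congr_right fun hs => ?_
    rw [← le_optimalLongDensity_xTwo_iff hβ hb hab hκ hs, optimalLongDensity,
      le_div_iff₀ (sub_pos.2 hab), one_div, inv_mul_eq_div, le_div_iff₀' (hb.trans hab)]
    constructor <;> intro h <;> linarith
  rw [muR, hset, setOf_xTwo_le_eq_Ici hβ hb hab hx hmin, csInf_Ici]

theorem le_optimalLongDensity_xTwo_iff_muR_le (hβ : 0 < β) (hb : 0 < b) (hab : b < a)
    (hκ : 0 < κ) (hμ : muT d β a b ≤ μ) :
    κ ≤ optimalLongDensity a b μ (xTwo d β a b μ) ↔ muR d β a b κ ≤ μ := by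
  obtain ⟨x, hx, hmin, hxR⟩ := exists_isMinOn_criticalPotential_eq_muR (d := d) hβ hb hab hκ
  rw [le_optimalLongDensity_xTwo_iff hβ hb hab hκ hμ, ← hxR]
  exact (and_iff_right hμ).symm.trans
    (Set.ext_iff.1 (setOf_xTwo_le_eq_Ici hβ hb hab hx hmin) μ)

-- Otherwise `criticalPotential` attains its minimum over `(0, X]`, `X = p₀'(-b κ)`, to the left of
-- `X` and takes a smaller value to the right of `X`, against convexity in the slope.
theorem optimalLongDensity_xTwo_muR (hβ : 0 < β) (hb : 0 < b) (hab : b < a) (hκ : 0 < κ)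
    (h : muT d β a b < muR d β a b κ) :
    optimalLongDensity a b (muR d β a b κ) (xTwo d β a b (muR d β a b κ)) = κ := by
  obtain ⟨x, hx, hmin, hxR⟩ := exists_isMinOn_criticalPotential_eq_muR (d := d) hβ hb hab hκ
  obtain ⟨hleast, hcrit⟩ := isLeast_xTwo (d := d) hβ hb hab h.le
  have hX : 0 < gasDensity d β (-(b * κ)) := hx.1.trans_le hx.2
  have hbκ : -(b * κ) < 0 := neg_neg_of_pos (mul_pos hb hκ)
  have hxTwo : xTwo d β a b (muR d β a b κ) = gasDensity d β (-(b * κ)) := by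
    refine ((hleast.2 ⟨hx.1, hxR.le⟩).trans hx.2).eq_of_not_lt fun hlt => ?_
    obtain ⟨s, hs, hsR⟩ : ∃ s < 0, criticalPotential d β a b (gasDensity d β s) <
        muR d β a b κ := by
      rw [muT_eq_sInf hβ] at h
      obtain ⟨_, ⟨s, hs, rfl⟩, hsR⟩ := exists_lt_of_csInf_lt (Set.nonempty_Iio.image _) h
      exact ⟨s, hs, hsR⟩
    have hXs : gasDensity d β (-(b * κ)) < gasDensity d β s := by
      by_contra! hle
      exact hsR.not_ge (hxR ▸ hmin ⟨gasDensity_pos hβ hs, hle⟩)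
    have hXR := criticalPotential_lt_of_lt_of_lt hβ (hb.trans hab) hleast.1.1 hlt hXs
      (by rwa [sBeta_gasDensity hβ hs]) hcrit.le hsR.le
    exact hXR.not_ge (hxR ▸ hmin ⟨hX, le_rfl⟩)
  have hslope := (criticalPotential_eq_iff hb hab).1 hcrit
  rw [hxTwo, sBeta_gasDensity hβ hbκ] at hslope
  rw [hxTwo]
  exact (mul_left_cancel₀ hb.ne' (by linarith)).symm

end ReturnPotential

section IntermediateCutoff

variable {d : ℕ} {β a b κ μ ν x y : ℝ}

/-- The gain in pressure from having density `κ` in long cycles over having no long cycles. -/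
noncomputable def advantage (d : ℕ) (β a b κ μ : ℝ) : ℝ :=
  meanFieldPressure d β a (μ - a * κ) + μ * κ - (a - b) / 2 * κ ^ 2 - meanFieldPressure d β a μ

theorem energy_eq_energy_sub_mul : energy d β a b μ (x, κ) =
    energy d β a b (μ - a * κ) (x, 0) - μ * κ + (a - b) / 2 * κ ^ 2 := by
  unfold energy
  ring

theorem energy_xThree : energy d β a b μ (xThree d β a κ μ, κ) =
    energy d β a b μ (xOne d β a μ, 0) - advantage d β a b κ μ := by
  rw [energy_eq_energy_sub_mul, xThree, energy_xOne, energy_xOne, advantage]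
  ring

theorem energy_xThree_le (hd : 1 ≤ d) (hβ : 0 < β) (ha : 0 < a) (hx : 0 ≤ x) :
    energy d β a b μ (xThree d β a κ μ, κ) ≤ energy d β a b μ (x, κ) := by
  rw [energy_eq_energy_sub_mul, energy_eq_energy_sub_mul (x := x), xThree, energy_xOne]
  gcongr
  exact neg_meanFieldPressure_le_energy hd hβ ha hx

theorem xThree_pos (hβ : 0 < β) (ha : 0 < a) : 0 < xThree d β a κ μ :=
  xOne_pos hβ ha _

theorem eq_xThree_of_mem_minimisers (hd : 1 ≤ d) (hβ : 0 < β) (ha : 0 < a) {c : ℝ≥0∞}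
    (h : (x, κ) ∈ minimisers d β a b μ c) : x = xThree d β a κ μ :=
  eq_xOne hβ ha (fst_pos_of_mem_minimisers hd hβ h)
    (by rw [sBeta_eq_of_mem_minimisers hd hβ h]; ring)

theorem hasDerivAt_advantage (hd : 1 ≤ d) (hβ : 0 < β) (ha : 0 < a) (μ : ℝ) :
    HasDerivAt (advantage d β a b κ) (xThree d β a κ μ + κ - xOne d β a μ) μ := by
  have hshift : HasDerivAt (fun ν => meanFieldPressure d β a (ν - a * κ))
      (xThree d β a κ μ) μ := (hasDerivAt_meanFieldPressure hd hβ ha _).comp_sub_const μ (a * κ)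
  unfold advantage
  exact ((hshift.add ((hasDerivAt_id μ).mul_const κ)).sub_const _).sub
    (hasDerivAt_meanFieldPressure hd hβ ha μ) |>.congr_deriv (by simp)

theorem strictMonoOn_advantage (hd : 1 ≤ d) (hβ : 0 < β) (ha : 0 < a) (hκ : 0 < κ)
    (hν : sBeta d β (xThree d β a κ ν) < 0) :
    StrictMonoOn (advantage d β a b κ) (Set.Iic ν) := by
  refine strictMonoOn_of_deriv_pos (convex_Iic _) (fun μ _ =>
    (hasDerivAt_advantage hd hβ ha μ).continuousAt.continuousWithinAt) fun μ hμ => ?_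
  rw [interior_Iic] at hμ
  rw [(hasDerivAt_advantage hd hβ ha μ).deriv]
  have hle : xThree d β a κ μ ≤ xThree d β a κ ν :=
    (strictMono_xOne hβ ha).monotone (sub_le_sub_right (le_of_lt hμ) _)
  have hlt : xThree d β a κ μ < xOne d β a μ :=
    strictMono_xOne hβ ha (sub_lt_self _ (mul_pos ha hκ))
  have hneg := (monotoneOn_sBeta hβ (xThree_pos hβ ha) (xThree_pos hβ ha) hle).trans_lt hν
  have hslope := sBeta_lt_sBeta hβ (xThree_pos hβ ha) hlt hneg
  rw [sBeta_xOne hβ ha, xThree, sBeta_xOne hβ ha] at hslope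
  rw [xThree]
  nlinarith

theorem mem_admissible_ofReal (hx : 0 ≤ x) (hκ : 0 ≤ κ) (hy : κ ≤ y) :
    (x, y) ∈ admissible (ENNReal.ofReal κ) :=
  ⟨hx, Or.inr ⟨hκ.trans hy, ENNReal.ofReal_le_ofReal hy⟩⟩

theorem eq_zero_or_eq_of_mem_minimisers_of_le_muR (hd : 1 ≤ d) (hβ : 0 < β) (hb : 0 < b)
    (hab : b < a) (hκ : 0 < κ) (hTR : muT d β a b < muR d β a b κ) (hμ : μ ≤ muR d β a b κ)
    (h : (x, y) ∈ minimisers d β a b μ (ENNReal.ofReal κ)) : y = 0 ∨ y = κ := by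
  refine h.1.2.imp_right fun ⟨hy0, hy⟩ => ?_
  rw [ENNReal.ofReal_le_ofReal_iff hy0] at hy
  refine (hy.eq_of_not_lt fun hlt => ?_).symm
  have hlt' : ENNReal.ofReal κ < ENNReal.ofReal y :=
    (ENNReal.ofReal_lt_ofReal_iff (hκ.trans hlt)).2 hlt
  have hyopt := congrArg Prod.snd (eq_xTwo_of_mem_minimisers hd hβ hb hab h hlt')
  have hRμ := (le_optimalLongDensity_xTwo_iff_muR_le hβ hb hab hκ
    (muT_le_of_mem_minimisers hd hβ hb hab h hlt')).1 (hlt.trans_eq hyopt).le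
  simp only [hμ.antisymm hRμ, optimalLongDensity_xTwo_muR hβ hb hab hκ hTR] at hyopt
  exact hlt.ne' hyopt

theorem minimisers_ofReal_of_advantage_neg (hd : 1 ≤ d) (hβ : 0 < β) (hb : 0 < b) (hab : b < a)
    (hκ : 0 < κ) (hTR : muT d β a b < muR d β a b κ) (hμ : μ ≤ muR d β a b κ)
    (hneg : advantage d β a b κ μ < 0) :
    minimisers d β a b μ (ENNReal.ofReal κ) = {(xOne d β a μ, 0)} := by
  have ha := hb.trans hab
  refine minimisers_eq_singleton hd hβ hb hab ?_
  rintro ⟨x, y⟩ hw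
  rcases eq_zero_or_eq_of_mem_minimisers_of_le_muR hd hβ hb hab hκ hTR hμ hw with rfl | rfl
  · rw [← eq_xOne_of_mem_minimisers hd hβ ha hw]
  · have hle : energy d β a b μ (x, y) ≤ energy d β a b μ (xOne d β a μ, 0) :=
      hw.2 (xOne_mem_admissible hβ ha μ)
    have hxThree := energy_xThree_le (b := b) (κ := y) (μ := μ) hd hβ ha hw.1.1
    rw [energy_xThree] at hxThree
    linarith

theorem minimisers_ofReal_of_advantage_pos (hd : 1 ≤ d) (hβ : 0 < β) (hb : 0 < b) (hab : b < a)
    (hκ : 0 < κ) (hTR : muT d β a b < muR d β a b κ) (hμ : μ ≤ muR d β a b κ)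
    (hpos : 0 < advantage d β a b κ μ) :
    minimisers d β a b μ (ENNReal.ofReal κ) = {(xThree d β a κ μ, κ)} := by
  have ha := hb.trans hab
  refine minimisers_eq_singleton hd hβ hb hab ?_
  rintro ⟨x, y⟩ hw
  rcases eq_zero_or_eq_of_mem_minimisers_of_le_muR hd hβ hb hab hκ hTR hμ hw with rfl | rfl
  · have hle : energy d β a b μ (x, 0) ≤ energy d β a b μ (xThree d β a κ μ, κ) :=
      hw.2 (mem_admissible_ofReal (xThree_pos hβ ha).le hκ.le le_rfl)
    rw [energy_xThree, eq_xOne_of_mem_minimisers hd hβ ha hw] at hle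
    linarith
  · rw [← eq_xThree_of_mem_minimisers hd hβ ha hw]

theorem minimisers_zero_muR (hd : 1 ≤ d) (hβ : 0 < β) (hb : 0 < b) (hab : b < a) (hκ : 0 < κ)
    (h : transitionPoint d β a b < muR d β a b κ) :
    minimisers d β a b (muR d β a b κ) 0 = {(xThree d β a κ (muR d β a b κ), κ)} := by
  have hmin := minimisers_zero_of_gt hd hβ hb hab h
  rw [optimalLongDensity_xTwo_muR hβ hb hab hκ
    ((muT_le_transitionPoint hd hβ hb hab).trans_lt h)] at hmin
  have hmem : (xTwo d β a b (muR d β a b κ), κ) ∈ minimisers d β a b (muR d β a b κ) 0 := by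
    rw [hmin]
    rfl
  rw [hmin, eq_xThree_of_mem_minimisers hd hβ (hb.trans hab) hmem]

theorem advantage_muR_pos (hd : 1 ≤ d) (hβ : 0 < β) (hb : 0 < b) (hab : b < a) (hκ : 0 < κ)
    (h : transitionPoint d β a b < muR d β a b κ) :
    0 < advantage d β a b κ (muR d β a b κ) := by
  have hsingleton := minimisers_zero_muR hd hβ hb hab hκ h
  have hmem : (xThree d β a κ (muR d β a b κ), κ) ∈ minimisers d β a b (muR d β a b κ) 0 := by
    rw [hsingleton]
    rfl
  by_contra! hnonpos
  have hxOne : (xOne d β a (muR d β a b κ), 0) ∈ minimisers d β a b (muR d β a b κ) 0 := by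
    refine ⟨xOne_mem_admissible hβ (hb.trans hab) _, isMinOn_iff.2 fun z hz => ?_⟩
    refine le_trans ?_ (isMinOn_iff.1 hmem.2 z hz)
    rw [energy_xThree]
    linarith
  rw [hsingleton] at hxOne
  exact hκ.ne (congrArg Prod.snd hxOne)

theorem advantage_transitionPoint_neg (hd : 1 ≤ d) (hβ : 0 < β) (hb : 0 < b) (hab : b < a)
    (hκ : 0 < κ) (h : transitionPoint d β a b < muR d β a b κ) :
    advantage d β a b κ (transitionPoint d β a b) < 0 := by
  have ha := hb.trans hab
  by_contra! hnonneg
  have hxThree : (xThree d β a κ (transitionPoint d β a b), κ) ∈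
      minimisers d β a b (transitionPoint d β a b) 0 := by
    refine ⟨mem_admissible_zero (xThree_pos hβ ha).le hκ.le, isMinOn_iff.2 fun z hz => ?_⟩
    refine le_trans ?_ (isMinOn_iff.1 (xOne_mem_minimisers_transitionPoint hd hβ hb hab).2 z hz)
    rw [energy_xThree]
    linarith
  have hopt := congrArg Prod.snd
    (eq_xTwo_of_mem_minimisers hd hβ hb hab hxThree (ENNReal.ofReal_pos.2 hκ))
  exact h.not_ge ((le_optimalLongDensity_xTwo_iff_muR_le hβ hb hab hκ
    (muT_le_transitionPoint hd hβ hb hab)).1 hopt.le)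

theorem strictMonoOn_advantage_muR (hd : 1 ≤ d) (hβ : 0 < β) (hb : 0 < b) (hab : b < a)
    (hκ : 0 < κ) (h : transitionPoint d β a b < muR d β a b κ) :
    StrictMonoOn (advantage d β a b κ) (Set.Iic (muR d β a b κ)) := by
  refine strictMonoOn_advantage hd hβ (hb.trans hab) hκ ?_
  rw [sBeta_eq_neg_mul_of_mem_minimisers hd hβ hab
    (by rw [minimisers_zero_muR hd hβ hb hab hκ h]; rfl) (ENNReal.ofReal_pos.2 hκ)]
  exact mul_neg_of_neg_of_pos (neg_neg_of_pos hb) hκ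

theorem exists_advantage_eq_zero (hd : 1 ≤ d) (hβ : 0 < β) (hb : 0 < b) (hab : b < a)
    (hκ : 0 < κ) (h : transitionPoint d β a b < muR d β a b κ) :
    ∃ t ∈ Set.Ioo (transitionPoint d β a b) (muR d β a b κ), advantage d β a b κ t = 0 :=
  intermediate_value_Ioo h.le
    (fun μ _ => (hasDerivAt_advantage hd hβ (hb.trans hab) μ).continuousAt.continuousWithinAt)
    ⟨advantage_transitionPoint_neg hd hβ hb hab hκ h, advantage_muR_pos hd hβ hb hab hκ h⟩

theorem minimisers_ofReal_of_muR_le (hd : 1 ≤ d) (hβ : 0 < β) (hb : 0 < b) (hab : b < a)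
    (hκ : 0 < κ) (hTμ : transitionPoint d β a b < μ) (hRμ : muR d β a b κ ≤ μ) :
    minimisers d β a b μ (ENNReal.ofReal κ) =
      {(xTwo d β a b μ, optimalLongDensity a b μ (xTwo d β a b μ))} := by
  have hμ := (muT_le_transitionPoint hd hβ hb hab).trans hTμ.le
  exact minimisers_eq_of_mem_admissible (minimisers_zero_of_gt hd hβ hb hab hTμ)
    (mem_admissible_ofReal (xTwo_pos hβ hb hab hμ).le hκ.le
      ((le_optimalLongDensity_xTwo_iff_muR_le hβ hb hab hκ hμ).2 hRμ))

theorem exists_transition_ofReal (hd : 1 ≤ d) (hβ : 0 < β) (hb : 0 < b) (hab : b < a)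
    (hκ : 0 < κ) : ∃ t : ℝ,
      (muR d β a b κ ≤ transitionPoint d β a b → t = transitionPoint d β a b) ∧
      (transitionPoint d β a b < muR d β a b κ →
        transitionPoint d β a b < t ∧ t < muR d β a b κ) ∧
      (∀ μ, μ < t → minimisers d β a b μ (ENNReal.ofReal κ) = {(xOne d β a μ, 0)}) ∧
      (∀ μ, t < μ → μ ≤ muR d β a b κ →
        minimisers d β a b μ (ENNReal.ofReal κ) = {(xThree d β a κ μ, κ)}) ∧
      (∀ μ, t < μ → muR d β a b κ ≤ μ → minimisers d β a b μ (ENNReal.ofReal κ) =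
        {(xTwo d β a b μ, optimalLongDensity a b μ (xTwo d β a b μ))}) := by
  rcases le_or_gt (muR d β a b κ) (transitionPoint d β a b) with hRT | hTR
  · refine ⟨transitionPoint d β a b, fun _ => rfl, fun h => absurd hRT h.not_ge, fun μ hμ => ?_,
      fun μ hTμ hμR => absurd (hTμ.trans_le hμR) hRT.not_gt,
      fun μ => minimisers_ofReal_of_muR_le hd hβ hb hab hκ⟩
    exact minimisers_eq_of_mem_admissible (minimisers_zero_of_lt hd hβ hb hab hμ)
      (xOne_mem_admissible hβ (hb.trans hab) μ)
  · obtain ⟨t, ht, hzero⟩ := exists_advantage_eq_zero hd hβ hb hab hκ hTR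
    have hmono := strictMonoOn_advantage_muR hd hβ hb hab hκ hTR
    have hmuT := (muT_le_transitionPoint hd hβ hb hab).trans_lt hTR
    refine ⟨t, fun h => absurd hTR h.not_gt, fun _ => ht, fun μ hμ => ?_, fun μ htμ hμR => ?_,
      fun μ htμ => minimisers_ofReal_of_muR_le hd hβ hb hab hκ (ht.1.trans htμ)⟩
    · exact minimisers_ofReal_of_advantage_neg hd hβ hb hab hκ hmuT (hμ.trans ht.2).le
        (hzero ▸ hmono (hμ.trans ht.2).le ht.2.le hμ)
    · exact minimisers_ofReal_of_advantage_pos hd hβ hb hab hκ hmuT hμR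
        (hzero ▸ hmono ht.2.le hμR htμ)

end IntermediateCutoff

section PoissonWeight

variable {c : ℕ+ → ℝ}

/-- The product Poisson weight `∏ₖ cₖ ^ nₖ / nₖ!` with parameters `c`, without its normalising
factor `exp (-∑ₖ cₖ)`. -/
noncomputable def poissonWeight (c : ℕ+ → ℝ) (n : CycleCounts) : ℝ :=
  n.prod fun k j => c k ^ j / (Nat.factorial j : ℝ)

theorem poissonWeight_nonneg (hc : ∀ k, 0 ≤ c k) (n : CycleCounts) : 0 ≤ poissonWeight c n :=
  Finset.prod_nonneg fun k _ => div_nonneg (pow_nonneg (hc k) _) (Nat.cast_nonneg _)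

theorem poissonWeight_pos (hc : ∀ k, 0 < c k) (n : CycleCounts) : 0 < poissonWeight c n :=
  Finset.prod_pos fun k _ => div_pos (pow_pos (hc k) _) (Nat.cast_pos.2 (Nat.factorial_pos _))

theorem poissonWeight_mul_exp (c e : ℕ+ → ℝ) (n : CycleCounts) :
    poissonWeight (fun k => c k * Real.exp (e k)) n =
      poissonWeight c n * Real.exp (n.sum fun k j => e k * j) := by
  rw [poissonWeight, poissonWeight, Finsupp.prod, Finsupp.prod, Finsupp.sum, Real.exp_sum,
    ← Finset.prod_mul_distrib]
  refine Finset.prod_congr rfl fun k _ => ?_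
  rw [mul_pow, ← Real.exp_nat_mul, mul_comm (e k), div_mul_eq_mul_div]

theorem sum_finsupp_poissonWeight (c : ℕ+ → ℝ) (s : Finset ℕ+) (t : Finset ℕ) :
    ∑ n ∈ s.finsupp fun _ => t, poissonWeight c n =
      ∏ k ∈ s, ∑ j ∈ t, c k ^ j / (Nat.factorial j : ℝ) := by
  classical
  rw [Finset.prod_sum, Finset.finsupp, Finset.sum_map]
  refine Finset.sum_congr (by congr!) fun p _ => ?_
  rw [Function.Embedding.coeFn_mk, poissonWeight, Finsupp.prod_of_support_subset _
    (Finsupp.support_indicator_subset _ _) _ (by simp), ← Finset.prod_attach]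
  exact Finset.prod_congr rfl fun k _ => by rw [Finsupp.indicator_of_mem k.2]

theorem exists_subset_finsupp_range (F : Finset CycleCounts) :
    ∃ (s : Finset ℕ+) (J : ℕ), F ⊆ s.finsupp fun _ => Finset.range J := by
  classical
  refine ⟨F.sup Finsupp.support, (F.sup fun n => n.support.sup n) + 1, fun n hn => ?_⟩
  refine Finset.mem_finsupp_iff.2 ⟨Finset.le_sup (f := Finsupp.support) hn, fun k _ => ?_⟩
  rw [Finset.mem_range, Nat.lt_succ_iff]
  by_cases hk : k ∈ n.support
  · exact (Finset.le_sup hk).trans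
      (Finset.le_sup (f := fun n : CycleCounts => n.support.sup n) hn)
  · rw [Finsupp.notMem_support_iff.1 hk]
    exact Nat.zero_le _

theorem tsum_poissonWeight_le (hc : ∀ k, 0 ≤ c k) (hs : Summable c) :
    ∑' n, ENNReal.ofReal (poissonWeight c n) ≤ ENNReal.ofReal (Real.exp (∑' k, c k)) := by
  rw [ENNReal.tsum_eq_iSup_sum]
  refine iSup_le fun F => ?_
  rw [← ENNReal.ofReal_sum_of_nonneg fun n _ => poissonWeight_nonneg hc n]
  refine ENNReal.ofReal_le_ofReal ?_
  obtain ⟨s, J, hF⟩ := exists_subset_finsupp_range F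
  calc ∑ n ∈ F, poissonWeight c n
      ≤ ∑ n ∈ s.finsupp fun _ => Finset.range J, poissonWeight c n :=
        Finset.sum_le_sum_of_subset_of_nonneg hF fun n _ _ => poissonWeight_nonneg hc n
    _ = ∏ k ∈ s, ∑ j ∈ Finset.range J, c k ^ j / (Nat.factorial j : ℝ) :=
        sum_finsupp_poissonWeight c s _
    _ ≤ ∏ k ∈ s, Real.exp (c k) :=
        Finset.prod_le_prod
          (fun k _ => Finset.sum_nonneg fun j _ =>
            div_nonneg (pow_nonneg (hc k) j) (Nat.cast_nonneg _))
          fun k _ => Real.sum_le_exp_of_nonneg (hc k) _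
    _ = Real.exp (∑ k ∈ s, c k) := (Real.exp_sum _ _).symm
    _ ≤ Real.exp (∑' k, c k) := Real.exp_le_exp.2 (hs.sum_le_tsum s fun k _ => hc k)

end PoissonWeight

section Densities

variable {V : ℝ} {m : ℕ}

/-- The number of particles in cycles shorter than `m`. -/
def shortCount (m : ℕ) (n : CycleCounts) : ℕ :=
  ∑ k ∈ n.support with PNat.val k < m, (k : ℕ) * n k

theorem shortDensity_eq_shortCount_div (V : ℝ) (m : ℕ) (n : CycleCounts) :
    shortDensity V m n = (shortCount m n : ℝ) / V := by
  simp only [shortDensity, shortCount, cycleDensity, Nat.cast_sum, Nat.cast_mul, Finset.sum_div,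
    mul_div_assoc]

theorem shortDensity_nonneg (hV : 0 ≤ V) (n : CycleCounts) : 0 ≤ shortDensity V m n := by
  rw [shortDensity_eq_shortCount_div]
  positivity

theorem cast_mul_cycleDensity_nonneg (hV : 0 ≤ V) (n : CycleCounts) (k : ℕ+) :
    0 ≤ ((k : ℕ) : ℝ) * cycleDensity V n k :=
  mul_nonneg (Nat.cast_nonneg _) (div_nonneg (Nat.cast_nonneg _) hV)

theorem longDensity_nonneg (hV : 0 ≤ V) (n : CycleCounts) : 0 ≤ longDensity V m n :=
  Finset.sum_nonneg fun k _ => cast_mul_cycleDensity_nonneg hV n k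

theorem longDensity_eq_zero_or_le (hV : 0 ≤ V) (n : CycleCounts) :
    longDensity V m n = 0 ∨ (m : ℝ) / V ≤ longDensity V m n := by
  rcases (n.support.filter fun k => m ≤ PNat.val k).eq_empty_or_nonempty with hempty | ⟨k, hk⟩
  · exact .inl (by rw [longDensity, hempty, Finset.sum_empty])
  refine .inr (le_trans ?_
    (Finset.single_le_sum (fun k _ => cast_mul_cycleDensity_nonneg hV n k) hk))
  obtain ⟨hsupp, hm⟩ := Finset.mem_filter.1 hk
  have hcount : 1 ≤ n k := Nat.one_le_iff_ne_zero.2 (Finsupp.mem_support_iff.1 hsupp)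
  rw [cycleDensity, ← mul_div_assoc]
  gcongr
  exact_mod_cast hm.trans (Nat.le_mul_of_pos_right _ hcount)

theorem sum_cast_mul_cycleDensity (V : ℝ) (m : ℕ) (n : CycleCounts) :
    ∑ k ∈ n.support, ((k : ℕ) : ℝ) * cycleDensity V n k =
      shortDensity V m n + longDensity V m n := by
  simp only [shortDensity, longDensity, ← not_lt, Finset.sum_filter_add_sum_filter_not]

/-- The counter term `∑_{k ≥ m} k² λₖ²` of the Hamiltonian. -/
noncomputable def longSquare (V : ℝ) (m : ℕ) (n : CycleCounts) : ℝ :=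
  ∑ k ∈ n.support with m ≤ PNat.val k, ((k : ℕ) : ℝ) ^ 2 * cycleDensity V n k ^ 2

theorem longSquare_le_sq_longDensity (hV : 0 ≤ V) (n : CycleCounts) :
    longSquare V m n ≤ longDensity V m n ^ 2 := by
  simp_rw [longSquare, longDensity, ← mul_pow]
  exact Finset.sum_sq_le_sq_sum_of_nonneg fun k _ => cast_mul_cycleDensity_nonneg hV n k

end Densities

section GibbsWeight

variable {d : ℕ} {β a b α μ V : ℝ} {m : ℕ}

theorem referenceWeight_nonneg (hβ : 0 < β) (hV : 0 ≤ V) (n : CycleCounts) :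
    0 ≤ referenceWeight d β α V n := by
  refine mul_nonneg (Real.exp_nonneg _) (poissonWeight_nonneg (fun k => ?_) n)
  have := cycleWeight_pos (d := d) hβ k
  positivity

/-- The weight of a configuration under the unnormalised Gibbs measure, divided by the factor
`exp (-V ∑ₖ qₖ exp (βαk))`; it no longer depends on `α`. -/
noncomputable def gibbsWeight (d : ℕ) (β a b μ V : ℝ) (m : ℕ) (n : CycleCounts) : ℝ :=
  poissonWeight (fun k => V * cycleWeight d β k) n *
    Real.exp (β * V * (μ * (shortDensity V m n + longDensity V m n)
      - a / 2 * (shortDensity V m n + longDensity V m n) ^ 2 + b / 2 * longSquare V m n))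

theorem poissonWeight_cycleWeight_pos (hβ : 0 < β) (hV : 0 < V) (n : CycleCounts) :
    0 < poissonWeight (fun k => V * cycleWeight d β k) n :=
  poissonWeight_pos (fun k => mul_pos hV (cycleWeight_pos hβ k)) n

theorem gibbsWeight_pos (hβ : 0 < β) (hV : 0 < V) (n : CycleCounts) :
    0 < gibbsWeight d β a b μ V m n :=
  mul_pos (poissonWeight_cycleWeight_pos hβ hV n) (Real.exp_pos _)

theorem referenceWeight_mul_exp_hamiltonian (hV : V ≠ 0) (n : CycleCounts) :
    referenceWeight d β α V n * Real.exp (-β * hamiltonian a b α μ V m n) =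
      Real.exp (-(V * totalWeight d β α)) * gibbsWeight d β a b μ V m n := by
  have hexponent : (n.sum fun k j => β * α * ((k : ℕ) : ℝ) * j) =
      β * α * V * (shortDensity V m n + longDensity V m n) := by
    rw [← sum_cast_mul_cycleDensity, Finsupp.sum, Finset.mul_sum]
    refine Finset.sum_congr rfl fun k _ => ?_
    rw [cycleDensity]
    field_simp
  have hreference : referenceWeight d β α V n = Real.exp (-(V * totalWeight d β α)) *
      (poissonWeight (fun k => V * cycleWeight d β k) n *
        Real.exp (β * α * V * (shortDensity V m n + longDensity V m n))) := by
    rw [← hexponent, ← poissonWeight_mul_exp]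
    rfl
  have hhamiltonian : hamiltonian a b α μ V m n =
      V * (-(μ - α) * (shortDensity V m n + longDensity V m n)
        + a / 2 * (shortDensity V m n + longDensity V m n) ^ 2 - b / 2 * longSquare V m n) := by
    rw [hamiltonian, sum_cast_mul_cycleDensity V m n, longSquare]
  rw [hreference, hhamiltonian, gibbsWeight, mul_assoc, mul_assoc, ← Real.exp_add]
  congr 3
  ring

theorem lintegral_referenceMeasure (f : CycleCounts → ℝ≥0∞) :
    ∫⁻ n, f n ∂(referenceMeasure d β α V) =
      ∑' n, ENNReal.ofReal (referenceWeight d β α V n) * f n := by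
  simp only [referenceMeasure, lintegral_sum_measure, lintegral_smul_measure,
    lintegral_dirac' _ (measurable_from_top (f := f)), smul_eq_mul]

theorem setLIntegral_exp_hamiltonian (hβ : 0 < β) (hV : 0 < V) (S : Set CycleCounts) :
    ∫⁻ n in S, ENNReal.ofReal (Real.exp (-β * hamiltonian a b α μ V m n))
      ∂(referenceMeasure d β α V) = ENNReal.ofReal (Real.exp (-(V * totalWeight d β α))) *
        ∑' n, S.indicator (fun n => ENNReal.ofReal (gibbsWeight d β a b μ V m n)) n := by
  rw [← lintegral_indicator (MeasurableSpace.measurableSet_top), lintegral_referenceMeasure,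
    ← ENNReal.tsum_mul_left]
  refine tsum_congr fun n => ?_
  by_cases hn : n ∈ S
  · rw [Set.indicator_of_mem hn, Set.indicator_of_mem hn,
      ← ENNReal.ofReal_mul (referenceWeight_nonneg hβ hV.le n),
      referenceWeight_mul_exp_hamiltonian hV.ne', ENNReal.ofReal_mul (Real.exp_nonneg _)]
  · rw [Set.indicator_of_notMem hn, Set.indicator_of_notMem hn, mul_zero, mul_zero]

theorem gibbsMeasure_apply (hβ : 0 < β) (hV : 0 < V)
    (hfin : ∑' n, ENNReal.ofReal (gibbsWeight d β a b μ V m n) ≠ ⊤) (S : Set CycleCounts) :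
    gibbsMeasure d β a b α μ V m S =
      (∑' n, S.indicator (fun n => ENNReal.ofReal (gibbsWeight d β a b μ V m n)) n) /
        ∑' n, ENNReal.ofReal (gibbsWeight d β a b μ V m n) := by
  set E := ENNReal.ofReal (Real.exp (-(V * totalWeight d β α))) with hE
  have hE0 : E ≠ 0 := (ENNReal.ofReal_pos.2 (Real.exp_pos _)).ne'
  set Z := ∑' n, ENNReal.ofReal (gibbsWeight d β a b μ V m n)
  have hZ0 : Z ≠ 0 := fun h => (ENNReal.ofReal_pos.2 (gibbsWeight_pos hβ hV 0)).ne'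
    (ENNReal.tsum_eq_zero.1 h 0)
  have hmass : ∫⁻ n, ENNReal.ofReal (Real.exp (-β * hamiltonian a b α μ V m n))
      ∂(referenceMeasure d β α V) = E * Z := by
    rw [← setLIntegral_univ, setLIntegral_exp_hamiltonian hβ hV, Set.indicator_univ]
  have hint : ∫ n, Real.exp (-β * hamiltonian a b α μ V m n) ∂(referenceMeasure d β α V) =
      (E * Z).toReal := by
    rw [integral_eq_lintegral_of_nonneg_ae (Eventually.of_forall fun n => Real.exp_nonneg _)
      measurable_from_top.aestronglyMeasurable, hmass]
  have hEZ : E * Z ≠ ⊤ := ENNReal.mul_ne_top ENNReal.ofReal_ne_top hfin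
  simp_rw [gibbsMeasure, tilted_apply' _ _ (MeasurableSpace.measurableSet_top), hint,
    ENNReal.ofReal_div_of_pos (ENNReal.toReal_pos (mul_ne_zero hE0 hZ0) hEZ),
    ENNReal.ofReal_toReal hEZ, div_eq_mul_inv]
  rw [lintegral_mul_const _ measurable_from_top, setLIntegral_exp_hamiltonian hβ hV, ← hE,
    ← div_eq_mul_inv, ← div_eq_mul_inv, ENNReal.mul_div_mul_left _ _ hE0 ENNReal.ofReal_ne_top]

theorem gibbsWeight_le (hβ : 0 < β) (hb : 0 ≤ b) (hV : 0 < V) (n : CycleCounts) :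
    gibbsWeight d β a b μ V m n ≤ poissonWeight (fun k => V * cycleWeight d β k) n *
      Real.exp (β * V * (gasFreeEnergy d β (shortDensity V m n)
        - energy d β a b μ (shortDensity V m n, longDensity V m n))) := by
  refine mul_le_mul_of_nonneg_left
    (Real.exp_le_exp.2 (mul_le_mul_of_nonneg_left ?_ (mul_pos hβ hV).le))
    (poissonWeight_cycleWeight_pos hβ hV n).le
  have := mul_le_mul_of_nonneg_left (longSquare_le_sq_longDensity (m := m) hV.le n)
    (div_nonneg hb zero_le_two)
  simp only [energy]
  linarith

/-- The total weight `∑_{k ≥ m} qₖ` of the long cycles. -/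
noncomputable def tailWeight (d : ℕ) (β : ℝ) (m : ℕ) : ℝ :=
  ∑' k : ℕ+, {k : ℕ+ | m ≤ (k : ℕ)}.indicator (cycleWeight d β) k

theorem tendsto_tailWeight (hd : 1 ≤ d) (hβ : 0 < β) :
    Tendsto (tailWeight d β) atTop (𝓝 0) := by
  have hlim := tendsto_tsum_of_dominated_convergence (𝓕 := atTop)
    (f := fun (m : ℕ) => {k : ℕ+ | m ≤ (k : ℕ)}.indicator (cycleWeight d β))
    (g := fun _ => (0 : ℝ)) (summable_cycleWeight (d := d) (β := β) hd) (fun k => ?_)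
    (Eventually.of_forall fun m k => ?_)
  · rwa [tsum_zero] at hlim
  · refine tendsto_const_nhds.congr' ?_
    filter_upwards [eventually_gt_atTop (k : ℕ)] with m hm
    exact (Set.indicator_of_notMem (s := {k : ℕ+ | m ≤ (k : ℕ)}) (not_le.2 hm) _).symm
  · exact (norm_indicator_le_norm_self _ _).trans_eq
      (Real.norm_of_nonneg (cycleWeight_pos hβ k).le)

theorem sum_ite_lt_mul (s : ℝ) (m : ℕ) (n : CycleCounts) :
    (n.sum fun k j => (if (k : ℕ) < m then s * (k : ℕ) else 0) * j) = s * shortCount m n := by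
  rw [shortCount, Finsupp.sum, Nat.cast_sum, Finset.mul_sum, Finset.sum_filter]
  refine Finset.sum_congr rfl fun k _ => ?_
  split_ifs <;> push_cast <;> ring

-- Only the short cycles are tilted, so the untilted long ones contribute their total weight.
theorem tsum_poissonWeight_mul_exp_shortCount_le (hd : 1 ≤ d) (hβ : 0 < β) (hV : 0 ≤ V) {s : ℝ}
    (hs : s ≤ 0) : ∑' n, ENNReal.ofReal (poissonWeight (fun k => V * cycleWeight d β k) n *
      Real.exp (β * s * shortCount m n)) ≤
        ENNReal.ofReal (Real.exp (V * (β * gasPressure d β s + tailWeight d β m))) := by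
  set c : ℕ+ → ℝ := fun k => V * cycleWeight d β k *
    Real.exp (if (k : ℕ) < m then β * s * (k : ℕ) else 0)
  have hq := fun k => (cycleWeight_pos (d := d) hβ k).le
  have hc0 : ∀ k, 0 ≤ c k := fun k => mul_nonneg (mul_nonneg hV (hq k)) (Real.exp_nonneg _)
  have hcle : ∀ k, c k ≤ V * (cycleWeight d β k * Real.exp (β * s * (k : ℕ)) +
      {k : ℕ+ | m ≤ (k : ℕ)}.indicator (cycleWeight d β) k) := by
    intro k
    refine (mul_assoc _ _ _).trans_le (mul_le_mul_of_nonneg_left ?_ hV)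
    rcases lt_or_ge (k : ℕ) m with hk | hk
    · rw [if_pos hk]
      exact le_add_of_nonneg_right (Set.indicator_nonneg (fun k _ => hq k) k)
    · rw [if_neg hk.not_gt, Real.exp_zero, mul_one, Set.indicator_of_mem (by exact hk)]
      exact le_add_of_nonneg_left (mul_nonneg (hq k) (Real.exp_nonneg _))
  have hshort := summable_cycleWeight_mul_exp hd hβ
    (mul_nonpos_of_nonneg_of_nonpos hβ.le hs)
  have hlong := (summable_cycleWeight (d := d) (β := β) hd).indicator {k : ℕ+ | m ≤ (k : ℕ)}
  have hdom := (hshort.add hlong).mul_left V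
  have hsummable := Summable.of_nonneg_of_le hc0 hcle hdom
  simp_rw [← sum_ite_lt_mul, ← poissonWeight_mul_exp]
  refine (tsum_poissonWeight_le hc0 hsummable).trans
    (ENNReal.ofReal_le_ofReal (Real.exp_le_exp.2 ((hsummable.tsum_le_tsum hcle hdom).trans_eq ?_)))
  rw [tsum_mul_left, hshort.tsum_add hlong, tailWeight, gasPressure, expSeries]
  field_simp

-- Exponential Chebyshev inequality, with a tilt that almost attains the supremum defining the
-- free energy; the `1` pays for the supremum not being attained at density zero.
theorem tsum_poissonWeight_shortCount_eq_le (hd : 1 ≤ d) (hβ : 0 < β) (hV : 0 < V) (i : ℕ) :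
    ∑' n, {n | shortCount m n = i}.indicator (fun n => ENNReal.ofReal
      (poissonWeight (fun k => V * cycleWeight d β k) n *
        Real.exp (β * V * gasFreeEnergy d β (i / V)))) n ≤
      ENNReal.ofReal (Real.exp (V * tailWeight d β m + 1)) := by
  have hβV := mul_pos hβ hV
  obtain ⟨_, ⟨s, hs, rfl⟩, hlt⟩ := (lt_isLUB_iff (isLUB_gasFreeEnergy (d := d) hβ
    (div_nonneg (Nat.cast_nonneg i) hV.le))).1
    (sub_lt_self (gasFreeEnergy d β (i / V)) (one_div_pos.2 hβV))
  have htilt : β * V * gasFreeEnergy d β (i / V) ≤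
      1 - β * V * gasPressure d β s + β * s * i := by
    have := mul_le_mul_of_nonneg_left hlt.le hβV.le
    field_simp at this ⊢
    linarith
  have hterm : ∀ n, {n | shortCount m n = i}.indicator (fun n => ENNReal.ofReal
      (poissonWeight (fun k => V * cycleWeight d β k) n *
        Real.exp (β * V * gasFreeEnergy d β (i / V)))) n ≤
      ENNReal.ofReal (Real.exp (1 - β * V * gasPressure d β s)) * ENNReal.ofReal
        (poissonWeight (fun k => V * cycleWeight d β k) n *
          Real.exp (β * s * shortCount m n)) := by
    refine Set.indicator_le fun n hn => ?_
    rw [show shortCount m n = i from hn, ← ENNReal.ofReal_mul (Real.exp_nonneg _), mul_left_comm,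
      ← Real.exp_add]
    exact ENNReal.ofReal_le_ofReal (mul_le_mul_of_nonneg_left (Real.exp_le_exp.2 htilt)
      (poissonWeight_cycleWeight_pos hβ hV n).le)
  calc _ ≤ ENNReal.ofReal (Real.exp (1 - β * V * gasPressure d β s)) *
        ENNReal.ofReal (Real.exp (V * (β * gasPressure d β s + tailWeight d β m))) := by
        refine (ENNReal.tsum_le_tsum hterm).trans ?_
        rw [ENNReal.tsum_mul_left]
        gcongr
        exact tsum_poissonWeight_mul_exp_shortCount_le hd hβ hV.le hs
    _ = _ := by
        rw [← ENNReal.ofReal_mul (Real.exp_nonneg _), ← Real.exp_add]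
        congr 2
        ring

theorem gibbsWeight_le_of_add_le_energy (hβ : 0 < β) (hb : 0 ≤ b) (hV : 0 < V) {c τ : ℝ}
    {n : CycleCounts} (hn : c + τ * shortDensity V m n ≤
      energy d β a b μ (shortDensity V m n, longDensity V m n)) :
    gibbsWeight d β a b μ V m n ≤ Real.exp (-(β * V * c)) * Real.exp (-(β * τ)) ^ shortCount m n *
      (poissonWeight (fun k => V * cycleWeight d β k) n *
        Real.exp (β * V * gasFreeEnergy d β (shortCount m n / V))) := by
  have hshort : β * V * (τ * shortDensity V m n) = shortCount m n * (β * τ) := by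
    rw [shortDensity_eq_shortCount_div]
    field_simp
  refine (gibbsWeight_le hβ hb hV n).trans ?_
  rw [mul_left_comm, ← Real.exp_nat_mul, ← Real.exp_add, ← Real.exp_add,
    ← shortDensity_eq_shortCount_div]
  refine mul_le_mul_of_nonneg_left (Real.exp_le_exp.2 ?_)
    (poissonWeight_cycleWeight_pos hβ hV n).le
  have := mul_le_mul_of_nonneg_left hn (mul_pos hβ hV).le
  linarith

theorem tsum_indicator_gibbsWeight_le (hd : 1 ≤ d) (hβ : 0 < β) (hb : 0 ≤ b) (hV : 0 < V)
    {S : Set CycleCounts} {c τ : ℝ} (hτ : 0 < τ)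
    (hS : ∀ n ∈ S, c + τ * shortDensity V m n ≤
      energy d β a b μ (shortDensity V m n, longDensity V m n)) :
    ∑' n, S.indicator (fun n => ENNReal.ofReal (gibbsWeight d β a b μ V m n)) n ≤
      ENNReal.ofReal (Real.exp (V * tailWeight d β m + 1 - β * V * c) *
        (1 - Real.exp (-(β * τ)))⁻¹) := by
  set r := Real.exp (-(β * τ))
  have hterm : ∀ n, S.indicator (fun n => ENNReal.ofReal (gibbsWeight d β a b μ V m n)) n ≤
      ∑' i : ℕ, ENNReal.ofReal (Real.exp (-(β * V * c)) * r ^ i) *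
        {n | shortCount m n = i}.indicator (fun n => ENNReal.ofReal
          (poissonWeight (fun k => V * cycleWeight d β k) n *
            Real.exp (β * V * gasFreeEnergy d β (i / V)))) n := by
    refine Set.indicator_le fun n hn => le_trans ?_ (ENNReal.le_tsum (shortCount m n))
    rw [Set.indicator_of_mem (by exact rfl), ← ENNReal.ofReal_mul (by positivity)]
    exact ENNReal.ofReal_le_ofReal (gibbsWeight_le_of_add_le_energy hβ hb hV (hS n hn))
  have hgeometric := hasSum_geometric_of_lt_one (Real.exp_nonneg (-(β * τ)))
    (Real.exp_lt_one_iff.2 (neg_neg_of_pos (mul_pos hβ hτ)))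
  calc _ ≤ ∑' i : ℕ, ENNReal.ofReal (Real.exp (-(β * V * c)) * r ^ i) *
        ENNReal.ofReal (Real.exp (V * tailWeight d β m + 1)) := by
        refine (ENNReal.tsum_le_tsum hterm).trans ?_
        rw [ENNReal.tsum_comm]
        refine ENNReal.tsum_le_tsum fun i => ?_
        rw [ENNReal.tsum_mul_left]
        gcongr
        exact tsum_poissonWeight_shortCount_eq_le hd hβ hV i
    _ = ENNReal.ofReal (Real.exp (-(β * V * c)) * (1 - r)⁻¹) *
        ENNReal.ofReal (Real.exp (V * tailWeight d β m + 1)) := by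
        rw [ENNReal.tsum_mul_right, ← ENNReal.ofReal_tsum_of_nonneg (fun i => by positivity)
          (hgeometric.summable.mul_left _), tsum_mul_left, hgeometric.tsum_eq]
    _ = _ := by
        rw [← ENNReal.ofReal_mul' (Real.exp_nonneg _), mul_right_comm, ← Real.exp_add]
        congr 3
        ring

end GibbsWeight

section FiniteTilt

variable {d : ℕ} {β x ε t : ℝ}

theorem sum_mul_exp_sBeta_le (hβ : 0 < β) (hx : 0 < x) (A : Finset ℕ+) :
    ∑ k ∈ A, ((k : ℕ) : ℝ) * cycleWeight d β k * Real.exp (β * sBeta d β x * (k : ℕ)) ≤ x := by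
  have hcont : Continuous fun s : ℝ =>
      ∑ k ∈ A, ((k : ℕ) : ℝ) * cycleWeight d β k * Real.exp (β * s * (k : ℕ)) := by fun_prop
  refine le_of_tendsto ((hcont.tendsto _).mono_left nhdsWithin_le_nhds)
    (f := fun s => _) (x := 𝓝[<] sBeta d β x) ?_
  filter_upwards [self_mem_nhdsWithin] with s hs
  have hs0 : s < 0 := lt_of_lt_of_le hs (sBeta_nonpos hβ hx)
  exact ((summable_cast_mul_cycleWeight_mul_exp hβ (mul_neg_of_pos_of_neg hβ hs0)).sum_le_tsum A
    fun k _ => (mul_pos (cast_mul_cycleWeight_pos hβ k) (Real.exp_pos _)).le).trans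
      ((lt_sBeta_iff hβ hx hs0).1 hs).le

theorem exists_lt_sum_mul_exp (hβ : 0 < β) (hx : 0 < x) (ht : sBeta d β x < t) :
    ∃ A : Finset ℕ+,
      x < ∑ k ∈ A, ((k : ℕ) : ℝ) * cycleWeight d β k * Real.exp (β * t * (k : ℕ)) := by
  by_contra! hbounded
  have hnn (s : ℝ) (k : ℕ+) :
      0 ≤ ((k : ℕ) : ℝ) * cycleWeight d β k * Real.exp (β * s * (k : ℕ)) :=
    (mul_pos (cast_mul_cycleWeight_pos hβ k) (Real.exp_pos _)).le
  rcases (sBeta_nonpos (d := d) hβ hx).lt_or_eq with hneg | hzero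
  · obtain ⟨u, hu, hut⟩ := exists_between (lt_min ht hneg)
    have hu0 : u < 0 := hut.trans_le (min_le_right _ _)
    refine ((sBeta_lt_iff hβ hx hu0).1 hu).not_ge
      (Real.tsum_le_of_sum_le (hnn u) fun A => le_trans ?_ (hbounded A))
    have := hut.le.trans (min_le_left _ _)
    gcongr with k
    exact (cast_mul_cycleWeight_pos hβ k).le
  · rw [hzero] at ht
    refine not_summable_cycleWeight_mul_exp (d := d) hβ (mul_pos hβ ht)
      (Summable.of_nonneg_of_le (fun k => (mul_pos (cycleWeight_pos hβ k) (Real.exp_pos _)).le)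
        (fun k => ?_) (summable_of_sum_le (hnn t) hbounded))
    exact mul_le_mul_of_nonneg_right
      (le_mul_of_one_le_left (cycleWeight_pos hβ k).le (one_le_cast_pnat k)) (Real.exp_nonneg _)

-- Above the critical density the tilt is slightly positive, which is possible only because `A` is
-- finite; the missing density then sits in the longest cycles of `A`.
theorem exists_finset_tilt (hd : 1 ≤ d) (hβ : 0 < β) (hx : 0 < x) (hε : 0 < ε) :
    ∃ (A : Finset ℕ+) (s : ℝ),
      ∑ k ∈ A, ((k : ℕ) : ℝ) * cycleWeight d β k * Real.exp (β * s * (k : ℕ)) = x ∧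
      s * x - 1 / β * ∑ k ∈ A, cycleWeight d β k * Real.exp (β * s * (k : ℕ)) ≤
        gasFreeEnergy d β x + ε := by
  set r := sBeta d β x
  obtain ⟨t, hrt, htx⟩ : ∃ t, r < t ∧ (t - r) * x ≤ ε / 2 :=
    ⟨r + ε / 2 / x, lt_add_of_pos_right _ (by positivity), le_of_eq (by field_simp; ring)⟩
  obtain ⟨A₀, hA₀⟩ := exists_lt_sum_mul_exp hβ hx hrt
  have hpressure : ∀ᶠ A : Finset ℕ+ in atTop, gasPressure d β r - ε / 2 <
      1 / β * ∑ k ∈ A, cycleWeight d β k * Real.exp (β * r * (k : ℕ)) :=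
    ((summable_cycleWeight_mul_exp hd hβ (mul_nonpos_of_nonneg_of_nonpos hβ.le
      (sBeta_nonpos hβ hx))).hasSum.const_mul (1 / β)).eventually_const_lt
        (sub_lt_self _ (half_pos hε))
  obtain ⟨A, hApressure, hA⟩ := (hpressure.and (eventually_ge_atTop A₀)).exists
  have hupper : x ≤ ∑ k ∈ A, ((k : ℕ) : ℝ) * cycleWeight d β k * Real.exp (β * t * (k : ℕ)) :=
    hA₀.le.trans (Finset.sum_le_sum_of_subset_of_nonneg hA fun k _ _ =>
      (mul_pos (cast_mul_cycleWeight_pos hβ k) (Real.exp_pos _)).le)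
  have hcont : Continuous fun s : ℝ =>
      ∑ k ∈ A, ((k : ℕ) : ℝ) * cycleWeight d β k * Real.exp (β * s * (k : ℕ)) := by fun_prop
  obtain ⟨s, hs, hsx⟩ := intermediate_value_Icc hrt.le hcont.continuousOn
    ⟨sum_mul_exp_sBeta_le hβ hx A, hupper⟩
  refine ⟨A, s, hsx, ?_⟩
  have hmono : 1 / β * ∑ k ∈ A, cycleWeight d β k * Real.exp (β * r * (k : ℕ)) ≤
      1 / β * ∑ k ∈ A, cycleWeight d β k * Real.exp (β * s * (k : ℕ)) := by
    have := hs.1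
    gcongr with k
    exact (cycleWeight_pos hβ k).le
  have hsx' : s * x ≤ t * x := mul_le_mul_of_nonneg_right hs.2 hx.le
  rw [gasFreeEnergy_eq_sBeta hd hβ hx]
  linarith

end FiniteTilt

section PoissonAsymptotics

variable {d : ℕ} {β : ℝ} {V : ℕ → ℝ}

theorem tendsto_mul_log_sub_log_factorial_div :
    Tendsto (fun n : ℕ => (n * Real.log n - Real.log (Nat.factorial n)) / n) atTop (𝓝 1) := by
  have hlog : Tendsto (fun n : ℕ => Real.log n / n) atTop (𝓝 0) :=
    Real.isLittleO_log_id_atTop.tendsto_div_nhds_zero.comp tendsto_natCast_atTop_atTop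
  have hstirling : Tendsto (fun n : ℕ => (Real.log (Stirling.stirlingSeq n) +
      1 / 2 * Real.log 2) / n) atTop (𝓝 0) :=
    (((Real.continuousAt_log (by positivity)).tendsto.comp
      Stirling.tendsto_stirlingSeq_sqrt_pi).add_const _).div_atTop tendsto_natCast_atTop_atTop
  have hlim := (tendsto_const_nhds (x := (1 : ℝ))).sub (hstirling.add (hlog.const_mul (1 / 2)))
  rw [mul_zero, add_zero, sub_zero] at hlim
  refine hlim.congr' ?_
  filter_upwards [eventually_gt_atTop 0] with n hn
  have hn0 : (0 : ℝ) < n := Nat.cast_pos.2 hn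
  have hformula := Stirling.log_stirlingSeq_formula n
  rw [Real.log_mul two_ne_zero hn0.ne', Real.log_div hn0.ne' (Real.exp_ne_zero 1),
    Real.log_exp] at hformula
  rw [hformula]
  field_simp
  ring

theorem tendsto_log_pow_div_factorial_div (hV : Tendsto V atTop atTop) {n : ℕ → ℕ} {q ν : ℝ}
    (hq : 0 < q) (hν : 0 < ν) (hn : Tendsto (fun j => (n j : ℝ) / V j) atTop (𝓝 ν)) :
    Tendsto (fun j => Real.log ((V j * q) ^ n j / (Nat.factorial (n j) : ℝ)) / V j) atTop
      (𝓝 (ν * (1 - Real.log (ν / q)))) := by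
  have hn_atTop : Tendsto n atTop atTop := by
    refine tendsto_natCast_atTop_iff.1 ((hn.pos_mul_atTop hν hV).congr' ?_)
    filter_upwards [hV.eventually_ne_atTop 0] with j hj
    exact div_mul_cancel₀ _ hj
  have hlog := (hn.div_const q).log (div_pos hν hq).ne'
  refine (hn.mul ((tendsto_mul_log_sub_log_factorial_div.comp hn_atTop).sub hlog)).congr' ?_
  filter_upwards [hV.eventually_gt_atTop 0, hn_atTop.eventually_gt_atTop 0] with j hVj hnj
  have hnj' : (0 : ℝ) < n j := Nat.cast_pos.2 hnj
  rw [Function.comp_apply, Real.log_div (pow_pos (mul_pos hVj hq) _).ne'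
    (Nat.cast_ne_zero.2 (Nat.factorial_ne_zero _)), Real.log_pow, Real.log_mul hVj.ne' hq.ne',
    Real.log_div (div_pos hnj' hVj).ne' hq.ne', Real.log_div hnj'.ne' hVj.ne']
  field_simp
  ring

theorem tendsto_log_mul_cycleWeight_div (hβ : 0 < β) (hV : Tendsto V atTop atTop) {K : ℕ → ℕ+}
    {y : ℝ} (hy : 0 < y) (hK : Tendsto (fun j => ((K j : ℕ) : ℝ) / V j) atTop (𝓝 y)) :
    Tendsto (fun j => Real.log (V j * cycleWeight d β (K j)) / V j) atTop (𝓝 0) := by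
  have hlogV : Tendsto (fun j => Real.log (V j) / V j) atTop (𝓝 0) :=
    Real.isLittleO_log_id_atTop.tendsto_div_nhds_zero.comp hV
  have hlogK := hK.log hy.ne'
  set C := (4 * Real.pi * β) ^ ((d : ℝ) / 2)
  have hC : 0 < C := by positivity
  set p := 1 + (d : ℝ) / 2
  have hlim := (hlogV.sub (((hlogK.const_mul p).const_add (Real.log C)).div_atTop hV)).sub
    (hlogV.const_mul p)
  simp only [sub_zero, mul_zero] at hlim
  refine hlim.congr' ?_
  filter_upwards [hV.eventually_gt_atTop 0] with j hVj
  have hk := cast_pnat_pos (K j)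
  have hkp := Real.rpow_pos_of_pos hk p
  rw [cycleWeight, Real.log_mul hVj.ne' (one_div_pos.2 (mul_pos hC hkp)).ne', one_div,
    Real.log_inv, Real.log_mul hC.ne' hkp.ne', Real.log_rpow hk, Real.log_div hk.ne' hVj.ne']
  field_simp
  ring

end PoissonAsymptotics

section TrialConfigurations

variable {d : ℕ} {β a b μ : ℝ}

/-- The configuration with `⌊ν k V⌋` cycles of each length `k ∈ A`, whose cycle counts in volume `V`
approximate `ν` on `A`. -/
noncomputable def roundedConfig (A : Finset ℕ+) (ν : ℕ+ → ℝ) (V : ℝ) : CycleCounts :=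
  Finsupp.indicator A fun k _ => ⌊ν k * V⌋₊

theorem support_roundedConfig_subset (A : Finset ℕ+) (ν : ℕ+ → ℝ) (V : ℝ) :
    (roundedConfig A ν V).support ⊆ A :=
  Finsupp.support_indicator_subset _ _

theorem poissonWeight_roundedConfig (A : Finset ℕ+) (ν : ℕ+ → ℝ) (V : ℝ) (c : ℕ+ → ℝ) :
    poissonWeight c (roundedConfig A ν V) =
      ∏ k ∈ A, c k ^ ⌊ν k * V⌋₊ / (Nat.factorial ⌊ν k * V⌋₊ : ℝ) := by
  rw [poissonWeight,
    Finsupp.prod_of_support_subset _ (support_roundedConfig_subset A ν V) _ (by simp)]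
  exact Finset.prod_congr rfl fun k hk => by rw [roundedConfig, Finsupp.indicator_of_mem hk]

theorem shortDensity_roundedConfig {A : Finset ℕ+} {m : ℕ} (hA : ∀ k ∈ A, (k : ℕ) < m)
    (ν : ℕ+ → ℝ) (V : ℝ) : shortDensity V m (roundedConfig A ν V) =
      ∑ k ∈ A, ((k : ℕ) : ℝ) * ((⌊ν k * V⌋₊ : ℝ) / V) := by
  have hsub := support_roundedConfig_subset A ν V
  rw [shortDensity, Finset.filter_true_of_mem fun k hk => hA k (hsub hk)]
  refine Finset.sum_subset_zero_on_sdiff hsub (fun k hk => ?_) fun k hk => ?_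
  · rw [Finset.mem_sdiff, Finsupp.notMem_support_iff, roundedConfig] at hk
    rw [← Finsupp.indicator_of_mem hk.1 fun k _ => ⌊ν k * V⌋₊, hk.2]
    simp
  · rw [cycleDensity, roundedConfig, Finsupp.indicator_of_mem (hsub hk)]

theorem tendsto_shortDensity_roundedConfig {A : Finset ℕ+} {ν : ℕ+ → ℝ} (hν : ∀ k, 0 ≤ ν k)
    {V : ℕ → ℝ} {m : ℕ → ℕ} (hV : Tendsto V atTop atTop) (hm : Tendsto m atTop atTop) :
    Tendsto (fun j => shortDensity (V j) (m j) (roundedConfig A ν (V j))) atTop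
      (𝓝 (∑ k ∈ A, ((k : ℕ) : ℝ) * ν k)) := by
  refine (tendsto_finsetSum A fun k _ =>
    ((tendsto_nat_floor_mul_div_atTop (hν k)).comp hV).const_mul ((k : ℕ) : ℝ)).congr' ?_
  filter_upwards [hm.eventually_gt_atTop (A.sup PNat.val)] with j hj
  exact (shortDensity_roundedConfig (fun k hk => (Finset.le_sup (f := PNat.val) hk).trans_lt hj)
    ν (V j)).symm

theorem tendsto_log_poissonWeight_roundedConfig {q ν : ℕ+ → ℝ} (hq : ∀ k, 0 < q k)
    (hν : ∀ k, 0 < ν k) (A : Finset ℕ+) {V : ℕ → ℝ} (hV : Tendsto V atTop atTop) :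
    Tendsto (fun j => Real.log (poissonWeight (fun k => V j * q k) (roundedConfig A ν (V j))) / V j)
      atTop (𝓝 (∑ k ∈ A, ν k * (1 - Real.log (ν k / q k)))) := by
  refine (tendsto_finsetSum A fun k _ => tendsto_log_pow_div_factorial_div hV (hq k) (hν k)
    ((tendsto_nat_floor_mul_div_atTop (hν k).le).comp hV)).congr' ?_
  filter_upwards [hV.eventually_gt_atTop 0] with j hj
  rw [poissonWeight_roundedConfig, Real.log_prod, Finset.sum_div]
  exact fun k _ => (div_pos (pow_pos (mul_pos hj (hq k)) _)
    (Nat.cast_pos.2 (Nat.factorial_pos _))).ne'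

theorem disjoint_support_single {m : ℕ} {n : CycleCounts} {K : ℕ+}
    (hn : ∀ k ∈ n.support, (k : ℕ) < m) (hK : m ≤ (K : ℕ)) (c : ℕ) :
    Disjoint n.support (Finsupp.single K c).support :=
  Finset.disjoint_of_subset_right Finsupp.support_single_subset
    (Finset.disjoint_singleton_right.2 fun h => (hn K h).not_ge hK)

theorem sum_add_single {m : ℕ} {n : CycleCounts} {K : ℕ+} (hn : ∀ k ∈ n.support, (k : ℕ) < m)
    (hK : m ≤ (K : ℕ)) (c : ℕ) {g : ℕ+ → ℕ → ℝ} (hg : ∀ k, g k 0 = 0) :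
    (n + Finsupp.single K c).sum g = n.sum g + g K c := by
  rw [Finsupp.sum_add_index_of_disjoint (disjoint_support_single hn hK c),
    Finsupp.sum_single_index (hg K)]

theorem gibbsWeight_add_single {V : ℝ} {m : ℕ} {n : CycleCounts} {K : ℕ+}
    (hn : ∀ k ∈ n.support, (k : ℕ) < m) (hK : m ≤ (K : ℕ)) (c : ℕ) :
    gibbsWeight d β a b μ V m (n + Finsupp.single K c) =
      poissonWeight (fun k => V * cycleWeight d β k) n *
        ((V * cycleWeight d β K) ^ c / (Nat.factorial c : ℝ)) *
        Real.exp (β * V * (μ * (shortDensity V m n + (K : ℕ) * c / V)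
          - a / 2 * (shortDensity V m n + (K : ℕ) * c / V) ^ 2
          + b / 2 * ((K : ℕ) * c / V) ^ 2)) := by
  have hpoisson : poissonWeight (fun k => V * cycleWeight d β k) (n + Finsupp.single K c) =
      poissonWeight (fun k => V * cycleWeight d β k) n *
        ((V * cycleWeight d β K) ^ c / (Nat.factorial c : ℝ)) := by
    rw [poissonWeight, Finsupp.prod_add_index_of_disjoint (disjoint_support_single hn hK c),
      Finsupp.prod_single_index (by simp)]
    rfl
  have hshort : shortDensity V m (n + Finsupp.single K c) = shortDensity V m n := by
    simp only [shortDensity, Finset.sum_filter]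
    refine (sum_add_single hn hK c
      (g := fun k i => if (k : ℕ) < m then ((k : ℕ) : ℝ) * ((i : ℝ) / V) else 0) (by simp)).trans ?_
    rw [if_neg hK.not_gt, add_zero]
    rfl
  have hlong : longDensity V m (n + Finsupp.single K c) = (K : ℕ) * c / V := by
    simp only [longDensity, Finset.sum_filter]
    refine (sum_add_single hn hK c
      (g := fun k i => if m ≤ (k : ℕ) then ((k : ℕ) : ℝ) * ((i : ℝ) / V) else 0) (by simp)).trans ?_
    rw [if_pos hK, Finsupp.sum, Finset.sum_eq_zero fun k hk => if_neg (hn k hk).not_ge, zero_add,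
      mul_div_assoc]
  have hsquare : longSquare V m (n + Finsupp.single K c) = ((K : ℕ) * c / V) ^ 2 := by
    simp only [longSquare, Finset.sum_filter]
    refine (sum_add_single hn hK c (g := fun k i =>
      if m ≤ (k : ℕ) then ((k : ℕ) : ℝ) ^ 2 * ((i : ℝ) / V) ^ 2 else 0) (by simp)).trans ?_
    rw [if_pos hK, Finsupp.sum, Finset.sum_eq_zero fun k hk => if_neg (hn k hk).not_ge, zero_add,
      ← mul_pow, mul_div_assoc]
  rw [gibbsWeight, hpoisson, hshort, hlong, hsquare]

end TrialConfigurations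

section LowerBound

variable {d : ℕ} {β a b μ x y ε : ℝ} {κ : ℝ≥0∞} {V : ℕ → ℝ} {m : ℕ → ℕ}

theorem exists_tendsto_longCycle_div (hV : Tendsto V atTop atTop)
    (hratio : Tendsto (fun j => ENNReal.ofReal ((m j : ℝ) / V j)) atTop (𝓝 κ)) (hy : 0 ≤ y)
    (hκ : κ ≤ ENNReal.ofReal y) :
    ∃ K : ℕ → ℕ+, (∀ j, m j ≤ (K j : ℕ)) ∧
      Tendsto (fun j => ((K j : ℕ) : ℝ) / V j) atTop (𝓝 y) := by
  refine ⟨fun j => Nat.succPNat (max (m j) ⌈y * V j⌉₊), fun j =>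
    (le_max_left _ _).trans (Nat.le_succ _), ?_⟩
  have hcutoff : Tendsto (fun j => (m j : ℝ) / V j) atTop (𝓝 κ.toReal) := by
    refine ((ENNReal.tendsto_toReal (ne_top_of_le_ne_top ENNReal.ofReal_ne_top hκ)).comp
      hratio).congr' ?_
    filter_upwards [hV.eventually_gt_atTop 0] with j hj
    exact ENNReal.toReal_ofReal (by positivity)
  have hlim := (hcutoff.max ((tendsto_nat_ceil_mul_div_atTop hy).comp hV)).add
    ((tendsto_const_nhds (x := (1 : ℝ))).div_atTop hV)
  rw [max_eq_right (ENNReal.toReal_le_of_le_ofReal hy hκ), add_zero] at hlim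
  refine hlim.congr' ?_
  filter_upwards [hV.eventually_gt_atTop 0] with j hj
  rw [Nat.succPNat_coe, Nat.cast_succ, Nat.cast_max, add_div, ← max_div_div_right hj.le]
  rfl

-- A single cycle carries the whole long density, at subexponential cost.
theorem exists_longCycles (hβ : 0 < β) (hV : Tendsto V atTop atTop)
    (hratio : Tendsto (fun j => ENNReal.ofReal ((m j : ℝ) / V j)) atTop (𝓝 κ))
    (hz : (x, y) ∈ admissible κ) :
    ∃ (K : ℕ → ℕ+) (c : ℕ), (∀ j, m j ≤ (K j : ℕ)) ∧
      Tendsto (fun j => ((K j : ℕ) : ℝ) * c / V j) atTop (𝓝 y) ∧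
      Tendsto (fun j => Real.log ((V j * cycleWeight d β (K j)) ^ c / (Nat.factorial c : ℝ)) / V j)
        atTop (𝓝 0) := by
  have hy : 0 ≤ y := admissible_nonneg hz
  rcases hy.eq_or_lt with rfl | hypos
  · exact ⟨fun j => Nat.succPNat (m j), 0, fun j => Nat.le_succ _, by simp, by simp⟩
  · obtain ⟨K, hK, hKy⟩ :=
      exists_tendsto_longCycle_div hV hratio hy (hz.2.resolve_left hypos.ne').2
    exact ⟨K, 1, hK, by simpa using hKy,
      by simpa using tendsto_log_mul_cycleWeight_div hβ hV hypos hKy⟩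

theorem exists_shortConfigs (hd : 1 ≤ d) (hβ : 0 < β) (hV : Tendsto V atTop atTop)
    (hm : Tendsto m atTop atTop) (hx : 0 < x) (hε : 0 < ε) :
    ∃ (n : ℕ → CycleCounts) (L : ℝ), (∀ᶠ j in atTop, ∀ k ∈ (n j).support, (k : ℕ) < m j) ∧
      Tendsto (fun j => shortDensity (V j) (m j) (n j)) atTop (𝓝 x) ∧
      Tendsto (fun j => Real.log (poissonWeight (fun k => V j * cycleWeight d β k) (n j)) / V j)
        atTop (𝓝 L) ∧
      -(β * (gasFreeEnergy d β x + ε)) ≤ L := by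
  obtain ⟨A, s, hAx, hAf⟩ := exists_finset_tilt hd hβ hx hε
  set ν : ℕ+ → ℝ := fun k => cycleWeight d β k * Real.exp (β * s * (k : ℕ))
  have hν (k) : 0 < ν k := mul_pos (cycleWeight_pos hβ k) (Real.exp_pos _)
  have hdensity : ∑ k ∈ A, ((k : ℕ) : ℝ) * ν k = x := by simp only [ν, ← mul_assoc, hAx]
  have hentropy : ∑ k ∈ A, ν k * (1 - Real.log (ν k / cycleWeight d β k)) =
      ∑ k ∈ A, ν k - β * s * x := by
    rw [← hdensity, Finset.mul_sum, ← Finset.sum_sub_distrib]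
    refine Finset.sum_congr rfl fun k _ => ?_
    rw [mul_div_cancel_left₀ _ (cycleWeight_pos hβ k).ne', Real.log_exp]
    ring
  refine ⟨fun j => roundedConfig A ν (V j), ∑ k ∈ A, ν k - β * s * x, ?_,
    hdensity ▸ tendsto_shortDensity_roundedConfig (fun k => (hν k).le) hV hm,
    hentropy ▸ tendsto_log_poissonWeight_roundedConfig (cycleWeight_pos hβ) hν A hV, ?_⟩
  · filter_upwards [hm.eventually_gt_atTop (A.sup PNat.val)] with j hj k hk
    exact (Finset.le_sup (f := PNat.val) (support_roundedConfig_subset _ _ _ hk)).trans_lt hj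
  · have hscaled := mul_le_mul_of_nonneg_left hAf hβ.le
    rw [mul_sub, ← mul_assoc, ← mul_assoc, mul_one_div_cancel hβ.ne', one_mul] at hscaled
    linarith

theorem tendsto_log_gibbsWeight_add_single_div (hβ : 0 < β) (hV : Tendsto V atTop atTop)
    {n : ℕ → CycleCounts} {K : ℕ → ℕ+} {c : ℕ} {L : ℝ}
    (hn : ∀ᶠ j in atTop, ∀ k ∈ (n j).support, (k : ℕ) < m j) (hK : ∀ j, m j ≤ (K j : ℕ))
    (hshort : Tendsto (fun j => shortDensity (V j) (m j) (n j)) atTop (𝓝 x))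
    (hlong : Tendsto (fun j => ((K j : ℕ) : ℝ) * c / V j) atTop (𝓝 y))
    (hshortWeight : Tendsto
      (fun j => Real.log (poissonWeight (fun k => V j * cycleWeight d β k) (n j)) / V j)
      atTop (𝓝 L))
    (hlongWeight : Tendsto
      (fun j => Real.log ((V j * cycleWeight d β (K j)) ^ c / (Nat.factorial c : ℝ)) / V j)
      atTop (𝓝 0)) :
    Tendsto (fun j =>
        Real.log (gibbsWeight d β a b μ (V j) (m j) (n j + Finsupp.single (K j) c)) / V j) atTop
      (𝓝 (L + β * (μ * (x + y) - a / 2 * (x + y) ^ 2 + b / 2 * y ^ 2))) := by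
  have htotal := hshort.add hlong
  have hlim := (hshortWeight.add hlongWeight).add (((htotal.const_mul μ).sub
    ((htotal.pow 2).const_mul (a / 2)) |>.add ((hlong.pow 2).const_mul (b / 2))).const_mul β)
  rw [add_zero] at hlim
  refine hlim.congr' ?_
  filter_upwards [hn, hV.eventually_gt_atTop 0] with j hnj hVj
  have hpoisson := poissonWeight_cycleWeight_pos (d := d) hβ hVj (n j)
  have hcycles : 0 < (V j * cycleWeight d β (K j)) ^ c / (Nat.factorial c : ℝ) :=
    div_pos (pow_pos (mul_pos hVj (cycleWeight_pos hβ _)) _) (Nat.cast_pos.2 c.factorial_pos)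
  rw [gibbsWeight_add_single hnj (hK j), Real.log_mul (mul_pos hpoisson hcycles).ne'
    (Real.exp_ne_zero _), Real.log_mul hpoisson.ne' hcycles.ne', Real.log_exp, add_div, add_div,
    mul_comm β (V j), mul_assoc (V j), mul_div_cancel_left₀ _ hVj.ne']

theorem eventually_exp_energy_le_tsum_gibbsWeight (hd : 1 ≤ d) (hβ : 0 < β)
    (hV : Tendsto V atTop atTop) (hm : Tendsto m atTop atTop)
    (hratio : Tendsto (fun j => ENNReal.ofReal ((m j : ℝ) / V j)) atTop (𝓝 κ))
    (hz : (x, y) ∈ admissible κ) (hx : 0 < x) (hε : 0 < ε) :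
    ∀ᶠ j in atTop, ENNReal.ofReal (Real.exp (-(β * V j * (energy d β a b μ (x, y) + ε)))) ≤
      ∑' n, ENNReal.ofReal (gibbsWeight d β a b μ (V j) (m j) n) := by
  obtain ⟨n, L, hn, hshort, hshortWeight, hL⟩ :=
    exists_shortConfigs hd hβ hV hm hx (half_pos hε)
  obtain ⟨K, c, hK, hlong, hlongWeight⟩ := exists_longCycles (d := d) hβ hV hratio hz
  have hlim := tendsto_log_gibbsWeight_add_single_div (a := a) (b := b) (μ := μ) hβ hV hn hK
    hshort hlong hshortWeight hlongWeight
  have hlt : -(β * (energy d β a b μ (x, y) + ε)) <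
      L + β * (μ * (x + y) - a / 2 * (x + y) ^ 2 + b / 2 * y ^ 2) := by
    have := mul_pos hβ hε
    unfold energy
    linarith
  filter_upwards [hlim.eventually_const_lt hlt, hV.eventually_gt_atTop 0] with j hj hVj
  refine le_trans (ENNReal.ofReal_le_ofReal ?_)
    (ENNReal.le_tsum (n j + Finsupp.single (K j) c))
  rw [lt_div_iff₀ hVj] at hj
  rw [← Real.le_log_iff_exp_le (gibbsWeight_pos hβ hVj _)]
  linarith

end LowerBound

section EnergyGap

variable {d : ℕ} {β a b μ : ℝ} {κ : ℝ≥0∞} {r : ℕ → ℝ} {z : ℝ × ℝ} {C : Set (ℝ × ℝ)}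

theorem mem_admissible_of_tendsto {ι : Type*} {l : Filter ι} [l.NeBot] {r : ι → ℝ}
    {w : ι → ℝ × ℝ} (hr : Tendsto (fun i => ENNReal.ofReal (r i)) l (𝓝 κ))
    (hw : Tendsto w l (𝓝 z)) (hfst : ∀ i, 0 ≤ (w i).1) (hsnd : ∀ i, 0 ≤ (w i).2)
    (hcut : ∀ i, (w i).2 = 0 ∨ r i ≤ (w i).2) : z ∈ admissible κ := by
  have hlim : Tendsto (fun i => (w i).2) l (𝓝 z.2) := (continuous_snd.tendsto z).comp hw
  refine ⟨ge_of_tendsto' ((continuous_fst.tendsto z).comp hw) hfst, or_iff_not_imp_left.2 fun hz =>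
    ⟨ge_of_tendsto' hlim hsnd,
      le_of_tendsto_of_tendsto hr ((ENNReal.continuous_ofReal.tendsto _).comp hlim) ?_⟩⟩
  filter_upwards [hlim.eventually_ne hz] with i hi
  exact ENNReal.ofReal_le_ofReal ((hcut i).resolve_left hi)

theorem exists_gap_of_add_le (hd : 1 ≤ d) (hβ : 0 < β)
    (hr : Tendsto (fun j => ENNReal.ofReal (r j)) atTop (𝓝 κ))
    (hz : minimisers d β a b μ κ = {z}) (hC : IsClosed C) (hzC : z ∉ C) (R : ℝ) :
    ∃ η > 0, ∀ᶠ j in atTop, ∀ w ∈ C, 0 ≤ w.1 → 0 ≤ w.2 → w.1 + w.2 ≤ R →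
      (w.2 = 0 ∨ r j ≤ w.2) → energy d β a b μ z + η ≤ energy d β a b μ w := by
  by_contra! hcon
  obtain ⟨φ, hφ, hφw⟩ := extraction_forall_of_frequently fun i : ℕ =>
    hcon (1 / ((i : ℝ) + 1)) Nat.one_div_pos_of_nat
  choose w hwC hfst hsnd hwR hcut hwE using hφw
  obtain ⟨v, -, ψ, hψ, hlim⟩ := (isCompact_Icc (a := ((0 : ℝ), (0 : ℝ)))
    (b := (R, R))).tendsto_subseq (x := w) fun i =>
      ⟨⟨hfst i, hsnd i⟩, ⟨by linarith [hwR i, hsnd i], by linarith [hwR i, hfst i]⟩⟩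
  have hv : v ∈ admissible κ := mem_admissible_of_tendsto
    (hr.comp (hφ.tendsto_atTop.comp hψ.tendsto_atTop)) hlim (fun i => hfst _) (fun i => hsnd _)
    fun i => hcut _
  have hEv : energy d β a b μ v ≤ energy d β a b μ z := by
    have henergy := ((continuousOn_energy (a := a) (b := b) (μ := μ) hd hβ) v hv.1).tendsto.comp
      (tendsto_nhdsWithin_iff.2 ⟨hlim, Eventually.of_forall fun i => hfst (ψ i)⟩)
    have hbound := ((tendsto_one_div_add_atTop_nhds_zero_nat (𝕜 := ℝ)).comp
      hψ.tendsto_atTop).const_add (energy d β a b μ z)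
    rw [add_zero] at hbound
    exact le_of_tendsto_of_tendsto' henergy hbound fun i => (hwE (ψ i)).le
  have hzmin : z ∈ minimisers d β a b μ κ := hz ▸ rfl
  have hvz : v ∈ minimisers d β a b μ κ :=
    ⟨hv, isMinOn_iff.2 fun u hu => hEv.trans (isMinOn_iff.1 hzmin.2 u hu)⟩
  rw [hz] at hvz
  exact hzC (hvz ▸ hC.mem_of_tendsto hlim (Eventually.of_forall fun i => hwC _))

theorem exists_energy_gap (hd : 1 ≤ d) (hβ : 0 < β) (hb : 0 < b) (hab : b < a)
    (hr : Tendsto (fun j => ENNReal.ofReal (r j)) atTop (𝓝 κ))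
    (hz : minimisers d β a b μ κ = {z}) (hC : IsClosed C) (hzC : z ∉ C) :
    ∃ η > 0, ∃ τ > 0, ∀ᶠ j in atTop, ∀ w ∈ C, 0 ≤ w.1 → 0 ≤ w.2 → (w.2 = 0 ∨ r j ≤ w.2) →
      energy d β a b μ z + η + τ * w.1 ≤ energy d β a b μ w := by
  obtain ⟨R, hR, hfar⟩ := exists_add_le_energy (d := d) hβ hb hab μ (energy d β a b μ z + 1)
  obtain ⟨η, hη, hnear⟩ := exists_gap_of_add_le hd hβ hr hz hC hzC R
  refine ⟨min (η / 2) 1, by positivity, min (η / (2 * R)) 1, by positivity, ?_⟩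
  filter_upwards [hnear] with j hj w hwC hfst hsnd hcut
  rcases le_or_gt (w.1 + w.2) R with hle | hgt
  · have hslope : min (η / (2 * R)) 1 * w.1 ≤ η / (2 * R) * R :=
      mul_le_mul (min_le_left _ _) (by linarith) hfst (by positivity)
    have hhalf : η / (2 * R) * R = η / 2 := by field_simp
    linarith [hj w hwC hfst hsnd hle hcut, min_le_left (η / 2) 1]
  · have hslope := mul_le_mul_of_nonneg_right (min_le_right (η / (2 * R)) 1) hfst
    linarith [hfar w hfst hsnd hgt.le, min_le_right (η / 2) 1]

theorem exists_add_fst_le_energy (hβ : 0 < β) (hb : 0 < b) (hab : b < a) (μ : ℝ) :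
    ∃ c : ℝ, ∀ z : ℝ × ℝ, 0 ≤ z.1 → 0 ≤ z.2 → c + z.1 ≤ energy d β a b μ z := by
  have hab' : 0 < a - b := sub_pos.2 hab
  refine ⟨-gasPressure d β 0 - (μ + 1) ^ 2 / (2 * (a - b)), fun z hfst hsnd => ?_⟩
  have hsquare : 0 ≤ ((a - b) * (z.1 + z.2) - (μ + 1)) ^ 2 / (2 * (a - b)) := by positivity
  have hexpand : ((a - b) * (z.1 + z.2) - (μ + 1)) ^ 2 / (2 * (a - b)) =
      (a - b) / 2 * (z.1 + z.2) ^ 2 - (μ + 1) * (z.1 + z.2) + (μ + 1) ^ 2 / (2 * (a - b)) := by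
    field_simp
    ring
  linarith [quadratic_le_energy (d := d) (a := a) (μ := μ) hβ hb hfst hsnd]

end EnergyGap

section Concentration

variable {d : ℕ} {β a b α μ V x y : ℝ} {m : ℕ} {κ : ℝ≥0∞}

theorem tsum_gibbsWeight_ne_top (hd : 1 ≤ d) (hβ : 0 < β) (hb : 0 < b) (hab : b < a)
    (hV : 0 < V) : ∑' n, ENNReal.ofReal (gibbsWeight d β a b μ V m n) ≠ ⊤ := by
  obtain ⟨c, hc⟩ := exists_add_fst_le_energy (d := d) hβ hb hab μ
  have hle := tsum_indicator_gibbsWeight_le (a := a) (μ := μ) (m := m) hd hβ hb.le hV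
    (S := Set.univ) (c := c) zero_lt_one fun n _ => by
      simpa only [one_mul] using hc (shortDensity V m n, longDensity V m n)
        (shortDensity_nonneg hV.le n) (longDensity_nonneg hV.le n)
  rw [Set.indicator_univ] at hle
  exact ne_top_of_le_ne_top ENNReal.ofReal_ne_top hle

theorem tsum_gibbsWeight_ne_zero (hβ : 0 < β) (hV : 0 < V) :
    ∑' n, ENNReal.ofReal (gibbsWeight d β a b μ V m n) ≠ 0 := fun h =>
  (ENNReal.ofReal_pos.2 (gibbsWeight_pos hβ hV 0)).ne' (ENNReal.tsum_eq_zero.1 h 0)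

theorem isProbabilityMeasure_gibbsMeasure (hd : 1 ≤ d) (hβ : 0 < β) (hb : 0 < b) (hab : b < a)
    (hV : 0 < V) : IsProbabilityMeasure (gibbsMeasure d β a b α μ V m) := by
  have hfin := tsum_gibbsWeight_ne_top (μ := μ) (m := m) hd hβ hb hab hV
  exact ⟨by rw [gibbsMeasure_apply hβ hV hfin, Set.indicator_univ,
    ENNReal.div_self (tsum_gibbsWeight_ne_zero hβ hV) hfin]⟩

-- A Chernoff bound: the slack `τ x` in the energy makes the sum over configurations converge.
theorem gibbsMeasure_le (hd : 1 ≤ d) (hβ : 0 < β) (hb : 0 < b) (hab : b < a) (hV : 0 < V)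
    {S : Set CycleCounts} {c e τ : ℝ} (hτ : 0 < τ)
    (hZ : ENNReal.ofReal (Real.exp (-(β * V * e))) ≤
      ∑' n, ENNReal.ofReal (gibbsWeight d β a b μ V m n))
    (hS : ∀ n ∈ S, c + τ * shortDensity V m n ≤
      energy d β a b μ (shortDensity V m n, longDensity V m n)) :
    gibbsMeasure d β a b α μ V m S ≤ ENNReal.ofReal
      (Real.exp (V * (tailWeight d β m - β * (c - e)) + 1) * (1 - Real.exp (-(β * τ)))⁻¹) := by
  rw [gibbsMeasure_apply hβ hV (tsum_gibbsWeight_ne_top hd hβ hb hab hV)]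
  refine (ENNReal.div_le_div (tsum_indicator_gibbsWeight_le hd hβ hb.le hV hτ hS) hZ).trans_eq ?_
  rw [← ENNReal.ofReal_div_of_pos (Real.exp_pos _), mul_div_right_comm, ← Real.exp_sub]
  ring_nf

theorem isClosed_setOf_notMem_ball (x y δ : ℝ) :
    IsClosed {w : ℝ × ℝ | !₂[w.1, w.2] ∉ Metric.ball (!₂[x, y] : EuclideanSpace ℝ (Fin 2)) δ} := by
  have hcont : Continuous fun w : ℝ × ℝ => (!₂[w.1, w.2] : EuclideanSpace ℝ (Fin 2)) := by
    fun_prop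
  exact (Metric.isOpen_ball.preimage hcont).isClosed_compl

theorem tendsto_gibbsMeasure_compl_ball (hd : 1 ≤ d) (hβ : 0 < β) (hb : 0 < b) (hab : b < a)
    (hz : minimisers d β a b μ κ = {(x, y)}) {V : ℕ → ℝ} {m : ℕ → ℕ} (hV : Tendsto V atTop atTop)
    (hm : Tendsto m atTop atTop)
    (hratio : Tendsto (fun j => ENNReal.ofReal ((m j : ℝ) / V j)) atTop (𝓝 κ))
    {δ : ℝ} (hδ : 0 < δ) :
    Tendsto (fun j => gibbsMeasure d β a b α μ (V j) (m j)
      {n | pairDensity (V j) (m j) n ∈ Metric.ball !₂[x, y] δ}ᶜ) atTop (𝓝 0) := by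
  have hzmin : (x, y) ∈ minimisers d β a b μ κ := hz ▸ rfl
  obtain ⟨η, hη, τ, hτ, hgap⟩ := exists_energy_gap hd hβ hb hab hratio hz
    (isClosed_setOf_notMem_ball x y δ) (fun h => h (Metric.mem_ball_self hδ))
  have hlower := eventually_exp_energy_le_tsum_gibbsWeight (a := a) (b := b) (μ := μ) hd hβ hV hm
    hratio hzmin.1 (fst_pos_of_mem_minimisers hd hβ hzmin) (half_pos hη)
  have hrate : Tendsto (fun j => tailWeight d β (m j) -
      β * (energy d β a b μ (x, y) + η - (energy d β a b μ (x, y) + η / 2))) atTop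
      (𝓝 (0 - β * (η / 2))) := by
    rw [add_sub_add_left_eq_sub, sub_half]
    exact ((tendsto_tailWeight hd hβ).comp hm).sub_const _
  have hneg : 0 - β * (η / 2) < 0 := by linarith [mul_pos hβ (half_pos hη)]
  have hbound := ENNReal.tendsto_ofReal ((Real.tendsto_exp_atBot.comp
    (tendsto_atBot_add_const_right _ 1 (hV.atTop_mul_neg hneg hrate))).mul_const
      (1 - Real.exp (-(β * τ)))⁻¹)
  rw [zero_mul, ENNReal.ofReal_zero] at hbound
  refine tendsto_of_tendsto_of_tendsto_of_le_of_le' tendsto_const_nhds hbound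
    (Eventually.of_forall fun _ => zero_le) ?_
  filter_upwards [hgap, hlower, hV.eventually_gt_atTop 0] with j hj hZ hVj
  exact gibbsMeasure_le hd hβ hb hab hVj hτ hZ fun n hn => hj (_, _) hn
    (shortDensity_nonneg hVj.le n) (longDensity_nonneg hVj.le n)
    (longDensity_eq_zero_or_le hVj.le n)

theorem pairDensityConcentratesAt_of_minimisers (hd : 1 ≤ d) (hβ : 0 < β) (hb : 0 < b)
    (hab : b < a) (hz : minimisers d β a b μ κ = {(x, y)}) :
    PairDensityConcentratesAt d β a b α μ κ x y := by
  intro ℓ m hseq δ hδ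
  have hcompl := tendsto_gibbsMeasure_compl_ball (α := α) hd hβ hb hab hz hseq.tendsto_volume
    hseq.tendsto_cutoff hseq.tendsto_ratio hδ
  have hsub := ENNReal.Tendsto.sub (tendsto_const_nhds (x := (1 : ℝ≥0∞))) hcompl
    (Or.inl ENNReal.one_ne_top)
  rw [tsub_zero] at hsub
  refine hsub.congr' ?_
  filter_upwards [hseq.tendsto_volume.eventually_gt_atTop 0] with j hj
  have := isProbabilityMeasure_gibbsMeasure (α := α) (μ := μ) (m := m j) hd hβ hb hab hj
  rw [← prob_compl_eq_one_sub MeasurableSpace.measurableSet_top, compl_compl]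

end Concentration

end HYL

theorem mainTheorem7 (d : ℕ) (hd : 1 ≤ d) (β a b : ℝ) (hβ : 0 < β) (hb : 0 < b) (hab : b < a) :
    -- concentration at the zero of the rate function whenever that zero is unique
    (∀ (κ : ℝ≥0∞) (μ α x y : ℝ), α < 0 → HYL.zeroes d β a b μ κ = {(x, y)} →
      HYL.PairDensityConcentratesAt d β a b α μ κ x y) ∧
    -- the zero is unique for all `μ` when `κ = ∞`
    (∀ μ : ℝ, HYL.zeroes d β a b μ ⊤ = {(HYL.xOne d β a μ, 0)}) ∧
    -- the zero is unique for `μ ≠ μ*` when `κ = 0`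
    ∃ μstar : ℝ, HYL.muT d β a b ≤ μstar ∧ (μstar : EReal) ≤ (HYL.muC d β a : EReal) ∧
      (∀ μ : ℝ, μ < μstar → HYL.zeroes d β a b μ 0 = {(HYL.xOne d β a μ, 0)}) ∧
      (∀ μ : ℝ, μstar < μ → HYL.zeroes d β a b μ 0 =
        {(HYL.xTwo d β a b μ, (μ - a * HYL.xTwo d β a b μ) / (a - b))}) ∧
      -- the zero is unique for `μ ≠ μ*_κ` when `0 < κ < ∞`
      ∀ κ : ℝ, 0 < κ → ∃ μstarκ : ℝ,
        (HYL.muR d β a b κ ≤ μstar → μstarκ = μstar) ∧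
        (μstar < HYL.muR d β a b κ → μstar < μstarκ ∧ μstarκ < HYL.muR d β a b κ) ∧
        (∀ μ : ℝ, μ < μstarκ →
          HYL.zeroes d β a b μ (ENNReal.ofReal κ) = {(HYL.xOne d β a μ, 0)}) ∧
        (∀ μ : ℝ, μstarκ < μ → μ ≤ HYL.muR d β a b κ →
          HYL.zeroes d β a b μ (ENNReal.ofReal κ) = {(HYL.xThree d β a κ μ, κ)}) ∧
        (∀ μ : ℝ, μstarκ < μ → HYL.muR d β a b κ ≤ μ →
          HYL.zeroes d β a b μ (ENNReal.ofReal κ) =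
            {(HYL.xTwo d β a b μ, (μ - a * HYL.xTwo d β a b μ) / (a - b))}) := by
  simp only [HYL.zeroes_eq_minimisers hd hβ]
  refine ⟨fun κ μ α x y _ hz => HYL.pairDensityConcentratesAt_of_minimisers hd hβ hb hab hz,
    HYL.minimisers_top hd hβ hb hab, HYL.transitionPoint d β a b,
    HYL.muT_le_transitionPoint hd hβ hb hab, HYL.transitionPoint_le_muC hd hβ hb hab,
    fun μ hμ => HYL.minimisers_zero_of_lt hd hβ hb hab hμ,
    fun μ hμ => HYL.minimisers_zero_of_gt hd hβ hb hab hμ,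
    fun κ hκ => HYL.exists_transition_ofReal hd hβ hb hab hκ⟩
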